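/- **Setting.** Let $H$ be a separable complex Hilbert space. Call a pair $(A,B)$ of (in general unbounded) selfadjoint operators on $H$ *admissible* if $D(A)\cap D(B)$ is dense in $H$, the closure $C$ of $A+iB$ (defined on $D(A)\cap D(B)$) satisfies $C=(A-iB)^*$, and $\Delta^{-1}$ is compact, where $\Delta=1+(A+iB)(A-iB)$, i.e. $\Delta=1+CC^*$. A bounded operator $K$ on $H$ is the commutator $[A,B]$ if $$\langle A\varphi,B\psi\rangle-\langle B\varphi,A\psi\rangle=\langle\varphi,K\psi\rangle\qquad\text{for all }\varphi,\psi\in D(A)\cap D(B)$$ (so that $K\psi=AB\psi-BA\psi$ whenever $\psi\in D(AB)\cap D(BA)$). **The invariant.** Let $$Q=Q(A,B)=\begin{pmatrix}\Delta^{-1}&C\Delta^{-1}\\ \Delta^{-1}C^*&1-\Delta^{-1}\end{pmatrix}$$ on $H\oplus H$, with $\Delta^{-1}C^*$ extended to a bounded operator on $H$. For an orthonormal basis $(e_i)_{i\in I}$ of $H$ and a finite set $F\subset I$ put $L_F=\mathrm{span}\{e_i:i\in F\}$, let $q_{11}$ be the compression of $Q$ to $L_F\oplus L_F$ and let $M_F$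 be the number of eigenvalues of $q_{11}$ greater than $1/2$, counted with multiplicity. We say that $\omega(A,B)$ is defined and equal to $w\in\mathbb Z$ if the entries of $Q$ are bounded, $\|Q^2-Q\|<1/4$, and for every orthonormal basis and all sufficiently large finite $F$ (all $F$ containing some finite $F_0$; in particular $F=\{1,\dots,N\}$ with $N$ large for a basis $e_1,e_2,\dots$) one has $\|q_{11}^2-q_{11}\|<1/4$ and $M_F-|F|=w$, and $w$ is the only integer with this property. For an admissible pair with a bounded commutator of arbitrary norm, $\omega(A,B)$ is defined by scaling, as the common value of $\omega(\lambda A,\mu B)$ over all $\lambda,\mu>0$ with $\|[\lambda A,\mu B]\|<0.02$. **Convergence.** Let $A_n$ be closed symmetric operators with $D(A)\subseteq D(A_n)$. We write $A_n\to A$ if there are real sequences $a_n\to0$, $b_n\to0$ such that $\|(A_n-A)\varphi\|\le a_n\|A\varphi\|+b_n\|\varphi\|$ for all $\varphi\in D(A)$ and all $n$. **Theorem.** Let $(A,B)$ be an admissible pair with bounded commutator $[A,B]$, let $A_n\to A$ and $B_m\to B$, and suppose that for all large $n,m$ the pair $(A_n,B_m)$ has a bounded commutator $[A_n,B_m]$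 and that $[A_n,B_m]\to[A,B]$ in operator norm as $n,m\to\infty$. If $\|[A,B]\|<0.02$, then $\omega(A,B)$ is defined, and for all sufficiently large $n$ and $m$ the pair $(A_n,B_m)$ is admissible, $\omega(A_n,B_m)$ is defined, and $$\omega(A_n,B_m)=\omega(A,B).$$ **Corollary.** Let $(A,B)$ be an admissible pair with bounded commutator (of arbitrary norm) and let $T$ be a bounded selfadjoint operator on $H$ commuting with $B$ (i.e. $TB\subseteq BT$). Then $(A+T,B)$ is admissible with $[A+T,B]=[A,B]$, the invariants $\omega(A,B)$ and $\omega(A+T,B)$ (defined by scaling) are defined, and $$\omega(A+T,B)=\omega(A,B).$$ -/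

import Mathlib

open Filter Topology
open scoped LinearPMap

namespace OperatorPair

noncomputable section

variable {H : Type*} [NormedAddCommGroup H] [InnerProductSpace ℂ H]

section Operators

variable [CompleteSpace H]

/-- The closure `C` of the operator `A + iB`, which has domain `D(A) ∩ D(B)`. -/
def opC (A B : H →ₗ.[ℂ] H) : H →ₗ.[ℂ] H := (A + Complex.I • B).closure

/-- `S` is the (everywhere defined, bounded) two-sided inverse of `Δ = 1 + C C†`, whose domain
consists of the `u ∈ D(C†)` with `C† u ∈ D(C)`. -/
structure IsDeltaInv (A B : H →ₗ.[ℂ] H) (S : H →L[ℂ] H) : Prop where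
  right_inv : ∀ x : H, ∃ y : H, (S x, y) ∈ (opC A B)†.graph ∧ (y, x - S x) ∈ (opC A B).graph
  left_inv : ∀ u y z : H, (u, y) ∈ (opC A B)†.graph → (y, z) ∈ (opC A B).graph → S (u + z) = u

/-- The standing assumptions on a pair of unbounded operators: `A` and `B` are self-adjoint,
`D(A) ∩ D(B)` is dense, the closure `C` of `A + iB` is the adjoint of `A - iB`, and the inverse of
`Δ = 1 + C C†` is compact. -/
structure IsAdmissible (A B : H →ₗ.[ℂ] H) : Prop where
  selfAdjoint_left : IsSelfAdjoint A
  selfAdjoint_right : IsSelfAdjoint B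
  dense_domain : Dense ((A.domain ⊓ B.domain : Submodule ℂ H) : Set H)
  closure_eq_adjoint : opC A B = (A - Complex.I • B)†
  compact_inv : ∃ S : H →L[ℂ] H, IsDeltaInv A B S ∧ IsCompactOperator S

/-- The bounded operator `K` is the commutator `[A, B]`:
`⟨A x, B y⟩ - ⟨B x, A y⟩ = ⟨x, K y⟩` for all `x, y ∈ D(A) ∩ D(B)`. -/
def IsCommutator (A B : H →ₗ.[ℂ] H) (K : H →L[ℂ] H) : Prop :=
  ∀ (x y : H) (hxA : x ∈ A.domain) (hxB : x ∈ B.domain) (hyA : y ∈ A.domain)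
    (hyB : y ∈ B.domain),
    inner ℂ (A ⟨x, hxA⟩) (B ⟨y, hyB⟩) - inner ℂ (B ⟨x, hxB⟩) (A ⟨y, hyA⟩) = inner ℂ x (K y)

/-- Where the compositions `AB` and `BA` are both defined, `[A, B]` is `AB - BA`. -/
theorem IsCommutator.apply_eq {A B : H →ₗ.[ℂ] H} {K : H →L[ℂ] H} (hK : IsCommutator A B K)
    (hAB : IsAdmissible A B) (y : H) (hyA : y ∈ A.domain) (hyB : y ∈ B.domain)
    (hAy : A ⟨y, hyA⟩ ∈ B.domain) (hBy : B ⟨y, hyB⟩ ∈ A.domain) :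
    K y = A ⟨B ⟨y, hyB⟩, hBy⟩ - B ⟨A ⟨y, hyA⟩, hAy⟩ := by
  have symm : ∀ {T : H →ₗ.[ℂ] H}, IsSelfAdjoint T → T.IsFormalAdjoint T := fun {T} hT => by
    have h := LinearPMap.adjoint_isFormalAdjoint (T := T) hT.dense_domain
    rwa [LinearPMap.isSelfAdjoint_def.mp hT] at h
  refine hAB.dense_domain.eq_of_inner_right ℂ fun x hx => ?_
  have hx' : x ∈ A.domain ∧ x ∈ B.domain := hx
  rw [← hK x y hx'.1 hx'.2 hyA hyB, inner_sub_right]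
  have h1 := symm hAB.selfAdjoint_left ⟨x, hx'.1⟩ ⟨B ⟨y, hyB⟩, hBy⟩
  have h2 := symm hAB.selfAdjoint_right ⟨x, hx'.2⟩ ⟨A ⟨y, hyA⟩, hAy⟩
  rw [h1, h2]

/-- `Q` is the bounded operator on `H ⊕ H` with the block matrix
`(Δ⁻¹, C Δ⁻¹; Δ⁻¹ C†, 1 - Δ⁻¹)`, where `Δ⁻¹ C†` stands for its bounded extension to `H`. -/
def IsBottOperator (A B : H →ₗ.[ℂ] H)
    (Q : WithLp 2 (H × H) →L[ℂ] WithLp 2 (H × H)) : Prop :=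
  ∃ S G G' : H →L[ℂ] H, IsDeltaInv A B S ∧
    (∀ x : H, (S x, G x) ∈ (opC A B).graph) ∧
    (∀ x y : H, (x, y) ∈ (opC A B)†.graph → G' x = S y) ∧
    ∀ u v : H, Q (WithLp.toLp 2 (u, v)) = WithLp.toLp 2 (S u + G v, G' u + (v - S v))

end Operators

section Truncation

/-- The subspace `L ⊕ L` of `H ⊕ H`, where `L` is spanned by the vectors `e i`, `i ∈ F`. -/
def truncSpace {ι : Type} (e : ι → H) (F : Finset ι) : Submodule ℂ (WithLp 2 (H × H)) :=
  ((Submodule.span ℂ (e '' (F : Set ι))).prod (Submodule.span ℂ (e '' (F : Set ι)))).map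
    (WithLp.linearEquiv 2 ℂ (H × H)).symm.toLinearMap

instance finiteDimensional_truncSpace {ι : Type} (e : ι → H) (F : Finset ι) :
    FiniteDimensional ℂ (truncSpace e F) := by
  have hfin : (e '' (F : Set ι)).Finite := F.finite_toSet.image e
  have h : (Submodule.span ℂ (e '' (F : Set ι))).FG := Submodule.fg_span hfin
  exact Module.Finite.iff_fg.mpr ((h.prod h).map _)

/-- The compression `q₁₁` of `Q` to a finite-dimensional subspace `L`. -/
def compression (Q : WithLp 2 (H × H) →L[ℂ] WithLp 2 (H × H))
    (L : Submodule ℂ (WithLp 2 (H × H))) [FiniteDimensional ℂ L] : L →L[ℂ] L :=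
  L.orthogonalProjectionOnto ∘L Q ∘L L.subtypeL

/-- The number of eigenvalues greater than `1/2` of an operator on a finite-dimensional space,
counted with multiplicity. -/
def numEigenvaluesAboveHalf {L : Type*} [NormedAddCommGroup L] [NormedSpace ℂ L]
    [FiniteDimensional ℂ L] (q : L →L[ℂ] L) : ℕ :=
  (((q : L →ₗ[ℂ] L).charpoly.roots).filter fun z : ℂ => 1 / 2 < z.re).card

end Truncation

section Invariant

variable [CompleteSpace H]

/-- The number `ω(A, B)` is defined by means of `Q(A, B)` itself and equals `w`: `Q` is an almost
projection, `‖Q² - Q‖ < 1/4`, and for every orthonormal basis and every sufficiently large finite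
set `F` of basis vectors, the corresponding compression `q₁₁` of `Q` is an almost projection and
has exactly `|F| + w` eigenvalues greater than `1/2`. -/
def HasOmega (A B : H →ₗ.[ℂ] H) (w : ℤ) : Prop :=
  ∃ Q : WithLp 2 (H × H) →L[ℂ] WithLp 2 (H × H), IsBottOperator A B Q ∧ ‖Q * Q - Q‖ < 1 / 4 ∧
    ∀ (ι : Type) (b : HilbertBasis ι ℂ H), ∀ᶠ F : Finset ι in atTop,
      ‖compression Q (truncSpace b F) * compression Q (truncSpace b F)
          - compression Q (truncSpace b F)‖ < 1 / 4 ∧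
      (numEigenvaluesAboveHalf (compression Q (truncSpace b F)) : ℤ) - (F.card : ℤ) = w

/-- `ω(A, B)` is well defined. -/
def OmegaDefined (A B : H →ₗ.[ℂ] H) : Prop := ∃! w : ℤ, HasOmega A B w

open Classical in
/-- The integer `ω(A, B)` for a pair with small commutator (`0` if it is not well defined). -/
def omega (A B : H →ₗ.[ℂ] H) : ℤ := if h : OmegaDefined A B then h.choose else 0

/-- The number `ω(A, B)`, defined by scaling for a pair with a bounded commutator of any size,
equals `w`: `ω(s A, t B) = w` for all `s, t > 0` with `‖[s A, t B]‖ < 0.02`. -/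
def HasScaledOmega (A B : H →ₗ.[ℂ] H) (w : ℤ) : Prop :=
  (∃ K : H →L[ℂ] H, IsCommutator A B K) ∧
    ∀ s t : ℝ, 0 < s → 0 < t → ∀ K : H →L[ℂ] H,
      IsCommutator ((s : ℂ) • A) ((t : ℂ) • B) K → ‖K‖ < 0.02 →
        HasOmega ((s : ℂ) • A) ((t : ℂ) • B) w

/-- `ω(A, B)`, defined by scaling, is well defined. -/
def ScaledOmegaDefined (A B : H →ₗ.[ℂ] H) : Prop := ∃! w : ℤ, HasScaledOmega A B w

open Classical in
/-- The integer `ω(A, B)`, defined by scaling (`0` if it is not well defined). -/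
def scaledOmega (A B : H →ₗ.[ℂ] H) : ℤ := if h : ScaledOmegaDefined A B then h.choose else 0

end Invariant

section Perturbation

/-- The sequence `A n` of closed symmetric operators tends to `A`: every `A n` is defined on `D(A)`
and `‖(A n - A) x‖ ≤ a n * ‖A x‖ + b n * ‖x‖` for `x ∈ D(A)`, with `a n → 0` and `b n → 0`. -/
structure RelTendsto (An : ℕ → H →ₗ.[ℂ] H) (A : H →ₗ.[ℂ] H) : Prop where
  closed : ∀ n, (An n).IsClosed
  symmetric : ∀ n, (An n).IsFormalAdjoint (An n)
  domain_le : ∀ n, A.domain ≤ (An n).domain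
  bound : ∃ a b : ℕ → ℝ, Tendsto a atTop (𝓝 0) ∧ Tendsto b atTop (𝓝 0) ∧
    ∀ (n : ℕ) (x : H) (hx : x ∈ A.domain),
      ‖An n ⟨x, domain_le n hx⟩ - A ⟨x, hx⟩‖ ≤ a n * ‖A ⟨x, hx⟩‖ + b n * ‖x‖

/-- The bounded operator `T` commutes with `B`: `T B ⊆ B T`. -/
def CommutesWith (T : H →L[ℂ] H) (B : H →ₗ.[ℂ] H) : Prop :=
  ∀ x y : H, (x, y) ∈ B.graph → (T x, T y) ∈ B.graph

/-- The operator `A + T` with domain `D(A)`. -/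
def addBounded (A : H →ₗ.[ℂ] H) (T : H →L[ℂ] H) : H →ₗ.[ℂ] H :=
  A + (T : H →ₗ[ℂ] H).toPMap ⊤

end Perturbation

end

end OperatorPair

/-! The integer `ω` is an index of `Q` that is locally constant in operator norm, and `Q` depends
norm-continuously on the pair once `A` and `B` are read as bounded operators on a fixed Hilbert
space.

Index of `Q`. Since `Δ⁻¹` is compact, `Q = P + Y` with `P = diag(0,1)` and `Y` compact, so `Y` is
small off `L ⊕ L` for large `L`. Then the compression of `Q` to `L ⊕ L` inherits the gap at `1/2`
(`norm_compression_sq_sub_le`). Enlarging `L` by an orthogonal `N` adds nearly `P` on `N ⊕ N`, hence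
`dim N` eigenvalues near `1` and `dim N` near `0`, so the count minus `dim L` does not change
(`numEigenvaluesAboveHalf_doubled_of_le`). Eigenvalues are counted by Sylvester's law of inertia,
which needs only the sign of a form on complementary subspaces and so tolerates small perturbations.
Together this gives one integer for every operator of this type near `Q`
(`exists_hasTruncationIndex_of_close`).

The operator `Q` without unbounded operators. A bounded commutator makes the graph norm of `A ± iB`
control `A` and `B` separately, so `A + iB` and `A - iB` are closed on `D(A) ∩ D(B)` and adjoint to
each other. Let `𝒢` be `D(A) ∩ D(B)` with the graph norm of `A - iB`, let `j` be its embedding into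
`H`, and let `k`, `m` be `A - iB`, `A + iB` as bounded operators on `𝒢`. By the variational
equation, `Δ⁻¹ = j (j†j + k†k)⁻¹ j†` and `C Δ⁻¹ = m (j†j + k†k)⁻¹ j†`, which are norm-continuous in
`k` and `m`. Compactness of `Δ⁻¹ = j j†` becomes compactness of `j`. The identity `C†C - CC† =
2i[A,B]` bounds `‖Q² - Q‖` by a multiple of the commutator (`IsHilbertModel.norm_bottOp_sq_sub_lt`).

Perturbation. If `A₁`, `B₁` are relatively close to `A`, `B`, the Kato–Rellich theorem, applied to
`A`, to `B` and to the off-diagonal matrix of `A ± iB`, shows that the new pair lives on the same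
`𝒢` with the same `j` and nearby `k`, `m`. Hence admissibility persists and `ω` is unchanged
(`IsAdmissible.exists_omega_eq_of_isRelClose`), which is the theorem.

Corollary. In logarithmic coordinates the scales with small commutator form a convex set, on which
`ω` is locally constant, hence constant; so the scaled `ω` exists. Along `r ↦ A + rT` the commutator
stays equal to `K`, so a single scale serves all `r`, and local constancy on the line compares `r =
0` with `r = 1`. -/

namespace OperatorPair

/-! ### Counting eigenvalues above `1/2` by the inertia of a form -/

section Counting

variable {L : Type*} [NormedAddCommGroup L] [InnerProductSpace ℂ L] [FiniteDimensional ℂ L]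

theorem numEigenvaluesAboveHalf_eq_card {q : L →L[ℂ] L} (hq : (q : L →ₗ[ℂ] L).IsSymmetric) :
    numEigenvaluesAboveHalf q
      = (Finset.univ.filter fun i => 1 / 2 < hq.eigenvalues rfl i).card := by
  rw [numEigenvaluesAboveHalf, hq.roots_charpoly_eq_eigenvalues rfl, Multiset.filter_map,
    Multiset.card_map]
  rfl

omit [FiniteDimensional ℂ L] in
theorem finrank_span_orthonormalBasis_subset {ι : Type*} [Fintype ι]
    (b : OrthonormalBasis ι ℂ L) (s : Finset ι) :
    Module.finrank ℂ (Submodule.span ℂ (b '' (s : Set ι))) = s.card := by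
  classical
  have h : LinearIndependent ℂ (fun i : s => b i) :=
    b.orthonormal.linearIndependent.comp _ Subtype.val_injective
  have h2 := finrank_span_eq_card h
  rw [Set.image_eq_range]
  simpa using h2

omit [FiniteDimensional ℂ L] in
theorem inner_eq_zero_of_mem_span_subset {ι : Type*} [Fintype ι]
    (b : OrthonormalBasis ι ℂ L) (s : Finset ι) {v : L}
    (hv : v ∈ Submodule.span ℂ (b '' (s : Set ι))) {i : ι} (hi : i ∉ s) :
    inner ℂ (b i) v = 0 := by
  induction hv using Submodule.span_induction with
  | mem x hx =>
    obtain ⟨j, hj, rfl⟩ := hx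
    exact b.orthonormal.2 (fun h => hi (h ▸ hj))
  | zero => simp
  | add x y _ _ hx hy => rw [inner_add_right, hx, hy, add_zero]
  | smul c x _ hx => rw [inner_smul_right, hx, mul_zero]

theorem reInner_eq_sum_eigenvalues {q : L →L[ℂ] L} (hq : (q : L →ₗ[ℂ] L).IsSymmetric) (v : L) :
    (inner ℂ (q v) v).re
      = ∑ i, hq.eigenvalues rfl i * ‖inner ℂ (hq.eigenvectorBasis rfl i) v‖ ^ 2 := by
  have h := (hq.eigenvectorBasis rfl).sum_inner_mul_inner (q v) v
  rw [← h, Complex.re_sum]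
  refine Finset.sum_congr rfl fun i _ => ?_
  have h1 : inner ℂ (q v) (hq.eigenvectorBasis rfl i)
      = (hq.eigenvalues rfl i : ℂ) * inner ℂ v (hq.eigenvectorBasis rfl i) := by
    have := hq v (hq.eigenvectorBasis rfl i)
    rw [hq.apply_eigenvectorBasis rfl i, inner_smul_right] at this
    exact this
  have h2 : inner ℂ v (hq.eigenvectorBasis rfl i) * inner ℂ (hq.eigenvectorBasis rfl i) v
      = ((‖inner ℂ (hq.eigenvectorBasis rfl i) v‖ ^ 2 : ℝ) : ℂ) := by
    rw [← inner_conj_symm v, RCLike.conj_mul]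
    simp
  rw [h1, mul_assoc, h2, ← Complex.ofReal_mul, Complex.ofReal_re]

theorem sq_norm_eq_sum_eigenvectorBasis {q : L →L[ℂ] L} (hq : (q : L →ₗ[ℂ] L).IsSymmetric)
    (v : L) : ‖v‖ ^ 2 = ∑ i, ‖inner ℂ (hq.eigenvectorBasis rfl i) v‖ ^ 2 :=
  ((hq.eigenvectorBasis rfl).sum_sq_norm_inner_right v).symm

theorem abs_eigenvalue_sq_sub_le {q : L →L[ℂ] L} (hq : (q : L →ₗ[ℂ] L).IsSymmetric)
    (i : Fin (Module.finrank ℂ L)) :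
    |hq.eigenvalues rfl i ^ 2 - hq.eigenvalues rfl i| ≤ ‖q * q - q‖ := by
  have h := (q * q - q).le_opNorm (hq.eigenvectorBasis rfl i)
  have h0 : q (hq.eigenvectorBasis rfl i)
      = (hq.eigenvalues rfl i : ℂ) • hq.eigenvectorBasis rfl i :=
    hq.apply_eigenvectorBasis rfl i
  have h1 : (q * q - q) (hq.eigenvectorBasis rfl i)
      = ((hq.eigenvalues rfl i ^ 2 - hq.eigenvalues rfl i : ℝ) : ℂ)
        • hq.eigenvectorBasis rfl i := by
    simp only [sub_apply, mul_apply_eq_comp, h0, map_smul,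
      smul_smul, ← sub_smul]
    congr 1
    push_cast
    ring
  rw [h1, norm_smul, (hq.eigenvectorBasis rfl).orthonormal.1 i, mul_one, mul_one] at h
  rwa [Complex.norm_real, Real.norm_eq_abs] at h

/-- The spectral subspaces of `q` for the eigenvalues above and not above `1/2`. -/
theorem exists_spectral_splitting {q : L →L[ℂ] L} (hq : (q : L →ₗ[ℂ] L).IsSymmetric) :
    ∃ V W : Submodule ℂ L, Module.finrank ℂ V = numEigenvaluesAboveHalf q ∧
      Module.finrank ℂ V + Module.finrank ℂ W = Module.finrank ℂ L ∧
      (∀ v ∈ V, v ≠ 0 → 1 / 2 * ‖v‖ ^ 2 < (inner ℂ (q v) v).re) ∧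
      (∀ v ∈ W, (inner ℂ (q v) v).re ≤ 1 / 2 * ‖v‖ ^ 2) ∧
      ∀ g : ℝ, 0 < g → ‖q * q - q‖ ≤ 1 / 4 - g ^ 2 →
        (∀ v ∈ V, (1 / 2 + g) * ‖v‖ ^ 2 ≤ (inner ℂ (q v) v).re) ∧
        (∀ v ∈ W, (inner ℂ (q v) v).re ≤ (1 / 2 - g) * ‖v‖ ^ 2) := by
  set b := hq.eigenvectorBasis rfl with hb
  set ev := hq.eigenvalues rfl with hev
  set s := Finset.univ.filter fun i => 1 / 2 < ev i with hs
  -- The free constant `c` lets one identity serve the three thresholds `1/2` and `1/2 ± g`.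
  have key : ∀ (t : Finset (Fin (Module.finrank ℂ L))) (v : L),
      v ∈ Submodule.span ℂ (b '' (t : Set _)) → ∀ c : ℝ,
      (inner ℂ (q v) v).re - c * ‖v‖ ^ 2 = ∑ i ∈ t, (ev i - c) * ‖inner ℂ (b i) v‖ ^ 2 := by
    intro t v hv c
    rw [reInner_eq_sum_eigenvalues hq, sq_norm_eq_sum_eigenvectorBasis hq, Finset.mul_sum,
      ← Finset.sum_sub_distrib]
    symm
    have hsub : ∀ i, ev i * ‖inner ℂ (b i) v‖ ^ 2 - c * ‖inner ℂ (b i) v‖ ^ 2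
        = (ev i - c) * ‖inner ℂ (b i) v‖ ^ 2 := fun i => by ring
    simp only [← hb, ← hev, hsub]
    refine Finset.sum_subset (Finset.subset_univ t) fun i _ hi => ?_
    rw [inner_eq_zero_of_mem_span_subset b t hv hi]
    simp
  refine ⟨Submodule.span ℂ (b '' (s : Set _)), Submodule.span ℂ (b '' ((sᶜ : Finset _) : Set _)),
    ?_, ?_, ?_, ?_, ?_⟩
  · rw [finrank_span_orthonormalBasis_subset, numEigenvaluesAboveHalf_eq_card hq]
  · rw [finrank_span_orthonormalBasis_subset, finrank_span_orthonormalBasis_subset,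
      Finset.card_add_card_compl, Fintype.card_fin]
  · intro v hv hv0
    have h := key s v hv (1 / 2)
    have hn : ∃ i ∈ s, inner ℂ (b i) v ≠ 0 := by
      by_contra! hcon
      apply hv0
      have h2 : ‖v‖ ^ 2 = 0 := by
        rw [sq_norm_eq_sum_eigenvectorBasis hq]
        refine Finset.sum_eq_zero fun i _ => ?_
        by_cases hi : i ∈ s
        · simp [← hb, hcon i hi]
        · rw [← hb, inner_eq_zero_of_mem_span_subset b s hv hi]
          simp
      simpa using h2
    have : 0 < ∑ i ∈ s, (ev i - 1 / 2) * ‖inner ℂ (b i) v‖ ^ 2 := by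
      refine Finset.sum_pos' (fun i hi => ?_) ?_
      · have : 1 / 2 < ev i := (Finset.mem_filter.mp hi).2
        exact mul_nonneg (by linarith) (sq_nonneg _)
      · obtain ⟨i, hi, hne⟩ := hn
        have : 1 / 2 < ev i := (Finset.mem_filter.mp hi).2
        exact ⟨i, hi, mul_pos (by linarith) (by positivity)⟩
    linarith
  · intro v hv
    have h := key _ v hv (1 / 2)
    have : ∑ i ∈ sᶜ, (ev i - 1 / 2) * ‖inner ℂ (b i) v‖ ^ 2 ≤ 0 := by
      refine Finset.sum_nonpos fun i hi => ?_
      have : ¬ 1 / 2 < ev i := fun hlt =>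
        Finset.mem_compl.mp hi (Finset.mem_filter.mpr ⟨Finset.mem_univ _, hlt⟩)
      exact mul_nonpos_of_nonpos_of_nonneg (by linarith) (sq_nonneg _)
    linarith
  · intro g hg hqg
    -- Since `λ² - λ = (λ - 1/2)² - 1/4`, the bound on `q² - q` keeps every eigenvalue at distance
    -- at least `g` from `1/2`.
    have hgap : ∀ i, g ^ 2 ≤ (ev i - 1 / 2) ^ 2 := fun i => by
      have h := (abs_le.mp ((abs_eigenvalue_sq_sub_le hq i).trans hqg)).1
      rw [← hev] at h
      nlinarith
    constructor
    · intro v hv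
      have h := key _ v hv (1 / 2 + g)
      have : 0 ≤ ∑ i ∈ s, (ev i - (1 / 2 + g)) * ‖inner ℂ (b i) v‖ ^ 2 := by
        refine Finset.sum_nonneg fun i hi => ?_
        have h1 : 1 / 2 < ev i := (Finset.mem_filter.mp hi).2
        have h2 := abs_le_of_sq_le_sq' (hgap i) (by linarith)
        exact mul_nonneg (by linarith) (sq_nonneg _)
      linarith
    · intro v hv
      have h := key _ v hv (1 / 2 - g)
      have : ∑ i ∈ sᶜ, (ev i - (1 / 2 - g)) * ‖inner ℂ (b i) v‖ ^ 2 ≤ 0 := by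
        refine Finset.sum_nonpos fun i hi => ?_
        have h1 : ¬ 1 / 2 < ev i := fun hlt =>
          Finset.mem_compl.mp hi (Finset.mem_filter.mpr ⟨Finset.mem_univ _, hlt⟩)
        have h2 := abs_le_of_sq_le_sq' (a := g) (b := 1 / 2 - ev i)
          (by have := hgap i; nlinarith) (by linarith)
        exact mul_nonpos_of_nonpos_of_nonneg (by linarith) (sq_nonneg _)
      linarith

/-- Two subspaces on which a form has opposite signs are independent. -/
theorem finrank_add_le_of_sign (f : L → ℝ) {V W : Submodule ℂ L}
    (hV : ∀ v ∈ V, v ≠ 0 → 0 < f v) (hW : ∀ v ∈ W, f v ≤ 0) :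
    Module.finrank ℂ V + Module.finrank ℂ W ≤ Module.finrank ℂ L := by
  have h : V ⊓ W = ⊥ := by
    rw [eq_bot_iff]
    rintro v ⟨h1, h2⟩
    by_contra hv
    exact absurd (hV v h1 hv) (not_lt.mpr (hW v h2))
  rw [← Submodule.finrank_sup_add_finrank_inf_eq, h, finrank_bot, add_zero]
  exact Submodule.finrank_le _

/-- Sylvester's law of inertia. -/
theorem numEigenvaluesAboveHalf_eq_finrank {q : L →L[ℂ] L} (hq : (q : L →ₗ[ℂ] L).IsSymmetric)
    {V W : Submodule ℂ L} (hdim : Module.finrank ℂ V + Module.finrank ℂ W = Module.finrank ℂ L)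
    (hV : ∀ v ∈ V, v ≠ 0 → 1 / 2 * ‖v‖ ^ 2 < (inner ℂ (q v) v).re)
    (hW : ∀ v ∈ W, (inner ℂ (q v) v).re ≤ 1 / 2 * ‖v‖ ^ 2) :
    numEigenvaluesAboveHalf q = Module.finrank ℂ V := by
  obtain ⟨V', W', h1, h2, h3, h4, -⟩ := exists_spectral_splitting hq
  -- `V` is compared with the spectral subspace below the threshold, and `W` with the one above;
  -- complementary dimensions turn the two inequalities into an equality.
  have e1 := finrank_add_le_of_sign (fun v => (inner ℂ (q v) v).re - 1 / 2 * ‖v‖ ^ 2)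
    (V := V) (W := W') (fun v hv h0 => by linarith [hV v hv h0]) (fun v hv => by linarith [h4 v hv])
  have e2 := finrank_add_le_of_sign (fun v => (inner ℂ (q v) v).re - 1 / 2 * ‖v‖ ^ 2)
    (V := V') (W := W) (fun v hv h0 => by linarith [h3 v hv h0]) (fun v hv => by linarith [hW v hv])
  omega

end Counting

/-! ### Quadratic forms on orthogonal sums -/

section Compression

variable {E : Type*} [NormedAddCommGroup E] [InnerProductSpace ℂ E]

theorem finrank_sup_eq_of_isOrtho {V W : Submodule ℂ E} [FiniteDimensional ℂ V]
    [FiniteDimensional ℂ W] (h : V ⟂ W) :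
    Module.finrank ℂ (V ⊔ W : Submodule ℂ E) = Module.finrank ℂ V + Module.finrank ℂ W := by
  rw [← Submodule.finrank_sup_add_finrank_inf_eq, h.disjoint.eq_bot, finrank_bot, add_zero]

theorem reInner_add_add {Q : E →L[ℂ] E} (hQ : (Q : E →ₗ[ℂ] E).IsSymmetric) (a b : E) :
    (inner ℂ (Q (a + b)) (a + b)).re
      = (inner ℂ (Q a) a).re + 2 * (inner ℂ (Q a) b).re + (inner ℂ (Q b) b).re := by
  have h : (inner ℂ (Q b) a).re = (inner ℂ (Q a) b).re := by
    have h1 : inner ℂ (Q b) a = inner ℂ b (Q a) := hQ b a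
    rw [h1, ← inner_conj_symm, Complex.conj_re]
  rw [map_add, inner_add_left, inner_add_right, inner_add_right]
  simp only [Complex.add_re, h]
  ring

theorem abs_re_le_of_norm_le {z : ℂ} {r : ℝ} (h : ‖z‖ ≤ r) : |z.re| ≤ r :=
  (Complex.abs_re_le_norm z).trans h

end Compression

/-! ### Compressions to `L ⊕ L` and their dependence on `L` -/

section Doubling

variable {H : Type*} [NormedAddCommGroup H] [InnerProductSpace ℂ H]

theorem inner_compression (Q : WithLp 2 (H × H) →L[ℂ] WithLp 2 (H × H))
    (M : Submodule ℂ (WithLp 2 (H × H))) [FiniteDimensional ℂ M] (v w : M) :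
    inner ℂ (compression Q M v) w = inner ℂ (Q v) (w : WithLp 2 (H × H)) :=
  Submodule.inner_orthogonalProjectionOnto_eq_of_mem_right w (Q v)

theorem isSymmetric_compression {Q : WithLp 2 (H × H) →L[ℂ] WithLp 2 (H × H)}
    (hQ : (Q : WithLp 2 (H × H) →ₗ[ℂ] WithLp 2 (H × H)).IsSymmetric)
    (M : Submodule ℂ (WithLp 2 (H × H))) [FiniteDimensional ℂ M] :
    (compression Q M : M →ₗ[ℂ] M).IsSymmetric := fun v w => by
  have h1 := inner_compression Q M v w
  have h2 := inner_compression Q M w v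
  have h3 : inner ℂ (Q v) (w : WithLp 2 (H × H)) = inner ℂ (v : WithLp 2 (H × H)) (Q w) := hQ v w
  simp only [ContinuousLinearMap.coe_coe]
  rw [h1, h3, ← inner_conj_symm, ← h2]
  exact inner_conj_symm (𝕜 := ℂ) v (compression Q M w)

/-- Sylvester's law of inertia for a compression. -/
theorem numEigenvaluesAboveHalf_compression {Q : WithLp 2 (H × H) →L[ℂ] WithLp 2 (H × H)}
    (hQ : (Q : WithLp 2 (H × H) →ₗ[ℂ] WithLp 2 (H × H)).IsSymmetric)
    {M V W : Submodule ℂ (WithLp 2 (H × H))} [FiniteDimensional ℂ M] (hVM : V ≤ M) (hWM : W ≤ M)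
    (hdim : Module.finrank ℂ V + Module.finrank ℂ W = Module.finrank ℂ M)
    (hV : ∀ v ∈ V, v ≠ 0 → 1 / 2 * ‖v‖ ^ 2 < (inner ℂ (Q v) v).re)
    (hW : ∀ v ∈ W, (inner ℂ (Q v) v).re ≤ 1 / 2 * ‖v‖ ^ 2) :
    numEigenvaluesAboveHalf (compression Q M) = Module.finrank ℂ V := by
  rw [← (Submodule.comapSubtypeEquivOfLe hVM).finrank_eq]
  refine numEigenvaluesAboveHalf_eq_finrank (isSymmetric_compression hQ M)
    (W := W.comap M.subtype) ?_ (fun v hv hv0 => ?_) (fun v hv => ?_)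
  · rw [(Submodule.comapSubtypeEquivOfLe hVM).finrank_eq,
      (Submodule.comapSubtypeEquivOfLe hWM).finrank_eq, hdim]
  · rw [inner_compression]
    exact hV v hv (fun h => hv0 (Subtype.ext h))
  · rw [inner_compression]
    exact hW v hv

/-- The spectral subspaces of an almost projective compression. -/
theorem exists_gap_splitting {Q : WithLp 2 (H × H) →L[ℂ] WithLp 2 (H × H)}
    (hQ : (Q : WithLp 2 (H × H) →ₗ[ℂ] WithLp 2 (H × H)).IsSymmetric)
    (M : Submodule ℂ (WithLp 2 (H × H))) [FiniteDimensional ℂ M] {g : ℝ} (hg : 0 < g)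
    (hgap : ‖compression Q M * compression Q M - compression Q M‖ ≤ 1 / 4 - g ^ 2) :
    ∃ V W : Submodule ℂ (WithLp 2 (H × H)), V ≤ M ∧ W ≤ M ∧
      Module.finrank ℂ V = numEigenvaluesAboveHalf (compression Q M) ∧
      Module.finrank ℂ V + Module.finrank ℂ W = Module.finrank ℂ M ∧
      (∀ v ∈ V, (1 / 2 + g) * ‖v‖ ^ 2 ≤ (inner ℂ (Q v) v).re) ∧
      (∀ v ∈ W, (inner ℂ (Q v) v).re ≤ (1 / 2 - g) * ‖v‖ ^ 2) := by
  obtain ⟨V, W, h1, h2, -, -, h3⟩ := exists_spectral_splitting (isSymmetric_compression hQ M)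
  obtain ⟨h4, h5⟩ := h3 g hg hgap
  have e : ∀ V : Submodule ℂ M, Module.finrank ℂ (V.map M.subtype) = Module.finrank ℂ V :=
    fun V => (V.equivMapOfInjective M.subtype M.injective_subtype).finrank_eq.symm
  refine ⟨V.map M.subtype, W.map M.subtype, Submodule.map_subtype_le _ _,
    Submodule.map_subtype_le _ _, by rw [e, h1], by rw [e, e, h2], ?_, ?_⟩
  · rintro _ ⟨v, hv, rfl⟩
    have := h4 v hv
    rwa [inner_compression] at this
  · rintro _ ⟨v, hv, rfl⟩
    have := h5 v hv
    rwa [inner_compression] at this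

/-- The number of eigenvalues above `1/2` is stable under small perturbations. -/
theorem numEigenvaluesAboveHalf_compression_eq_of_close
    {Q Q' : WithLp 2 (H × H) →L[ℂ] WithLp 2 (H × H)}
    (hQ : (Q : WithLp 2 (H × H) →ₗ[ℂ] WithLp 2 (H × H)).IsSymmetric)
    (hQ' : (Q' : WithLp 2 (H × H) →ₗ[ℂ] WithLp 2 (H × H)).IsSymmetric)
    (M : Submodule ℂ (WithLp 2 (H × H))) [FiniteDimensional ℂ M] {g : ℝ} (hg : 0 < g)
    (hgap : ‖compression Q M * compression Q M - compression Q M‖ ≤ 1 / 4 - g ^ 2)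
    (hQQ' : ‖Q' - Q‖ < g) :
    numEigenvaluesAboveHalf (compression Q' M) = numEigenvaluesAboveHalf (compression Q M) := by
  obtain ⟨V, W, hV, hW, h1, h2, h3, h4⟩ := exists_gap_splitting hQ M hg hgap
  have hd : ∀ v : WithLp 2 (H × H),
      |(inner ℂ (Q' v) v).re - (inner ℂ (Q v) v).re| ≤ ‖Q' - Q‖ * ‖v‖ ^ 2 := fun v => by
    rw [← Complex.sub_re, ← inner_sub_left, ← sub_apply]
    refine abs_re_le_of_norm_le ((norm_inner_le_norm _ _).trans ?_)
    nlinarith [(Q' - Q).le_opNorm v, norm_nonneg v]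
  rw [← h1]
  refine numEigenvaluesAboveHalf_compression hQ' hV hW h2 (fun v hv hv0 => ?_) fun v hv => ?_
  · have := (abs_le.mp (hd v)).1
    have hp : 0 < ‖v‖ ^ 2 := by positivity
    nlinarith [h3 v hv]
  · have := (abs_le.mp (hd v)).2
    nlinarith [h4 v hv, sq_nonneg ‖v‖]

/-- The subspace `L ⊕ L` of `H ⊕ H`. -/
def doubled (L : Submodule ℂ H) : Submodule ℂ (WithLp 2 (H × H)) :=
  (L.prod L).map (WithLp.linearEquiv 2 ℂ (H × H)).symm.toLinearMap

theorem mem_doubled {L : Submodule ℂ H} {x : WithLp 2 (H × H)} :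
    x ∈ doubled L ↔ x.fst ∈ L ∧ x.snd ∈ L := by
  constructor
  · rintro ⟨y, hy, rfl⟩
    exact hy
  · exact fun h => ⟨(x.fst, x.snd), h, rfl⟩

theorem doubled_mono {L L' : Submodule ℂ H} (h : L ≤ L') : doubled L ≤ doubled L' := fun _ hx =>
  mem_doubled.mpr ⟨h (mem_doubled.mp hx).1, h (mem_doubled.mp hx).2⟩

instance finiteDimensional_doubled (L : Submodule ℂ H) [FiniteDimensional ℂ L] :
    FiniteDimensional ℂ (doubled L) := by
  have h : L.FG := Module.Finite.iff_fg.mp inferInstance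
  exact Module.Finite.iff_fg.mpr ((h.prod h).map _)

/-- The subspace `N ⊕ 0` of `H ⊕ H`. -/
def leftCopy (N : Submodule ℂ H) : Submodule ℂ (WithLp 2 (H × H)) :=
  N.map ((WithLp.linearEquiv 2 ℂ (H × H)).symm.toLinearMap ∘ₗ LinearMap.inl ℂ H H)

/-- The subspace `0 ⊕ N` of `H ⊕ H`. -/
def rightCopy (N : Submodule ℂ H) : Submodule ℂ (WithLp 2 (H × H)) :=
  N.map ((WithLp.linearEquiv 2 ℂ (H × H)).symm.toLinearMap ∘ₗ LinearMap.inr ℂ H H)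

instance finiteDimensional_leftCopy (N : Submodule ℂ H) [FiniteDimensional ℂ N] :
    FiniteDimensional ℂ (leftCopy N) := by
  rw [leftCopy]; infer_instance

instance finiteDimensional_rightCopy (N : Submodule ℂ H) [FiniteDimensional ℂ N] :
    FiniteDimensional ℂ (rightCopy N) := by
  rw [rightCopy]; infer_instance

theorem mem_leftCopy {N : Submodule ℂ H} {x : WithLp 2 (H × H)} (h : x ∈ leftCopy N) :
    x.fst ∈ N ∧ x.snd = 0 := by
  obtain ⟨y, hy, rfl⟩ := h
  exact ⟨hy, rfl⟩

theorem mem_rightCopy {N : Submodule ℂ H} {x : WithLp 2 (H × H)} (h : x ∈ rightCopy N) :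
    x.fst = 0 ∧ x.snd ∈ N := by
  obtain ⟨y, hy, rfl⟩ := h
  exact ⟨rfl, hy⟩

theorem finrank_leftCopy (N : Submodule ℂ H) :
    Module.finrank ℂ (leftCopy N) = Module.finrank ℂ N :=
  (N.equivMapOfInjective
    ((WithLp.linearEquiv 2 ℂ (H × H)).symm.toLinearMap ∘ₗ LinearMap.inl ℂ H H)
    ((WithLp.linearEquiv 2 ℂ (H × H)).symm.injective.comp
      (LinearMap.inl_injective (R := ℂ) (M := H) (M₂ := H)))).finrank_eq.symm

theorem finrank_rightCopy (N : Submodule ℂ H) :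
    Module.finrank ℂ (rightCopy N) = Module.finrank ℂ N :=
  (N.equivMapOfInjective
    ((WithLp.linearEquiv 2 ℂ (H × H)).symm.toLinearMap ∘ₗ LinearMap.inr ℂ H H)
    ((WithLp.linearEquiv 2 ℂ (H × H)).symm.injective.comp
      (LinearMap.inr_injective (R := ℂ) (M := H) (M₂ := H)))).finrank_eq.symm

theorem finrank_doubled (L : Submodule ℂ H) [FiniteDimensional ℂ L] :
    Module.finrank ℂ (doubled L) = Module.finrank ℂ L + Module.finrank ℂ L := by
  have h : doubled L = leftCopy L ⊔ rightCopy L := by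
    apply le_antisymm
    · rintro x hx
      obtain ⟨h1, h2⟩ := mem_doubled.mp hx
      exact Submodule.mem_sup.mpr ⟨_, ⟨x.fst, h1, rfl⟩, _, ⟨x.snd, h2, rfl⟩, by
        apply (WithLp.linearEquiv 2 ℂ (H × H)).injective
        ext <;> simp⟩
    · refine sup_le (fun x hx => ?_) (fun x hx => ?_)
      · obtain ⟨h1, h2⟩ := mem_leftCopy hx
        exact mem_doubled.mpr ⟨h1, h2 ▸ L.zero_mem⟩
      · obtain ⟨h1, h2⟩ := mem_rightCopy hx
        exact mem_doubled.mpr ⟨h1 ▸ L.zero_mem, h2⟩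
  rw [h, finrank_sup_eq_of_isOrtho, finrank_leftCopy, finrank_rightCopy]
  rw [Submodule.isOrtho_iff_inner_eq]
  intro u hu v hv
  rw [WithLp.prod_inner_apply]
  simp [(mem_leftCopy hu).2, (mem_rightCopy hv).1]

theorem mem_doubled_orthogonal {L : Submodule ℂ H} {x : WithLp 2 (H × H)} :
    x ∈ (doubled L)ᗮ ↔ x.fst ∈ Lᗮ ∧ x.snd ∈ Lᗮ := by
  constructor
  · intro h
    refine ⟨fun y hy => ?_, fun y hy => ?_⟩
    · have := h (WithLp.toLp 2 (y, 0)) (mem_doubled.mpr ⟨hy, L.zero_mem⟩)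
      simpa [WithLp.prod_inner_apply] using this
    · have := h (WithLp.toLp 2 (0, y)) (mem_doubled.mpr ⟨L.zero_mem, hy⟩)
      simpa [WithLp.prod_inner_apply] using this
  · rintro ⟨h1, h2⟩ y hy
    have h3 := h1 _ (mem_doubled.mp hy).1
    have h4 := h2 _ (mem_doubled.mp hy).2
    simp [WithLp.prod_inner_apply, h3, h4]

/-- The projection of `H ⊕ H` onto its second summand. -/
noncomputable def sndProj (H : Type*) [NormedAddCommGroup H] [InnerProductSpace ℂ H] :
    WithLp 2 (H × H) →L[ℂ] WithLp 2 (H × H) :=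
  ((WithLp.prodContinuousLinearEquiv 2 ℂ H H).symm : H × H →L[ℂ] WithLp 2 (H × H)) ∘L
    ContinuousLinearMap.inr ℂ H H ∘L WithLp.sndL 2 ℂ H H

theorem sndProj_apply (x : WithLp 2 (H × H)) : sndProj H x = WithLp.toLp 2 (0, x.snd) := rfl

theorem sndProj_mem_doubled {L : Submodule ℂ H} {x : WithLp 2 (H × H)} (hx : x ∈ doubled L) :
    sndProj H x ∈ doubled L :=
  mem_doubled.mpr ⟨L.zero_mem, (mem_doubled.mp hx).2⟩

/-- `Y` is small on the orthogonal complement of `M`: `‖(1 - p) Y‖ ≤ η` for the projection `p`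
onto `M`. -/
def IsSmallOff (Y : WithLp 2 (H × H) →L[ℂ] WithLp 2 (H × H))
    (M : Submodule ℂ (WithLp 2 (H × H))) (η : ℝ) : Prop :=
  ∀ x, ∀ b ∈ Mᗮ, ‖inner ℂ (Y x) b‖ ≤ η * ‖x‖ * ‖b‖

theorem inner_sndProj_add_of_mem {L : Submodule ℂ H}
    {Y : WithLp 2 (H × H) →L[ℂ] WithLp 2 (H × H)} {v b : WithLp 2 (H × H)}
    (hv : v ∈ doubled L) (hb : b ∈ (doubled L)ᗮ) :
    inner ℂ ((sndProj H + Y) v) b = inner ℂ (Y v) b := by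
  rw [add_apply, inner_add_left, hb _ (sndProj_mem_doubled hv), zero_add]

/-- With `p` the projection onto `L ⊕ L`, `(pQp)² - pQp = p(Q² - Q)p - pQ(1 - p)Qp`. As `sndProj`
preserves `L ⊕ L`, the factor `(1 - p)Qp` equals `(1 - p)Yp`, of norm at most `η`; by symmetry so is
`pQ(1 - p)`. -/
theorem norm_compression_sq_sub_le {L : Submodule ℂ H} [FiniteDimensional ℂ L]
    {Y : WithLp 2 (H × H) →L[ℂ] WithLp 2 (H × H)}
    (hQ : ((sndProj H + Y : WithLp 2 (H × H) →L[ℂ] WithLp 2 (H × H)) :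
      WithLp 2 (H × H) →ₗ[ℂ] WithLp 2 (H × H)).IsSymmetric)
    {η : ℝ} (hη : 0 ≤ η) (hY : IsSmallOff Y (doubled L) η) :
    ‖compression (sndProj H + Y) (doubled L) * compression (sndProj H + Y) (doubled L)
      - compression (sndProj H + Y) (doubled L)‖
      ≤ ‖(sndProj H + Y) * (sndProj H + Y) - (sndProj H + Y)‖ + η ^ 2 := by
  set Q := sndProj H + Y with hQdef
  set M := doubled L
  have hle : ∀ x y : ℝ, 0 ≤ x → x ^ 2 ≤ y * x → 0 ≤ y → x ≤ y := fun x y hx h hy => by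
    rcases hx.eq_or_lt with h0 | h0
    · rwa [← h0]
    · nlinarith
  refine ContinuousLinearMap.opNorm_le_bound _ (by positivity) fun v => ?_
  -- `r` is `(1 - p)Qv`, and `z` below is `pQr`: the two factors of the error term are estimated in
  -- turn.
  set r : WithLp 2 (H × H) := Q v - compression Q M v with hr
  have hrM : r ∈ Mᗮ := Submodule.sub_starProjection_mem_orthogonal (K := M) (Q v)
  have hr1 : ‖r‖ ≤ η * ‖v‖ := by
    refine hle _ _ (norm_nonneg _) ?_ (by positivity)
    have h1 : inner ℂ (Q v) r = inner ℂ r r := by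
      have : inner ℂ (compression Q M v : WithLp 2 (H × H)) r = 0 := hrM _ (Subtype.mem _)
      conv_rhs => rw [hr, inner_sub_left, ← hr, this, sub_zero]
    have h2 := hY v r hrM
    rw [← inner_sndProj_add_of_mem v.2 hrM, ← hQdef, h1] at h2
    rw [inner_self_eq_norm_sq_to_K] at h2
    simpa using h2
  set z := M.orthogonalProjectionOnto (Q r) with hz
  have hz1 : ‖z‖ ≤ η * ‖r‖ := by
    refine hle _ _ (norm_nonneg _) ?_ (by positivity)
    have h1 : inner ℂ (Q z) r = inner ℂ z z := by
      have h3 : inner ℂ (Q z) r = inner ℂ (z : WithLp 2 (H × H)) (Q r) := hQ z r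
      rw [h3, hz, Submodule.inner_orthogonalProjectionOnto_eq_of_mem_left]
    have h2 := hY z r hrM
    rw [← inner_sndProj_add_of_mem z.2 hrM, ← hQdef, h1] at h2
    rw [inner_self_eq_norm_sq_to_K] at h2
    have h4 : ‖(z : WithLp 2 (H × H))‖ = ‖z‖ := rfl
    rw [h4] at h2
    simp only [norm_pow, Complex.coe_algebraMap, Complex.norm_real, norm_norm] at h2
    linarith
  have hdecomp : (compression Q M * compression Q M - compression Q M) v
      = M.orthogonalProjectionOnto ((Q * Q - Q) v) - z := by
    have h1 : (compression Q M v : WithLp 2 (H × H)) = Q v - r := by rw [hr]; abel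
    have h2 : (compression Q M * compression Q M) v
        = M.orthogonalProjectionOnto (Q (compression Q M v : WithLp 2 (H × H))) := rfl
    have h3 : compression Q M v = M.orthogonalProjectionOnto (Q v) := rfl
    rw [sub_apply, h2, h1, h3, hz, ← map_sub, ← map_sub]
    simp only [map_sub, sub_apply, mul_apply_eq_comp]
    abel
  rw [hdecomp]
  calc _ ≤ ‖M.orthogonalProjectionOnto ((Q * Q - Q) v)‖ + ‖z‖ := norm_sub_le _ _
    _ ≤ ‖Q * Q - Q‖ * ‖v‖ + η * (η * ‖v‖) := by
      refine add_le_add ((Submodule.norm_orthogonalProjectionOnto_apply_le _ _).trans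
        ((Q * Q - Q).le_opNorm v)) (hz1.trans (mul_le_mul_of_nonneg_left hr1 hη))
    _ = _ := by ring

/-- Enlarging a subspace `L` that is already large does not change the number of eigenvalues above
`1/2` of the compression to `L ⊕ L`, minus the dimension of `L`. -/
theorem numEigenvaluesAboveHalf_doubled_of_le {L L' : Submodule ℂ H} [FiniteDimensional ℂ L]
    [FiniteDimensional ℂ L'] (hL : L ≤ L') {Y : WithLp 2 (H × H) →L[ℂ] WithLp 2 (H × H)}
    (hQ : ((sndProj H + Y : WithLp 2 (H × H) →L[ℂ] WithLp 2 (H × H)) :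
      WithLp 2 (H × H) →ₗ[ℂ] WithLp 2 (H × H)).IsSymmetric)
    {η g : ℝ} (hη : 0 < η) (hg : 4 * η ≤ g) (hY : IsSmallOff Y (doubled L) η)
    (hgap : ‖compression (sndProj H + Y) (doubled L) * compression (sndProj H + Y) (doubled L)
      - compression (sndProj H + Y) (doubled L)‖ ≤ 1 / 4 - g ^ 2) :
    numEigenvaluesAboveHalf (compression (sndProj H + Y) (doubled L')) + Module.finrank ℂ L
      = numEigenvaluesAboveHalf (compression (sndProj H + Y) (doubled L))
        + Module.finrank ℂ L' := by
  obtain ⟨V, W, hV, hW, h1, h2, h3, h4⟩ := exists_gap_splitting hQ (doubled L)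
    (by linarith : 0 < g) hgap
  have hg2 : g ≤ 1 / 2 := by
    have := le_trans (norm_nonneg (_ : doubled L →L[ℂ] doubled L)) hgap
    nlinarith
  set N : Submodule ℂ H := Lᗮ ⊓ L' with hN
  have hNL' : N ≤ L' := inf_le_right
  have : FiniteDimensional ℂ N := Submodule.finiteDimensional_of_le hNL'
  have : FiniteDimensional ℂ V := Submodule.finiteDimensional_of_le hV
  have : FiniteDimensional ℂ W := Submodule.finiteDimensional_of_le hW
  have hNdim : Module.finrank ℂ L + Module.finrank ℂ N = Module.finrank ℂ L' :=
    Submodule.finrank_add_inf_finrank_orthogonal hL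
  have hr : rightCopy N ≤ (doubled L)ᗮ := fun x hx => by
    obtain ⟨e1, e2⟩ := mem_rightCopy hx
    exact mem_doubled_orthogonal.mpr ⟨e1 ▸ Submodule.zero_mem _, e2.1⟩
  have hl : leftCopy N ≤ (doubled L)ᗮ := fun x hx => by
    obtain ⟨e1, e2⟩ := mem_leftCopy hx
    exact mem_doubled_orthogonal.mpr ⟨e1.1, e2 ▸ Submodule.zero_mem _⟩
  have hr' : rightCopy N ≤ doubled L' := fun x hx => by
    obtain ⟨e1, e2⟩ := mem_rightCopy hx
    exact mem_doubled.mpr ⟨e1 ▸ Submodule.zero_mem _, e2.2⟩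
  have hl' : leftCopy N ≤ doubled L' := fun x hx => by
    obtain ⟨e1, e2⟩ := mem_leftCopy hx
    exact mem_doubled.mpr ⟨e1.2, e2 ▸ Submodule.zero_mem _⟩
  have ortho : ∀ {V : Submodule ℂ (WithLp 2 (H × H))} {R : Submodule ℂ (WithLp 2 (H × H))},
      V ≤ doubled L → R ≤ (doubled L)ᗮ → V ⟂ R := fun hV hR =>
    (Submodule.isOrtho_orthogonal_right (doubled L)).mono hV hR
  have hVdim := finrank_sup_eq_of_isOrtho (ortho hV hr)
  have hWdim := finrank_sup_eq_of_isOrtho (ortho hW hl)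
  rw [finrank_rightCopy] at hVdim
  rw [finrank_leftCopy] at hWdim
  have hD := finrank_doubled L
  have hD' := finrank_doubled L'
  have hpyth : ∀ a b : WithLp 2 (H × H), a ∈ doubled L → b ∈ (doubled L)ᗮ →
      ‖a + b‖ ^ 2 = ‖a‖ ^ 2 + ‖b‖ ^ 2 := fun a b ha hb => by
    have := norm_add_sq_eq_norm_sq_add_norm_sq_of_inner_eq_zero (𝕜 := ℂ) a b (hb a ha)
    nlinarith
  have hcross : ∀ a b : WithLp 2 (H × H), a ∈ doubled L → b ∈ (doubled L)ᗮ →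
      |(inner ℂ ((sndProj H + Y) a) b).re| ≤ η * ‖a‖ * ‖b‖ := fun a b ha hb => by
    rw [inner_sndProj_add_of_mem ha hb]
    exact abs_re_le_of_norm_le (hY a b hb)
  rw [numEigenvaluesAboveHalf_compression hQ
    (V := V ⊔ rightCopy N) (W := W ⊔ leftCopy N)
    (sup_le (hV.trans (doubled_mono hL)) hr') (sup_le (hW.trans (doubled_mono hL)) hl')
    (by omega)]
  · omega
  · rintro v hv hv0
    obtain ⟨a, ha, b, hb, rfl⟩ := Submodule.mem_sup.mp hv
    rw [reInner_add_add hQ, hpyth a b (hV ha) (hr hb)]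
    have e1 := (abs_le.mp (hcross a b (hV ha) (hr hb))).1
    have e2 := (abs_le.mp (abs_re_le_of_norm_le (hY b b (hr hb)))).1
    have e3 : (inner ℂ ((sndProj H + Y) b) b).re = ‖b‖ ^ 2 + (inner ℂ (Y b) b).re := by
      have hb1 : sndProj H b = b := by
        rw [sndProj_apply, ← (mem_rightCopy hb).1]
        rfl
      rw [add_apply, inner_add_left, hb1, Complex.add_re, inner_self_eq_norm_sq_to_K]
      norm_cast
    have e4 := h3 a ha
    have hpos : 0 < ‖a‖ ^ 2 + ‖b‖ ^ 2 := by
      rw [← hpyth a b (hV ha) (hr hb)]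
      positivity
    -- The excess over `1/2` is at least `g‖a‖² - 2η‖a‖‖b‖ + (1/2 - η)‖b‖²`, hence at least `(g -
    -- η)‖a‖² + (1/2 - 2η)‖b‖²`, which is positive since `4η ≤ g ≤ 1/2`.
    nlinarith [sq_nonneg (‖a‖ - ‖b‖), sq_nonneg ‖a‖, sq_nonneg ‖b‖, mul_pos hη hpos]
  · rintro v hv
    obtain ⟨a, ha, b, hb, rfl⟩ := Submodule.mem_sup.mp hv
    rw [reInner_add_add hQ, hpyth a b (hW ha) (hl hb)]
    have e1 := (abs_le.mp (hcross a b (hW ha) (hl hb))).2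
    have e2 := (abs_le.mp (abs_re_le_of_norm_le (hY b b (hl hb)))).2
    have e3 : (inner ℂ ((sndProj H + Y) b) b).re = (inner ℂ (Y b) b).re := by
      have hb1 : sndProj H b = 0 := by
        rw [sndProj_apply, (mem_leftCopy hb).2]
        rfl
      rw [add_apply, inner_add_left, hb1, inner_zero_left, zero_add]
    have e4 := h4 a ha
    nlinarith [sq_nonneg (‖a‖ - ‖b‖), sq_nonneg ‖a‖, sq_nonneg ‖b‖]

end Doubling

/-! ### The truncation index of a compact perturbation of `diag(0,1)` -/

section Index

theorem exists_norm_mul_self_sub_lt_of_close {R : Type*} [NormedRing R] (q : R) {c : ℝ}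
    (h : ‖q * q - q‖ < c) : ∃ δ > 0, ∀ q' : R, ‖q' - q‖ < δ → ‖q' * q' - q'‖ < c := by
  have hcont : Continuous fun q' : R => ‖q' * q' - q'‖ := by fun_prop
  obtain ⟨δ, hδ, hδ'⟩ :=
    Metric.eventually_nhds_iff.mp ((hcont.tendsto q).eventually_lt_const h)
  exact ⟨δ, hδ, fun q' hq' => hδ' (by rwa [dist_eq_norm])⟩

variable {H : Type*} [NormedAddCommGroup H] [InnerProductSpace ℂ H]

theorem finrank_span_hilbertBasis_image {ι : Type} (b : HilbertBasis ι ℂ H) (F : Finset ι) :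
    Module.finrank ℂ (Submodule.span ℂ (b '' (F : Set ι))) = F.card := by
  have h : LinearIndependent ℂ (fun i : F => b i) :=
    b.orthonormal.linearIndependent.comp _ Subtype.val_injective
  rw [Set.image_eq_range]
  simpa using finrank_span_eq_card h

theorem eventually_exists_mem_span_near {ι : Type} (b : HilbertBasis ι ℂ H) (x : H) {ε : ℝ}
    (hε : 0 < ε) :
    ∀ᶠ F : Finset ι in atTop, ∃ m ∈ Submodule.span ℂ (b '' (F : Set ι)), ‖x - m‖ < ε := by
  have h : Tendsto (fun F : Finset ι => ∑ i ∈ F, b.repr x i • b i) atTop (𝓝 x) := b.hasSum_repr x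
  filter_upwards [Metric.tendsto_nhds.mp h ε hε] with F hF
  refine ⟨∑ i ∈ F, b.repr x i • b i, Submodule.sum_mem _ fun i hi => Submodule.smul_mem _ _
    (Submodule.subset_span ⟨i, hi, rfl⟩), ?_⟩
  rwa [← dist_eq_norm, dist_comm]

theorem eventually_exists_mem_truncSpace_near {ι : Type} (b : HilbertBasis ι ℂ H)
    (x : WithLp 2 (H × H)) {ε : ℝ} (hε : 0 < ε) :
    ∀ᶠ F : Finset ι in atTop, ∃ m ∈ truncSpace b F, ‖x - m‖ < ε := by
  filter_upwards [eventually_exists_mem_span_near b x.fst (half_pos hε),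
    eventually_exists_mem_span_near b x.snd (half_pos hε)] with F h1 h2
  obtain ⟨m, hm, hm'⟩ := h1
  obtain ⟨n, hn, hn'⟩ := h2
  refine ⟨WithLp.toLp 2 (m, n), ⟨(m, n), ⟨hm, hn⟩, rfl⟩, ?_⟩
  have h3 := WithLp.prod_norm_sq_eq_of_L2 (x - WithLp.toLp 2 (m, n))
  simp only [WithLp.sub_fst, WithLp.toLp_fst, WithLp.sub_snd, WithLp.toLp_snd] at h3
  nlinarith [norm_nonneg (x.fst - m), norm_nonneg (x.snd - n),
    norm_nonneg (x - WithLp.toLp 2 (m, n))]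

/-- The image of the unit ball under `Y` has a finite `η/2`-net, and each net point is eventually
within `η/2` of the truncation space. Subtracting a vector of that space does not change the pairing
with its orthogonal complement. -/
theorem eventually_isSmallOff {Y : WithLp 2 (H × H) →L[ℂ] WithLp 2 (H × H)}
    (hY : IsCompactOperator Y) {η : ℝ} (hη : 0 < η) {ι : Type} (b : HilbertBasis ι ℂ H) :
    ∀ᶠ F : Finset ι in atTop, IsSmallOff Y (truncSpace b F) η := by
  have hK := hY.isCompact_closure_image_closedBall (𝕜₁ := ℂ) 1
  obtain ⟨t, htf, ht⟩ := Metric.totallyBounded_iff.mp hK.totallyBounded (η / 2) (half_pos hη)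
  have hev : ∀ᶠ F : Finset ι in atTop, ∀ y ∈ t, ∃ m ∈ truncSpace b F, ‖y - m‖ < η / 2 :=
    (eventually_all_finite htf).mpr fun y _ =>
      eventually_exists_mem_truncSpace_near b y (half_pos hη)
  filter_upwards [hev] with F hF
  have hunit : ∀ x : WithLp 2 (H × H), ‖x‖ ≤ 1 → ∀ c ∈ (truncSpace b F)ᗮ,
      ‖inner ℂ (Y x) c‖ ≤ η * ‖c‖ := by
    intro x hx c hc
    have hmem : Y x ∈ closure (Y '' Metric.closedBall 0 1) :=
      subset_closure ⟨x, by simpa using hx, rfl⟩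
    obtain ⟨y, hy, hxy⟩ := Set.mem_iUnion₂.mp (ht hmem)
    obtain ⟨m, hm, hym⟩ := hF y hy
    have h1 : inner ℂ (Y x) c = inner ℂ (Y x - m) c := by
      rw [inner_sub_left, hc m hm, sub_zero]
    rw [h1]
    refine (norm_inner_le_norm _ _).trans (mul_le_mul_of_nonneg_right ?_ (norm_nonneg c))
    rw [Metric.mem_ball, dist_eq_norm] at hxy
    calc ‖Y x - m‖ = ‖(Y x - y) + (y - m)‖ := by congr 1; abel
      _ ≤ ‖Y x - y‖ + ‖y - m‖ := norm_add_le _ _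
      _ ≤ η := by linarith
  intro x c hc
  rcases eq_or_ne x 0 with rfl | hx
  · simp
  have hx0 : 0 < ‖x‖ := norm_pos_iff.mpr hx
  have h := hunit ((‖x‖⁻¹ : ℂ) • x) (by
    rw [norm_smul, norm_inv, Complex.norm_real, norm_norm, inv_mul_cancel₀ hx0.ne']) c hc
  rw [map_smul, inner_smul_left, norm_mul, RCLike.norm_conj, norm_inv, Complex.norm_real,
    norm_norm, inv_mul_le_iff₀ hx0] at h
  linarith

/-- For all large finite sets of basis vectors, the compression of `Q` is an almost projection whose
number of eigenvalues above `1/2` is the number of basis vectors plus `w`. -/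
def HasTruncationIndex (Q : WithLp 2 (H × H) →L[ℂ] WithLp 2 (H × H)) (w : ℤ) : Prop :=
  ∀ (ι : Type) (b : HilbertBasis ι ℂ H), ∀ᶠ F : Finset ι in atTop,
    ‖compression Q (truncSpace b F) * compression Q (truncSpace b F)
        - compression Q (truncSpace b F)‖ < 1 / 4 ∧
    (numEigenvaluesAboveHalf (compression Q (truncSpace b F)) : ℤ) - (F.card : ℤ) = w

/-- One integer serves a whole norm neighbourhood of `Q`, which gives both existence and local
constancy of the index. Any two large subspaces are compared through their sum; `Q'` is compared
with `Q` on the same truncation, where the gap of `Q` absorbs the difference. -/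
theorem exists_hasTruncationIndex_of_close {Q : WithLp 2 (H × H) →L[ℂ] WithLp 2 (H × H)}
    (hQ : (Q : WithLp 2 (H × H) →ₗ[ℂ] WithLp 2 (H × H)).IsSymmetric)
    (hcpt : IsCompactOperator (Q - sndProj H)) (hlt : ‖Q * Q - Q‖ < 1 / 4) :
    ∃ w : ℤ, ∃ ε > 0, ∀ Q' : WithLp 2 (H × H) →L[ℂ] WithLp 2 (H × H),
      (Q' : WithLp 2 (H × H) →ₗ[ℂ] WithLp 2 (H × H)).IsSymmetric →
      IsCompactOperator (Q' - sndProj H) → ‖Q' - Q‖ < ε →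
      ‖Q' * Q' - Q'‖ < 1 / 4 ∧ HasTruncationIndex Q' w := by
  -- Half of the slack below `1/4` is kept as the gap `g²`; the other half absorbs the truncation
  -- error `(g/4)²`.
  obtain ⟨g, hg, hgd⟩ : ∃ g : ℝ, 0 < g ∧ g ^ 2 ≤ (1 / 4 - ‖Q * Q - Q‖) / 2 :=
    ⟨√((1 / 4 - ‖Q * Q - Q‖) / 2), Real.sqrt_pos.mpr (by linarith),
      (Real.sq_sqrt (by linarith)).le⟩
  have hgap : ∀ (L : Submodule ℂ H) [FiniteDimensional ℂ L],
      IsSmallOff (Q - sndProj H) (doubled L) (g / 4) →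
      ‖compression Q (doubled L) * compression Q (doubled L) - compression Q (doubled L)‖
        ≤ 1 / 4 - g ^ 2 := fun L _ hL => by
    have h := norm_compression_sq_sub_le (L := L) (Y := Q - sndProj H)
      (by rwa [add_sub_cancel]) (by positivity) hL
    rw [add_sub_cancel] at h
    nlinarith
  have hle : ∀ (L L' : Submodule ℂ H) [FiniteDimensional ℂ L] [FiniteDimensional ℂ L'],
      L ≤ L' → IsSmallOff (Q - sndProj H) (doubled L) (g / 4) →
      (numEigenvaluesAboveHalf (compression Q (doubled L')) : ℤ) - Module.finrank ℂ L'
        = numEigenvaluesAboveHalf (compression Q (doubled L)) - Module.finrank ℂ L :=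
    fun L L' _ _ hLL' hL => by
    have h := numEigenvaluesAboveHalf_doubled_of_le (Y := Q - sndProj H) (η := g / 4) (g := g)
      hLL' (by rwa [add_sub_cancel]) (by positivity) (by linarith) hL
      (by rw [add_sub_cancel]; exact hgap L hL)
    rw [add_sub_cancel] at h
    omega
  obtain ⟨w, hw⟩ : ∃ w : ℤ, ∀ (L : Submodule ℂ H) [FiniteDimensional ℂ L],
      IsSmallOff (Q - sndProj H) (doubled L) (g / 4) →
      (numEigenvaluesAboveHalf (compression Q (doubled L)) : ℤ) - Module.finrank ℂ L = w := by
    by_cases h : ∃ (L : Submodule ℂ H) (_ : FiniteDimensional ℂ L),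
        IsSmallOff (Q - sndProj H) (doubled L) (g / 4)
    · obtain ⟨L₀, hfd, hL₀⟩ := h
      refine ⟨(numEigenvaluesAboveHalf (compression Q (doubled L₀)) : ℤ) - Module.finrank ℂ L₀,
        fun L _ hL => ?_⟩
      rw [← hle L (L ⊔ L₀) le_sup_left hL, ← hle L₀ (L ⊔ L₀) le_sup_right hL₀]
    -- Without such a subspace the claim is vacuous and any integer would do.
    · exact ⟨0, fun L hfd hL => absurd ⟨L, hfd, hL⟩ h⟩
  obtain ⟨δ, hδ, hδ'⟩ := exists_norm_mul_self_sub_lt_of_close Q hlt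
  refine ⟨w, min δ g, lt_min hδ hg, fun Q' hQ' hcpt' hclose => ?_⟩
  have hlt' : ‖Q' * Q' - Q'‖ < 1 / 4 :=
    hδ' Q' (hclose.trans_le (min_le_left _ _))
  refine ⟨hlt', fun ι b => ?_⟩
  -- The almost-projection property of the compression of `Q'` uses the slack of `Q'` itself,
  -- whereas the eigenvalue count uses the gap of `Q`.
  obtain ⟨g', hg', hgd'⟩ : ∃ g' : ℝ, 0 < g' ∧ g' ^ 2 ≤ (1 / 4 - ‖Q' * Q' - Q'‖) / 2 :=
    ⟨√((1 / 4 - ‖Q' * Q' - Q'‖) / 2), Real.sqrt_pos.mpr (by linarith),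
      (Real.sq_sqrt (by linarith)).le⟩
  filter_upwards [eventually_isSmallOff hcpt (by positivity : 0 < g / 4) b,
    eventually_isSmallOff hcpt' hg' b] with F h1 h2
  have : FiniteDimensional ℂ (Submodule.span ℂ (b '' (F : Set ι))) :=
    FiniteDimensional.span_of_finite ℂ (F.finite_toSet.image b)
  constructor
  · have h := norm_compression_sq_sub_le (L := Submodule.span ℂ (b '' (F : Set ι)))
      (Y := Q' - sndProj H) (by rwa [add_sub_cancel]) hg'.le h2
    rw [add_sub_cancel] at h
    exact h.trans_lt (by linarith)
  · have h3 := numEigenvaluesAboveHalf_compression_eq_of_close hQ hQ'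
      (doubled (Submodule.span ℂ (b '' (F : Set ι)))) hg (hgap _ h1)
      (hclose.trans_le (min_le_right _ _))
    have h4 := hw _ h1
    rw [finrank_span_hilbertBasis_image, ← h3] at h4
    exact h4

/-- The index is unique, as a separable space has a basis indexed by a small type. -/
theorem HasTruncationIndex.unique [CompleteSpace H] [TopologicalSpace.SeparableSpace H]
    {Q : WithLp 2 (H × H) →L[ℂ] WithLp 2 (H × H)} {w w' : ℤ} (h : HasTruncationIndex Q w)
    (h' : HasTruncationIndex Q w') : w = w' := by
  obtain ⟨ι, ⟨b⟩⟩ : ∃ ι : Type, Nonempty (HilbertBasis ι ℂ H) := by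
    obtain ⟨s, b, hb⟩ := exists_hilbertBasis ℂ H
    -- Distinct orthonormal vectors are `√2` apart, so the balls of radius `1/2` around them are
    -- disjoint open sets in a separable space. The basis is then reindexed by a subset of `ℕ`.
    have hs : Countable s := by
      refine (Pairwise.countable_of_isOpen_disjoint
        (s := fun i : s => Metric.ball (i : H) (1 / 2)) ?_ (fun _ => Metric.isOpen_ball)
        (fun i => Metric.nonempty_ball.mpr (by norm_num)))
      intro i j hij
      refine Metric.ball_disjoint_ball ?_
      have h1 := b.orthonormal
      rw [hb] at h1
      have h2 : ‖(i : H) - j‖ ^ 2 = 2 := by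
        rw [@norm_sub_sq ℂ, h1.2 hij]
        have e1 : ‖(i : H)‖ = 1 := h1.1 i
        have e2 : ‖(j : H)‖ = 1 := h1.1 j
        rw [e1, e2]
        norm_num
      rw [dist_eq_norm]
      nlinarith [norm_nonneg ((i : H) - j)]
    obtain ⟨f, hf⟩ := hs.exists_injective_nat
    let e : s ≃ Set.range f := Equiv.ofInjective f hf
    refine ⟨Set.range f, ⟨HilbertBasis.mk (v := fun i => b (e.symm i))
      (b.orthonormal.comp _ e.symm.injective) ?_⟩⟩
    have hr : Set.range (fun i => b (e.symm i)) = Set.range b := e.symm.surjective.range_comp b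
    rw [hr, b.dense_span]
  obtain ⟨F, h1, h2⟩ := ((h ι b).and (h' ι b)).exists
  exact h1.2.symm.trans h2.2

end Index

/-! ### The Kato–Rellich theorem on a fixed domain, for one operator and for adjoint pairs -/

section KatoRellich

variable {E D : Type*} [NormedAddCommGroup E] [InnerProductSpace ℂ E] [AddCommGroup D] [Module ℂ D]

/-- The operators `c` and `c'`, defined on the domain `D` embedded into `E` by `ι`, are adjoint to
each other. -/
structure IsMutualAdjoint (ι c c' : D →ₗ[ℂ] E) : Prop where
  inner_eq : ∀ x y, inner ℂ (c x) (ι y) = inner ℂ (ι x) (c' y)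
  maximal_left : ∀ w z, (∀ h, inner ℂ w (c h) = inner ℂ z (ι h)) → ∃ d, ι d = w ∧ c' d = z
  maximal_right : ∀ w z, (∀ h, inner ℂ w (c' h) = inner ℂ z (ι h)) → ∃ d, ι d = w ∧ c d = z

theorem IsMutualAdjoint.inner_eq' {ι c c' : D →ₗ[ℂ] E} (h : IsMutualAdjoint ι c c') (x y : D) :
    inner ℂ (c' x) (ι y) = inner ℂ (ι x) (c y) := by
  rw [← inner_conj_symm, ← h.inner_eq, inner_conj_symm]

/-- For symmetric `T` the number `⟨Td, ιd⟩` is real, so the cross term with the imaginary multiple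
vanishes. -/
theorem norm_sq_add_I_smul {ι T : D →ₗ[ℂ] E}
    (hT : ∀ x y, inner ℂ (T x) (ι y) = inner ℂ (ι x) (T y)) (r : ℝ) (d : D) :
    ‖T d + (Complex.I * r) • ι d‖ ^ 2 = ‖T d‖ ^ 2 + r ^ 2 * ‖ι d‖ ^ 2 := by
  have him : (inner ℂ (T d) (ι d)).im = 0 := by
    have h := hT d d
    rw [← inner_conj_symm (ι d)] at h
    have := congrArg Complex.im h
    rw [Complex.conj_im] at this
    linarith
  rw [@norm_add_sq ℂ, inner_smul_right, norm_smul, norm_mul, Complex.norm_I, Complex.norm_real,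
    mul_pow, one_mul, Real.norm_eq_abs, sq_abs]
  have : RCLike.re (Complex.I * (r : ℂ) * inner ℂ (T d) (ι d)) = 0 := by
    simp [him]
  rw [this]
  ring

/-- The range is closed because `T + ir` is bounded below by `|r|` and maximality makes `T` closed.
It is dense because a vector orthogonal to it would be an eigenvector of the symmetric `T` with
eigenvalue `ir`. -/
theorem exists_add_I_smul_eq [CompleteSpace E] {ι T : D →ₗ[ℂ] E} (hT : IsMutualAdjoint ι T T)
    {r : ℝ} (hr : r ≠ 0) (f : E) : ∃ d, T d + (Complex.I * r) • ι d = f := by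
  set R : D →ₗ[ℂ] E := T + (Complex.I * r : ℂ) • ι with hR
  have hRd : ∀ d, R d = T d + (Complex.I * r) • ι d := fun d => rfl
  have hnorm : ∀ d, |r| * ‖ι d‖ ≤ ‖R d‖ := fun d => by
    have := norm_sq_add_I_smul hT.inner_eq r d
    rw [← hRd] at this
    refine abs_le_of_sq_le_sq' ?_ (norm_nonneg _) |>.2
    rw [this, mul_pow, sq_abs]
    nlinarith [sq_nonneg ‖T d‖]
  have hclosed : IsClosed (LinearMap.range R : Set E) := by
    refine isClosed_of_closure_subset fun g hg => ?_
    obtain ⟨u, hu, hug⟩ := mem_closure_iff_seq_limit.mp hg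
    choose d hd using hu
    have hc : CauchySeq fun n => ι (d n) := by
      have h1 := hug.cauchySeq
      rw [Metric.cauchySeq_iff'] at h1 ⊢
      intro ε hε
      obtain ⟨N, hN⟩ := h1 (|r| * ε) (by positivity)
      refine ⟨N, fun n hn => ?_⟩
      have h2 := hN n hn
      rw [dist_eq_norm, ← hd, ← hd, ← map_sub] at h2
      rw [dist_eq_norm, ← map_sub]
      exact lt_of_mul_lt_mul_left ((hnorm _).trans_lt h2) (abs_nonneg r)
    obtain ⟨w, hw⟩ := cauchySeq_tendsto_of_complete hc
    have hTd : Tendsto (fun n => T (d n)) atTop (𝓝 (g - (Complex.I * r) • w)) := by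
      have h1 := hug.sub (hw.const_smul (Complex.I * r : ℂ))
      refine h1.congr fun n => ?_
      rw [← hd, hRd, add_sub_cancel_right]
    obtain ⟨e, he1, he2⟩ := hT.maximal_left w (g - (Complex.I * r) • w) fun h =>
      tendsto_nhds_unique (hw.inner tendsto_const_nhds)
        ((hTd.inner tendsto_const_nhds).congr fun n => hT.inner_eq _ _)
    exact ⟨e, by rw [hRd, he1, he2, sub_add_cancel]⟩
  have hbot : (LinearMap.range R)ᗮ = ⊥ := by
    rw [eq_bot_iff]
    intro w hw
    have hw' : ∀ h, inner ℂ w (T h) = inner ℂ ((Complex.I * r) • w) (ι h) := fun h => by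
      have h1 : inner ℂ w (R h) = 0 := by
        rw [← inner_conj_symm, hw _ ⟨h, rfl⟩, map_zero]
      rw [hRd, inner_add_right, inner_smul_right] at h1
      rw [inner_smul_left, map_mul, Complex.conj_I, Complex.conj_ofReal]
      linear_combination h1
    obtain ⟨d, hd1, hd2⟩ := hT.maximal_left w _ hw'
    have h1 := hT.inner_eq d d
    rw [hd1, hd2, inner_smul_left, inner_smul_right, map_mul, Complex.conj_I,
      Complex.conj_ofReal] at h1
    have h2 : (Complex.I * r) * inner ℂ w w = 0 := by linear_combination -(1 / 2 : ℂ) * h1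
    have h3 : (Complex.I * r : ℂ) ≠ 0 := by simp [hr]
    exact inner_self_eq_zero.mp ((mul_eq_zero.mp h2).resolve_left h3)
  have hcomplete : CompleteSpace (LinearMap.range R) := hclosed.completeSpace_coe
  have htop : LinearMap.range R = ⊤ := (Submodule.orthogonal_eq_bot_iff).mp hbot
  exact LinearMap.range_eq_top.mp htop f

/-- The **Kato–Rellich theorem**. -/
theorem IsMutualAdjoint.perturb_self [CompleteSpace E] {ι T T₁ : D →ₗ[ℂ] E}
    (hι : Function.Injective ι) (hT : IsMutualAdjoint ι T T)
    (hT₁ : ∀ x y, inner ℂ (T₁ x) (ι y) = inner ℂ (ι x) (T₁ y)) {a b : ℝ} (ha0 : 0 ≤ a)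
    (ha : a < 1) (hb : 0 ≤ b) (hbound : ∀ d, ‖T₁ d - T d‖ ≤ a * ‖T d‖ + b * ‖ι d‖) :
    IsMutualAdjoint ι T₁ T₁ := by
  -- A large shift makes the zeroth-order part `b/r` of the bound harmless, so `b` needs no
  -- smallness.
  obtain ⟨r, hr0, hr⟩ : ∃ r : ℝ, 0 < r ∧ a + b / r < 1 := by
    refine ⟨2 * (b + 1) / (1 - a), by have := sub_pos.mpr ha; positivity, ?_⟩
    have h1 : 0 < 1 - a := sub_pos.mpr ha
    rw [div_div_eq_mul_div, ← lt_sub_iff_add_lt', div_lt_iff₀ (by positivity)]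
    nlinarith
  have hsurj : ∀ s : ℝ, |s| = r → ∀ f, ∃ d, T₁ d + (Complex.I * s) • ι d = f := by
    intro s hs f
    have hs0 : s ≠ 0 := by
      rintro rfl
      rw [abs_zero] at hs
      linarith
    have hnorm := norm_sq_add_I_smul hT.inner_eq s
    set R : D →ₗ[ℂ] E := T + (Complex.I * s : ℂ) • ι with hR
    have hRd : ∀ d, R d = T d + (Complex.I * s) • ι d := fun d => rfl
    simp only [← hRd] at hnorm
    have h1 : ∀ d, ‖T d‖ ≤ ‖R d‖ := fun d =>
      (abs_le_of_sq_le_sq' (by nlinarith [hnorm d, sq_nonneg (s * ‖ι d‖)]) (norm_nonneg _)).2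
    have h2 : ∀ d, ‖ι d‖ ≤ ‖R d‖ / r := fun d => by
      rw [le_div_iff₀ hr0, ← hs]
      refine (abs_le_of_sq_le_sq' ?_ (norm_nonneg _)).2
      rw [mul_pow, sq_abs, hnorm d]
      nlinarith [sq_nonneg ‖T d‖]
    have hinj : Function.Injective R := by
      rw [injective_iff_map_eq_zero]
      intro d hd
      have := h2 d
      rw [hd, norm_zero, zero_div] at this
      exact hι (by rw [norm_le_zero_iff.mp this, map_zero])
    let e := LinearEquiv.ofBijective R ⟨hinj, exists_add_I_smul_eq hT hs0⟩
    have he : ∀ f, R (e.symm f) = f := fun f => e.apply_symm_apply f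
    -- `T₁ + is = (1 + P)(T + is)` with `P = (T₁ - T)(T + is)⁻¹` of norm below `1`, so `T₁ + is` is
    -- onto by the Neumann series.
    let P : E →L[ℂ] E := LinearMap.mkContinuous ((T₁ - T) ∘ₗ e.symm.toLinearMap) (a + b / r)
      fun f => by
        have h3 := hbound (e.symm f)
        have h4 := h1 (e.symm f)
        have h5 := h2 (e.symm f)
        rw [he] at h4 h5
        calc ‖((T₁ - T) ∘ₗ e.symm.toLinearMap) f‖ ≤ a * ‖T (e.symm f)‖ + b * ‖ι (e.symm f)‖ := h3
          _ ≤ a * ‖f‖ + b * (‖f‖ / r) := by gcongr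
          _ = (a + b / r) * ‖f‖ := by ring
    have hP : ‖P‖ < 1 := (LinearMap.mkContinuous_norm_le _ (by positivity) _).trans_lt hr
    obtain ⟨u, hu⟩ : IsUnit (1 - -P) := isUnit_one_sub_of_norm_lt_one (by rwa [norm_neg])
    set f' : E := (u⁻¹ : (E →L[ℂ] E)ˣ).val f with hf'
    have h6 : f' + P f' = f := by
      have h3 := congrArg (fun q : E →L[ℂ] E => q f) u.mul_inv
      rw [hu] at h3
      simpa [sub_neg_eq_add] using h3
    have h7 := he f'
    have h8 : P f' = T₁ (e.symm f') - T (e.symm f') := rfl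
    refine ⟨e.symm f', ?_⟩
    rw [hRd] at h7
    have h9 : T₁ (e.symm f') + (Complex.I * s) • ι (e.symm f')
        = (T (e.symm f') + (Complex.I * s) • ι (e.symm f')) + (T₁ (e.symm f') - T (e.symm f')) := by
      abel
    rw [h9, h7, ← h8, h6]
  -- Solve `(T₁ + ir)d = z + irw`; then `w - ιd` is orthogonal to the range of `T₁ - ir`, which is
  -- everything.
  have hmax : ∀ w z, (∀ h, inner ℂ w (T₁ h) = inner ℂ z (ι h)) → ∃ d, ι d = w ∧ T₁ d = z := by
    intro w z hwz
    obtain ⟨d, hd⟩ := hsurj r (abs_of_pos hr0) (z + (Complex.I * r) • w)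
    obtain ⟨h, hh⟩ := hsurj (-r) (by rw [abs_neg, abs_of_pos hr0]) (w - ι d)
    have h1 : inner ℂ (w - ι d) (w - ι d) = 0 := by
      have h2 : inner ℂ (T₁ d + (Complex.I * r) • ι d) (ι h)
          = inner ℂ (z + (Complex.I * r) • w) (ι h) := by rw [hd]
      nth_rewrite 2 [← hh]
      simp only [inner_add_left, inner_smul_left, inner_sub_left, inner_add_right,
        inner_smul_right, hwz, ← hT₁, map_mul, Complex.conj_I, Complex.conj_ofReal] at h2 ⊢
      push_cast
      linear_combination -h2
    have h3 : w = ι d := sub_eq_zero.mp (inner_self_eq_zero.mp h1)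
    refine ⟨d, h3.symm, ?_⟩
    rw [h3] at hd
    exact add_right_cancel hd
  exact ⟨hT₁, hmax, hmax⟩

/-- The operator matrix `(0, c'; c, 0)`, defined on `D × D`. -/
def offDiag (c c' : D →ₗ[ℂ] E) : D × D →ₗ[ℂ] WithLp 2 (E × E) :=
  (WithLp.linearEquiv 2 ℂ (E × E)).symm.toLinearMap ∘ₗ
    (c' ∘ₗ LinearMap.snd ℂ D D).prod (c ∘ₗ LinearMap.fst ℂ D D)

/-- The embedding of the domain of `offDiag`. -/
def diagEmb (ι : D →ₗ[ℂ] E) : D × D →ₗ[ℂ] WithLp 2 (E × E) :=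
  (WithLp.linearEquiv 2 ℂ (E × E)).symm.toLinearMap ∘ₗ
    (ι ∘ₗ LinearMap.fst ℂ D D).prod (ι ∘ₗ LinearMap.snd ℂ D D)

theorem offDiag_apply (c c' : D →ₗ[ℂ] E) (x : D × D) :
    offDiag c c' x = WithLp.toLp 2 (c' x.2, c x.1) := rfl

theorem diagEmb_apply (ι : D →ₗ[ℂ] E) (x : D × D) :
    diagEmb ι x = WithLp.toLp 2 (ι x.1, ι x.2) := rfl

theorem inner_offDiag {ι c c' : D →ₗ[ℂ] E}
    (h : ∀ x y, inner ℂ (c x) (ι y) = inner ℂ (ι x) (c' y)) (x y : D × D) :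
    inner ℂ (offDiag c c' x) (diagEmb ι y) = inner ℂ (diagEmb ι x) (offDiag c c' y) := by
  have h' : inner ℂ (c' x.2) (ι y.1) = inner ℂ (ι x.2) (c y.1) := by
    rw [← inner_conj_symm, ← h, inner_conj_symm]
  simp only [offDiag_apply, diagEmb_apply, WithLp.prod_inner_apply]
  simp only [h, h']
  ring

/-- An adjoint pair is the same as one self-adjoint off-diagonal matrix, whose maximality splits
into the maximality of each entry. This reduces the theorem for pairs to the self-adjoint one. -/
theorem isMutualAdjoint_offDiag_iff {ι c c' : D →ₗ[ℂ] E} :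
    IsMutualAdjoint (diagEmb ι) (offDiag c c') (offDiag c c') ↔ IsMutualAdjoint ι c c' := by
  constructor
  · intro h
    refine ⟨fun x y => ?_, fun w z hwz => ?_, fun w z hwz => ?_⟩
    · have := h.inner_eq (x, 0) (0, y)
      simpa [offDiag_apply, diagEmb_apply, WithLp.prod_inner_apply] using this
    · obtain ⟨d, hd1, hd2⟩ := h.maximal_left (WithLp.toLp 2 (0, w)) (WithLp.toLp 2 (z, 0))
        fun x => by simpa [offDiag_apply, diagEmb_apply, WithLp.prod_inner_apply] using hwz x.1
      exact ⟨d.2, congrArg WithLp.snd hd1, congrArg WithLp.fst hd2⟩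
    · obtain ⟨d, hd1, hd2⟩ := h.maximal_left (WithLp.toLp 2 (w, 0)) (WithLp.toLp 2 (0, z))
        fun x => by simpa [offDiag_apply, diagEmb_apply, WithLp.prod_inner_apply] using hwz x.2
      exact ⟨d.1, congrArg WithLp.fst hd1, congrArg WithLp.snd hd2⟩
  · intro h
    have hmax : ∀ w z, (∀ x, inner ℂ w (offDiag c c' x) = inner ℂ z (diagEmb ι x)) →
        ∃ d, diagEmb ι d = w ∧ offDiag c c' d = z := by
      intro w z hwz
      obtain ⟨d1, h1, h2⟩ := h.maximal_left w.snd z.fst fun x => by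
        simpa [offDiag_apply, diagEmb_apply, WithLp.prod_inner_apply] using hwz (x, 0)
      obtain ⟨d2, h3, h4⟩ := h.maximal_right w.fst z.snd fun x => by
        simpa [offDiag_apply, diagEmb_apply, WithLp.prod_inner_apply] using hwz (0, x)
      exact ⟨(d2, d1), by rw [diagEmb_apply, h1, h3]; rfl, by rw [offDiag_apply, h2, h4]; rfl⟩
    exact ⟨inner_offDiag h.inner_eq, hmax, hmax⟩

omit [InnerProductSpace ℂ E] in
theorem norm_toLp_le (x y : E) : ‖WithLp.toLp 2 (x, y)‖ ≤ ‖x‖ + ‖y‖ := by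
  have h := WithLp.prod_norm_sq_eq_of_L2 (WithLp.toLp 2 (x, y))
  simp only [WithLp.toLp_fst, WithLp.toLp_snd] at h
  nlinarith [norm_nonneg x, norm_nonneg y, norm_nonneg (WithLp.toLp 2 (x, y))]

/-- The Kato–Rellich theorem for a pair of adjoint operators. -/
theorem IsMutualAdjoint.perturb [CompleteSpace E] {ι c c' c₁ c₁' : D →ₗ[ℂ] E}
    (hι : Function.Injective ι) (h : IsMutualAdjoint ι c c')
    (h₁ : ∀ x y, inner ℂ (c₁ x) (ι y) = inner ℂ (ι x) (c₁' y)) {a b : ℝ} (ha0 : 0 ≤ a)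
    (ha : a < 1 / 2) (hb : 0 ≤ b) (hbound : ∀ d, ‖c₁ d - c d‖ ≤ a * ‖c d‖ + b * ‖ι d‖)
    (hbound' : ∀ d, ‖c₁' d - c' d‖ ≤ a * ‖c' d‖ + b * ‖ι d‖) :
    IsMutualAdjoint ι c₁ c₁' := by
  rw [← isMutualAdjoint_offDiag_iff] at h ⊢
  -- The factor `2` comes from bounding the norm of a pair by the sum of the norms of its entries;
  -- hence the requirement `a < 1/2`.
  refine h.perturb_self ?_ (inner_offDiag h₁) (a := 2 * a) (b := 2 * b) (by positivity)
    (by linarith) (by positivity) fun d => ?_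
  · intro x y hxy
    exact Prod.ext (hι (congrArg WithLp.fst hxy)) (hι (congrArg WithLp.snd hxy))
  · have e1 : offDiag c₁ c₁' d - offDiag c c' d
        = WithLp.toLp 2 (c₁' d.2 - c' d.2, c₁ d.1 - c d.1) := rfl
    have e2 := WithLp.norm_fst_le (p := 2) (α := E) (β := E) (x := offDiag c c' d)
    have e3 := WithLp.norm_snd_le (p := 2) (α := E) (β := E) (x := offDiag c c' d)
    have e4 := WithLp.norm_fst_le (p := 2) (α := E) (β := E) (x := diagEmb ι d)
    have e5 := WithLp.norm_snd_le (p := 2) (α := E) (β := E) (x := diagEmb ι d)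
    rw [offDiag_apply] at e2 e3
    rw [diagEmb_apply] at e4 e5
    simp only [WithLp.toLp_fst, WithLp.toLp_snd] at e2 e3 e4 e5
    rw [e1, offDiag_apply, diagEmb_apply]
    refine (norm_toLp_le _ _).trans ((add_le_add (hbound' d.2) (hbound d.1)).trans ?_)
    nlinarith

end KatoRellich

/-! ### The pair `A ± iB` on `D(A) ∩ D(B)` -/

section Models

variable {H D : Type*} [NormedAddCommGroup H] [InnerProductSpace ℂ H] [AddCommGroup D] [Module ℂ D]

theorem mem_adjoint_graph_iff [CompleteSpace H] {T : H →ₗ.[ℂ] H} (hT : Dense (T.domain : Set H))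
    (w z : H) :
    (w, z) ∈ T†.graph ↔ ∀ u y, (u, y) ∈ T.graph → inner ℂ w y = inner ℂ z u := by
  rw [LinearPMap.adjoint_graph_eq_graph_adjoint hT, Submodule.mem_adjoint_iff]
  refine forall_congr' fun u => forall_congr' fun y => imp_congr_right fun _ => ?_
  rw [sub_eq_zero, ← inner_conj_symm, ← inner_conj_symm u]
  exact (starRingEnd ℂ).injective.eq_iff

theorem closure_eq_self_of_isClosed {T : H →ₗ.[ℂ] H} (hT : T.IsClosed) : T.closure = T := by
  apply LinearPMap.eq_of_eq_graph
  rw [← hT.isClosable.graph_closure_eq_closure_graph]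
  exact IsClosed.submodule_topologicalClosure_eq hT

theorem eq_of_mem_graph_iff {S T : H →ₗ.[ℂ] H}
    (h : ∀ u y, (u, y) ∈ S.graph ↔ (u, y) ∈ T.graph) : S = T :=
  LinearPMap.eq_of_eq_graph (by ext ⟨u, y⟩; exact h u y)

theorem isFormalAdjoint_graph {T : H →ₗ.[ℂ] H} (hT : T.IsFormalAdjoint T) {u v y z : H}
    (h1 : (u, y) ∈ T.graph) (h2 : (v, z) ∈ T.graph) : inner ℂ y v = inner ℂ u z := by
  obtain ⟨p, rfl, rfl⟩ := (LinearPMap.mem_graph_iff T).mp h1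
  obtain ⟨q, rfl, rfl⟩ := (LinearPMap.mem_graph_iff T).mp h2
  exact hT p q

theorem exists_apply_eq_of_mem_graph {T : H →ₗ.[ℂ] H} {u y : H} (h : (u, y) ∈ T.graph) :
    ∃ hu : u ∈ T.domain, T ⟨u, hu⟩ = y := by
  obtain ⟨p, rfl, rfl⟩ := (LinearPMap.mem_graph_iff T).mp h
  exact ⟨p.2, rfl⟩

theorem le_add_mul_of_sq_le {x y z k : ℝ} (hy : 0 ≤ y) (hz : 0 ≤ z) (hk : 0 ≤ k)
    (h : x ^ 2 ≤ y ^ 2 + k * z ^ 2) : x ≤ y + (1 + k) * z := by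
  refine (abs_le_of_sq_le_sq' ?_ (by positivity)).2
  have h1 : 0 ≤ y * ((1 + k) * z) := by positivity
  have h2 : 0 ≤ k * z ^ 2 + k ^ 2 * z ^ 2 + z ^ 2 := by positivity
  nlinarith

theorem IsSelfAdjoint.isFormalAdjoint [CompleteSpace H] {A : H →ₗ.[ℂ] H} (hA : IsSelfAdjoint A) :
    A.IsFormalAdjoint A := by
  have h := LinearPMap.adjoint_isFormalAdjoint (T := A) hA.dense_domain
  rwa [LinearPMap.isSelfAdjoint_def.mp hA] at h

theorem IsSelfAdjoint.isMutualAdjoint [CompleteSpace H] {A : H →ₗ.[ℂ] H} (hA : IsSelfAdjoint A) :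
    IsMutualAdjoint A.domain.subtype A.toFun A.toFun := by
  have hmax : ∀ w z, (∀ h, inner ℂ w (A.toFun h) = inner ℂ z (A.domain.subtype h)) →
      ∃ d, A.domain.subtype d = w ∧ A.toFun d = z := by
    intro w z hwz
    have h1 : (w, z) ∈ A†.graph := by
      rw [mem_adjoint_graph_iff hA.dense_domain]
      intro u y huy
      obtain ⟨p, rfl, rfl⟩ := (LinearPMap.mem_graph_iff A).mp huy
      exact hwz p
    rw [LinearPMap.isSelfAdjoint_def.mp hA] at h1
    exact (LinearPMap.mem_graph_iff A).mp h1
  exact ⟨IsSelfAdjoint.isFormalAdjoint hA, hmax, hmax⟩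

/-- A self-adjoint operator has no proper symmetric extension. Thus a perturbed operator, known only
to be defined on a larger domain, has exactly the original domain. -/
theorem isSelfAdjoint_of_isMutualAdjoint [CompleteSpace H] {A : H →ₗ.[ℂ] H}
    (hA : A.IsFormalAdjoint A) {ι T : D →ₗ[ℂ] H} (hT : IsMutualAdjoint ι T T)
    (hgraph : ∀ d, (ι d, T d) ∈ A.graph) (hdense : Dense (Set.range ι)) :
    IsSelfAdjoint A ∧ ∀ u ∈ A.domain, ∃ d, ι d = u := by
  have hsub : ∀ u y, (u, y) ∈ A.graph → ∃ d, ι d = u ∧ T d = y := fun u y huy =>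
    hT.maximal_left u y fun h => (isFormalAdjoint_graph hA huy (hgraph h)).symm
  have hdom : Dense (A.domain : Set H) := hdense.mono <| by
    rintro _ ⟨d, rfl⟩
    exact LinearPMap.mem_domain_of_mem_graph (hgraph d)
  refine ⟨?_, fun u hu => ?_⟩
  · rw [LinearPMap.isSelfAdjoint_def]
    refine eq_of_mem_graph_iff fun w z => ?_
    rw [mem_adjoint_graph_iff hdom]
    constructor
    · intro h
      obtain ⟨d, rfl, rfl⟩ := hT.maximal_left w z fun d => h _ _ (hgraph d)
      exact hgraph d
    · exact fun h u y huy => (isFormalAdjoint_graph hA h huy).symm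
  · obtain ⟨d, hd, -⟩ := hsub u _ (LinearPMap.mem_graph A ⟨u, hu⟩)
    exact ⟨d, hd⟩

/-- The space `D`, with the embedding `ι` and the operators `α`, `β`, is a copy of `D(A) ∩ D(B)`
with the restrictions of `A` and `B`. -/
structure IsModel (A B : H →ₗ.[ℂ] H) (ι α β : D →ₗ[ℂ] H) : Prop where
  injective : Function.Injective ι
  graph_left : ∀ d, (ι d, α d) ∈ A.graph
  graph_right : ∀ d, (ι d, β d) ∈ B.graph
  exists_eq : ∀ u, u ∈ A.domain → u ∈ B.domain → ∃ d, ι d = u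

theorem isModel_inf (A B : H →ₗ.[ℂ] H) :
    IsModel A B (A.domain ⊓ B.domain).subtype
      (A.toFun ∘ₗ Submodule.inclusion inf_le_left) (B.toFun ∘ₗ Submodule.inclusion inf_le_right) where
  injective := Subtype.val_injective
  graph_left d := LinearPMap.mem_graph A ⟨d, d.2.1⟩
  graph_right d := LinearPMap.mem_graph B ⟨d, d.2.2⟩
  exists_eq u h1 h2 := ⟨⟨u, h1, h2⟩, rfl⟩

namespace IsModel

variable {A B : H →ₗ.[ℂ] H} {ι α β : D →ₗ[ℂ] H}

theorem exists_graph (h : IsModel A B ι α β) {u a b : H} (ha : (u, a) ∈ A.graph)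
    (hb : (u, b) ∈ B.graph) : ∃ d, ι d = u ∧ α d = a ∧ β d = b := by
  obtain ⟨d, rfl⟩ := h.exists_eq u (LinearPMap.mem_domain_of_mem_graph ha)
    (LinearPMap.mem_domain_of_mem_graph hb)
  exact ⟨d, rfl, LinearPMap.mem_graph_snd_inj A (h.graph_left d) ha rfl,
    LinearPMap.mem_graph_snd_inj B (h.graph_right d) hb rfl⟩

theorem mem_graph_add_iff (h : IsModel A B ι α β) (s : ℂ) (u y : H) :
    (u, y) ∈ (A + s • B).graph ↔ ∃ d, ι d = u ∧ α d + s • β d = y := by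
  constructor
  · intro huy
    obtain ⟨⟨p, hp1, hp2⟩, rfl, rfl⟩ := (LinearPMap.mem_graph_iff _).mp huy
    obtain ⟨d, h1, h2, h3⟩ := h.exists_graph (LinearPMap.mem_graph A ⟨p, hp1⟩)
      (LinearPMap.mem_graph B ⟨p, hp2⟩)
    exact ⟨d, h1, by rw [h2, h3]; rfl⟩
  · rintro ⟨d, rfl, rfl⟩
    obtain ⟨hp1, hp2⟩ := exists_apply_eq_of_mem_graph (h.graph_left d)
    obtain ⟨hq1, hq2⟩ := exists_apply_eq_of_mem_graph (h.graph_right d)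
    refine (LinearPMap.mem_graph_iff _).mpr ⟨⟨ι d, hp1, hq1⟩, rfl, ?_⟩
    change _ = α d + s • β d
    rw [← hp2, ← hq2]
    rfl

theorem mem_graph_sub_iff (h : IsModel A B ι α β) (s : ℂ) (u y : H) :
    (u, y) ∈ (A - s • B).graph ↔ ∃ d, ι d = u ∧ α d - s • β d = y := by
  have e : A - s • B = A + (-s) • B := by
    rw [sub_eq_add_neg]
    congr 1
    exact LinearPMap.ext rfl fun x hx hx' => (neg_smul s (B ⟨x, hx⟩)).symm
  simp only [e, h.mem_graph_add_iff, neg_smul, sub_eq_add_neg]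

theorem domain_sub (h : IsModel A B ι α β) (s : ℂ) :
    ((A - s • B).domain : Set H) = Set.range ι := by
  ext u
  constructor
  · intro hu
    obtain ⟨d, hd, -⟩ := (h.mem_graph_sub_iff s _ _).mp (LinearPMap.mem_graph _ ⟨u, hu⟩)
    exact ⟨d, hd⟩
  · rintro ⟨d, rfl⟩
    exact LinearPMap.mem_domain_of_mem_graph ((h.mem_graph_sub_iff s _ _).mpr ⟨d, rfl, rfl⟩)

theorem range_eq (h : IsModel A B ι α β) :
    Set.range ι = ((A.domain ⊓ B.domain : Submodule ℂ H) : Set H) := by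
  ext u
  constructor
  · rintro ⟨d, rfl⟩
    exact ⟨LinearPMap.mem_domain_of_mem_graph (h.graph_left d),
      LinearPMap.mem_domain_of_mem_graph (h.graph_right d)⟩
  · rintro ⟨h1, h2⟩
    exact h.exists_eq u h1 h2

/-- The adjointness of `A + iB` and `A - iB`, on `D(A) ∩ D(B)`. -/
theorem opC_eq_adjoint_and_opC_eq [CompleteSpace H] (h : IsModel A B ι α β)
    (hdense : Dense (Set.range ι))
    (hmut : IsMutualAdjoint ι (α + Complex.I • β) (α - Complex.I • β)) :
    opC A B = (A - Complex.I • B)† ∧ opC A B = A + Complex.I • B := by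
  have hd : Dense ((A - Complex.I • B).domain : Set H) := by rwa [h.domain_sub]
  have h1 : A + Complex.I • B = (A - Complex.I • B)† := by
    refine eq_of_mem_graph_iff fun u y => ?_
    rw [mem_adjoint_graph_iff hd, h.mem_graph_add_iff]
    constructor
    · rintro ⟨d, rfl, rfl⟩ v z hvz
      obtain ⟨e, rfl, rfl⟩ := (h.mem_graph_sub_iff _ _ _).mp hvz
      exact (hmut.inner_eq d e).symm
    · intro huy
      exact hmut.maximal_right u y fun e =>
        huy _ _ ((h.mem_graph_sub_iff _ _ _).mpr ⟨e, rfl, rfl⟩)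
  have h2 : opC A B = A + Complex.I • B := by
    refine closure_eq_self_of_isClosed ?_
    rw [h1]
    exact LinearPMap.adjoint_isClosed hd
  exact ⟨h2.trans h1, h2⟩

theorem mem_graph_opC_iff [CompleteSpace H] (h : IsModel A B ι α β) (hdense : Dense (Set.range ι))
    (hmut : IsMutualAdjoint ι (α + Complex.I • β) (α - Complex.I • β)) (u y : H) :
    (u, y) ∈ (opC A B).graph ↔ ∃ d, ι d = u ∧ (α + Complex.I • β) d = y := by
  rw [(h.opC_eq_adjoint_and_opC_eq hdense hmut).2, h.mem_graph_add_iff]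
  rfl

theorem mem_graph_adjoint_opC_iff [CompleteSpace H] (h : IsModel A B ι α β)
    (hdense : Dense (Set.range ι))
    (hmut : IsMutualAdjoint ι (α + Complex.I • β) (α - Complex.I • β)) (u y : H) :
    (u, y) ∈ (opC A B)†.graph ↔ ∃ d, ι d = u ∧ (α - Complex.I • β) d = y := by
  have hd : Dense ((opC A B).domain : Set H) := hdense.mono <| by
    rintro _ ⟨d, rfl⟩
    exact LinearPMap.mem_domain_of_mem_graph ((h.mem_graph_opC_iff hdense hmut _ _).mpr ⟨d, rfl, rfl⟩)
  rw [mem_adjoint_graph_iff hd]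
  constructor
  · intro huy
    exact hmut.maximal_left u y fun e =>
      huy _ _ ((h.mem_graph_opC_iff hdense hmut _ _).mpr ⟨e, rfl, rfl⟩)
  · rintro ⟨d, rfl, rfl⟩ v z hvz
    obtain ⟨e, rfl, rfl⟩ := (h.mem_graph_opC_iff hdense hmut _ _).mp hvz
    exact (hmut.inner_eq' d e).symm

end IsModel

/-- Where the commutator is `K`, the graph norms of `A ± iB` dominate `A` and `B`. -/
theorem sq_norm_add_sq_norm_le {A B : H →ₗ.[ℂ] H} {ι α β : D →ₗ[ℂ] H} {K : H →L[ℂ] H}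
    (h : IsModel A B ι α β) (hK : IsCommutator A B K) (d : D) :
    ‖α d‖ ^ 2 + ‖β d‖ ^ 2 ≤ ‖(α + Complex.I • β) d‖ ^ 2 + ‖K‖ * ‖ι d‖ ^ 2 ∧
    ‖α d‖ ^ 2 + ‖β d‖ ^ 2 ≤ ‖(α - Complex.I • β) d‖ ^ 2 + ‖K‖ * ‖ι d‖ ^ 2 := by
  have hk : inner ℂ (α d) (β d) - inner ℂ (β d) (α d) = inner ℂ (ι d) (K (ι d)) := by
    obtain ⟨hp1, hp2⟩ := exists_apply_eq_of_mem_graph (h.graph_left d)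
    obtain ⟨hq1, hq2⟩ := exists_apply_eq_of_mem_graph (h.graph_right d)
    rw [← hp2, ← hq2]
    exact hK _ _ _ _ _ _
  have hb : ‖inner ℂ (ι d) (K (ι d))‖ ≤ ‖K‖ * ‖ι d‖ ^ 2 :=
    (norm_inner_le_norm _ _).trans (by nlinarith [K.le_opNorm (ι d), norm_nonneg (ι d)])
  -- The commutator form on the diagonal is `2i Im⟨αd, βd⟩`, and `∓2 Im⟨αd, βd⟩` is exactly the
  -- cross term of `‖(α ± iβ)d‖²`.
  rw [← hk, ← inner_conj_symm (β d), Complex.sub_conj] at hb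
  have him : |2 * (inner ℂ (α d) (β d)).im| ≤ ‖K‖ * ‖ι d‖ ^ 2 := by
    simpa using hb
  have hn : ‖Complex.I • β d‖ = ‖β d‖ := by simp [norm_smul]
  have hr : RCLike.re (inner ℂ (α d) (Complex.I • β d)) = -(inner ℂ (α d) (β d)).im := by
    rw [inner_smul_right]; simp
  obtain ⟨h1, h2⟩ := abs_le.mp him
  constructor
  · rw [LinearMap.add_apply, LinearMap.smul_apply, @norm_add_sq ℂ, hn, hr]
    linarith
  · rw [LinearMap.sub_apply, LinearMap.smul_apply, @norm_sub_sq ℂ, hn, hr]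
    linarith

/-- For an admissible pair with a bounded commutator, `A + iB` and `A - iB` are adjoint to each
other without taking closures. -/
theorem IsAdmissible.isMutualAdjoint [CompleteSpace H] {A B : H →ₗ.[ℂ] H} {ι α β : D →ₗ[ℂ] H}
    {K : H →L[ℂ] H} (h : IsModel A B ι α β) (hAB : IsAdmissible A B) (hK : IsCommutator A B K) :
    IsMutualAdjoint ι (α + Complex.I • β) (α - Complex.I • β) := by
  -- If `ι d` and `c d` converge along a sequence, the domination hypothesis makes `α d` and `β d`
  -- Cauchy separately, and the closedness of `A` and of `B` identifies the limits.
  have hclosed : ∀ c : D →ₗ[ℂ] H, ∀ s : ℂ, c = α + s • β →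
      (∀ d, ‖α d‖ ^ 2 + ‖β d‖ ^ 2 ≤ ‖c d‖ ^ 2 + ‖K‖ * ‖ι d‖ ^ 2) →
      ∀ (d : ℕ → D) (u y : H), Tendsto (fun n => ι (d n)) atTop (𝓝 u) →
        Tendsto (fun n => c (d n)) atTop (𝓝 y) → ∃ e, ι e = u ∧ c e = y := by
    intro c s hcs hc d u y hu hy
    have hcau : ∀ f : D →ₗ[ℂ] H, (∀ d, ‖f d‖ ^ 2 ≤ ‖c d‖ ^ 2 + ‖K‖ * ‖ι d‖ ^ 2) →
        CauchySeq fun n => f (d n) := by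
      intro f hf
      rw [Metric.cauchySeq_iff]
      intro ε hε
      obtain ⟨N, hN⟩ := Metric.cauchySeq_iff.mp hu.cauchySeq (ε / (2 * (1 + ‖K‖))) (by positivity)
      obtain ⟨N', hN'⟩ := Metric.cauchySeq_iff.mp hy.cauchySeq (ε / 2) (by positivity)
      refine ⟨max N N', fun m hm n hn => ?_⟩
      have e1 := hN m (le_of_max_le_left hm) n (le_of_max_le_left hn)
      have e2 := hN' m (le_of_max_le_right hm) n (le_of_max_le_right hn)
      rw [dist_eq_norm, ← map_sub] at e1 e2 ⊢
      rw [lt_div_iff₀ (by positivity)] at e1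
      have e3 := le_add_mul_of_sq_le (norm_nonneg _) (norm_nonneg _) (norm_nonneg K)
        (hf (d m - d n))
      linarith
    obtain ⟨a, ha⟩ := cauchySeq_tendsto_of_complete 
      (hcau α fun d => by nlinarith [hc d, sq_nonneg ‖β d‖])
    obtain ⟨b, hb⟩ := cauchySeq_tendsto_of_complete 
      (hcau β fun d => by nlinarith [hc d, sq_nonneg ‖α d‖])
    have h1 : (u, a) ∈ A.graph :=
      hAB.selfAdjoint_left.isClosed.mem_of_tendsto (hu.prodMk_nhds ha)
        (Eventually.of_forall fun n => h.graph_left (d n))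
    have h2 : (u, b) ∈ B.graph :=
      hAB.selfAdjoint_right.isClosed.mem_of_tendsto (hu.prodMk_nhds hb)
        (Eventually.of_forall fun n => h.graph_right (d n))
    obtain ⟨e, he1, he2, he3⟩ := h.exists_graph h1 h2
    refine ⟨e, he1, ?_⟩
    rw [hcs, LinearMap.add_apply, LinearMap.smul_apply, he2, he3]
    refine tendsto_nhds_unique (ha.add (hb.const_smul s)) (hy.congr fun n => ?_)
    rw [hcs]
    rfl
  have hinner : ∀ x y, inner ℂ ((α + Complex.I • β) x) (ι y)
      = inner ℂ (ι x) ((α - Complex.I • β) y) := fun x y => by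
    have e1 := isFormalAdjoint_graph (IsSelfAdjoint.isFormalAdjoint hAB.selfAdjoint_left)
      (h.graph_left x) (h.graph_left y)
    have e2 := isFormalAdjoint_graph (IsSelfAdjoint.isFormalAdjoint hAB.selfAdjoint_right)
      (h.graph_right x) (h.graph_right y)
    simp only [LinearMap.add_apply, LinearMap.sub_apply, LinearMap.smul_apply, inner_add_left,
      inner_sub_right, inner_smul_left, inner_smul_right, e1, e2, Complex.conj_I]
    ring
  have hdense : Dense (Set.range ι) := by rw [h.range_eq]; exact hAB.dense_domain
  have hopC : opC A B = A + Complex.I • B := by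
    refine closure_eq_self_of_isClosed ?_
    refine isClosed_of_closure_subset fun p hp => ?_
    obtain ⟨x, hx, hxp⟩ := mem_closure_iff_seq_limit.mp hp
    choose d hd1 hd2 using fun n => (h.mem_graph_add_iff _ _ _).mp (hx n)
    obtain ⟨e, he1, he2⟩ := hclosed (α + Complex.I • β) _ rfl
      (fun d => (sq_norm_add_sq_norm_le h hK d).1) d p.1 p.2
      (((continuous_fst.tendsto p).comp hxp).congr fun n => (hd1 n).symm)
      (((continuous_snd.tendsto p).comp hxp).congr fun n => (hd2 n).symm)
    exact (h.mem_graph_add_iff _ _ _).mpr ⟨e, he1, he2⟩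
  have hright : ∀ w z, (∀ h, inner ℂ w ((α - Complex.I • β) h) = inner ℂ z (ι h)) →
      ∃ d, ι d = w ∧ (α + Complex.I • β) d = z := by
    intro w z hwz
    have h1 : (w, z) ∈ (A - Complex.I • B)†.graph := by
      rw [mem_adjoint_graph_iff (by rwa [h.domain_sub])]
      intro u y huy
      obtain ⟨d, rfl, rfl⟩ := (h.mem_graph_sub_iff _ _ _).mp huy
      exact hwz d
    rw [← hAB.closure_eq_adjoint, hopC] at h1
    exact (h.mem_graph_add_iff _ _ _).mp h1
  refine ⟨hinner, fun w z hwz => ?_, hright⟩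
  -- The remaining maximality is `(A - iB)** = A - iB`: the graph `Γ` of `A - iB` is closed, hence
  -- its own double orthogonal complement, and a vector orthogonal to `Γ` has the form `(-(A + iB)e,
  -- e)`.
  let Γ : Submodule ℂ (WithLp 2 (H × H)) := LinearMap.range
    ((WithLp.linearEquiv 2 ℂ (H × H)).symm.toLinearMap ∘ₗ ι.prod (α - Complex.I • β))
  have hΓ : IsClosed (Γ : Set (WithLp 2 (H × H))) := by
    refine isClosed_of_closure_subset fun p hp => ?_
    obtain ⟨x, hx, hxp⟩ := mem_closure_iff_seq_limit.mp hp
    choose d hd using hx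
    obtain ⟨e, he1, he2⟩ := hclosed (α - Complex.I • β) (-Complex.I)
      (by rw [neg_smul, sub_eq_add_neg])
      (fun d => (sq_norm_add_sq_norm_le h hK d).2) d p.fst p.snd
      ((((WithLp.continuous_fst 2 H H).tendsto p).comp hxp).congr fun n => by
        rw [Function.comp_apply, ← hd n]; rfl)
      ((((WithLp.continuous_snd 2 H H).tendsto p).comp hxp).congr fun n => by
        rw [Function.comp_apply, ← hd n]; rfl)
    exact ⟨e, by
      change WithLp.toLp 2 (ι e, (α - Complex.I • β) e) = p
      rw [he1, he2]
      rfl⟩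
  have hmem : WithLp.toLp 2 (w, z) ∈ Γ := by
    have : CompleteSpace Γ := hΓ.completeSpace_coe
    rw [← Submodule.orthogonal_orthogonal Γ]
    intro p hp
    have hp' : ∀ d, inner ℂ (ι d) p.fst + inner ℂ ((α - Complex.I • β) d) p.snd = 0 := fun d =>
      hp _ ⟨d, rfl⟩
    obtain ⟨e, he1, he2⟩ := hright p.snd (-p.fst) fun d => by
      have := congrArg (starRingEnd ℂ) (hp' d)
      rw [map_add, inner_conj_symm, inner_conj_symm, map_zero] at this
      rw [inner_neg_left]
      linear_combination this
    have h3 : p.fst = -(α + Complex.I • β) e := by rw [he2, neg_neg]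
    have h4 := congrArg (starRingEnd ℂ) (hwz e)
    rw [inner_conj_symm, inner_conj_symm] at h4
    rw [WithLp.prod_inner_apply]
    change inner ℂ p.fst w + inner ℂ p.snd z = 0
    rw [h3, ← he1, inner_neg_left, h4, neg_add_cancel]
  obtain ⟨d, hd⟩ := hmem
  exact ⟨d, congrArg WithLp.fst hd, congrArg WithLp.snd hd⟩

end Models

/-! ### Compactness of an operator from that of `T† T` -/

section Compact

variable {X Y : Type*} [NormedAddCommGroup X] [InnerProductSpace ℂ X] [CompleteSpace X]
  [NormedAddCommGroup Y] [InnerProductSpace ℂ Y] [CompleteSpace Y]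

/-- If `T† T` is compact, then so is `T`. -/
theorem isCompactOperator_of_adjoint_comp_self {T : X →L[ℂ] Y}
    (h : IsCompactOperator (ContinuousLinearMap.adjoint T ∘L T)) : IsCompactOperator T := by
  refine (isCompactOperator_iff_isCompact_closure_image_closedBall (𝕜₁ := ℂ) (T : X →ₗ[ℂ] Y)
    one_pos).mpr ?_
  refine TotallyBounded.isCompact_of_isClosed (TotallyBounded.closure ?_) isClosed_closure
  have hc := (h.isCompact_closure_image_closedBall (𝕜₁ := ℂ)
    (f := ((ContinuousLinearMap.adjoint T ∘L T : X →L[ℂ] X) : X →ₗ[ℂ] X)) 1).totallyBounded.subset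
      subset_closure
  rw [Metric.totallyBounded_iff]
  intro ε hε
  -- `‖Tv‖² ≤ ‖T†Tv‖ ‖v‖` and differences of unit-ball vectors have norm at most `2`, so an
  -- `ε²/4`-net for `T†T` gives `‖Tv‖² < ε²`.
  obtain ⟨t, hts, htf, ht⟩ := Metric.finite_approx_of_totallyBounded hc (ε ^ 2 / 4) (by positivity)
  choose! f hf1 hf2 using fun y (hy : y ∈ t) => hts hy
  refine ⟨(fun y => T (f y)) '' t, htf.image _, ?_⟩
  rintro _ ⟨x, hx, rfl⟩
  obtain ⟨y, hy, hxy⟩ := Set.mem_iUnion₂.mp (ht ⟨x, hx, rfl⟩)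
  refine Set.mem_iUnion₂.mpr ⟨_, ⟨y, hy, rfl⟩, ?_⟩
  have h1 := hf1 y hy
  rw [mem_closedBall_zero_iff] at hx h1
  rw [← hf2 y hy, Metric.mem_ball, dist_eq_norm, ← map_sub] at hxy
  rw [Metric.mem_ball, dist_eq_norm]
  change ‖T x - T (f y)‖ < ε
  rw [← map_sub]
  have h2 : ‖T (x - f y)‖ ^ 2 ≤ ‖(ContinuousLinearMap.adjoint T ∘L T) (x - f y)‖ * ‖x - f y‖ := by
    have h3 : (‖T (x - f y)‖ : ℂ) ^ 2
        = inner ℂ ((ContinuousLinearMap.adjoint T ∘L T) (x - f y)) (x - f y) := by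
      rw [ContinuousLinearMap.comp_apply, ContinuousLinearMap.adjoint_inner_left,
        inner_self_eq_norm_sq_to_K]
      rfl
    have h4 := norm_inner_le_norm (𝕜 := ℂ) ((ContinuousLinearMap.adjoint T ∘L T) (x - f y))
      (x - f y)
    rwa [← h3, norm_pow, Complex.norm_real, norm_norm] at h4
  have h5 : ‖x - f y‖ ≤ 2 := (norm_sub_le _ _).trans (by linarith)
  have h6 : ‖(ContinuousLinearMap.adjoint T ∘L T) (x - f y)‖ < ε ^ 2 / 4 := hxy
  refine (abs_lt_of_sq_lt_sq' ?_ hε.le).2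
  nlinarith [norm_nonneg (x - f y), norm_nonneg ((ContinuousLinearMap.adjoint T ∘L T) (x - f y))]

end Compact

/-! ### Two-by-two block operators -/

section Blocks

variable {H : Type*} [NormedAddCommGroup H] [InnerProductSpace ℂ H]

/-- The operator on `H ⊕ H` with the block matrix `(a, b; c, d)`. -/
noncomputable def blockOp (a b c d : H →L[ℂ] H) : WithLp 2 (H × H) →L[ℂ] WithLp 2 (H × H) :=
  ((WithLp.prodContinuousLinearEquiv 2 ℂ H H).symm : H × H →L[ℂ] WithLp 2 (H × H)) ∘L
    ((a ∘L WithLp.fstL 2 ℂ H H + b ∘L WithLp.sndL 2 ℂ H H).prod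
      (c ∘L WithLp.fstL 2 ℂ H H + d ∘L WithLp.sndL 2 ℂ H H))

theorem blockOp_apply (a b c d : H →L[ℂ] H) (x : WithLp 2 (H × H)) :
    blockOp a b c d x = WithLp.toLp 2 (a x.fst + b x.snd, c x.fst + d x.snd) := rfl

theorem ext_withLp {x y : WithLp 2 (H × H)} (h1 : x.fst = y.fst) (h2 : x.snd = y.snd) : x = y :=
  (WithLp.linearEquiv 2 ℂ (H × H)).injective (Prod.ext h1 h2)

theorem inner_withLp (x y : WithLp 2 (H × H)) :
    inner ℂ x y = inner ℂ x.fst y.fst + inner ℂ x.snd y.snd := rfl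

theorem blockOp_sub (a b c d a' b' c' d' : H →L[ℂ] H) :
    blockOp a b c d - blockOp a' b' c' d' = blockOp (a - a') (b - b') (c - c') (d - d') := by
  ext x
  refine ext_withLp ?_ ?_
  · simp only [sub_apply, blockOp_apply, WithLp.sub_fst, WithLp.toLp_fst]
    abel
  · simp only [sub_apply, blockOp_apply, WithLp.sub_snd, WithLp.toLp_snd]
    abel

theorem blockOp_mul (a b c d a' b' c' d' : H →L[ℂ] H) :
    blockOp a b c d * blockOp a' b' c' d'
      = blockOp (a * a' + b * c') (a * b' + b * d') (c * a' + d * c') (c * b' + d * d') := by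
  ext x
  refine ext_withLp ?_ ?_
  · simp only [mul_apply_eq_comp, add_apply, blockOp_apply, WithLp.toLp_fst, WithLp.toLp_snd,
      map_add]
    abel
  · simp only [mul_apply_eq_comp, add_apply, blockOp_apply, WithLp.toLp_fst, WithLp.toLp_snd,
      map_add]
    abel

theorem norm_blockOp_le (a b c d : H →L[ℂ] H) :
    ‖blockOp a b c d‖ ≤ ‖a‖ + ‖b‖ + ‖c‖ + ‖d‖ := by
  refine ContinuousLinearMap.opNorm_le_bound _ (by positivity) fun x => ?_
  have h1 := WithLp.norm_fst_le (p := 2) (α := H) (β := H) x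
  have h2 := WithLp.norm_snd_le (p := 2) (α := H) (β := H) x
  rw [blockOp_apply]
  refine (norm_toLp_le _ _).trans ?_
  refine (add_le_add (norm_add_le _ _) (norm_add_le _ _)).trans ?_
  have e1 := (a.le_opNorm x.fst).trans (mul_le_mul_of_nonneg_left h1 (norm_nonneg a))
  have e2 := (b.le_opNorm x.snd).trans (mul_le_mul_of_nonneg_left h2 (norm_nonneg b))
  have e3 := (c.le_opNorm x.fst).trans (mul_le_mul_of_nonneg_left h1 (norm_nonneg c))
  have e4 := (d.le_opNorm x.snd).trans (mul_le_mul_of_nonneg_left h2 (norm_nonneg d))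
  linarith

theorem isCompactOperator_blockOp {a b c d : H →L[ℂ] H} (ha : IsCompactOperator a)
    (hb : IsCompactOperator b) (hc : IsCompactOperator c) (hd : IsCompactOperator d) :
    IsCompactOperator (blockOp a b c d) := by
  have key : ∀ (i : H →L[ℂ] WithLp 2 (H × H)) (p : WithLp 2 (H × H) →L[ℂ] H) (t : H →L[ℂ] H),
      IsCompactOperator t → IsCompactOperator (i ∘L t ∘L p) := fun i p t ht =>
    (ht.comp_clm p).clm_comp i
  let i₁ : H →L[ℂ] WithLp 2 (H × H) :=
    ((WithLp.prodContinuousLinearEquiv 2 ℂ H H).symm : H × H →L[ℂ] WithLp 2 (H × H)) ∘L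
      ContinuousLinearMap.inl ℂ H H
  let i₂ : H →L[ℂ] WithLp 2 (H × H) :=
    ((WithLp.prodContinuousLinearEquiv 2 ℂ H H).symm : H × H →L[ℂ] WithLp 2 (H × H)) ∘L
      ContinuousLinearMap.inr ℂ H H
  have h := (((key i₁ (WithLp.fstL 2 ℂ H H) a ha).add (key i₁ (WithLp.sndL 2 ℂ H H) b hb)).add
    (key i₂ (WithLp.fstL 2 ℂ H H) c hc)).add (key i₂ (WithLp.sndL 2 ℂ H H) d hd)
  refine (congrArg IsCompactOperator (funext fun x => ?_)).mpr h
  refine ext_withLp ?_ ?_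
  · change a x.fst + b x.snd = ((a x.fst + b x.snd) + 0) + 0
    rw [add_zero, add_zero]
  · change c x.fst + d x.snd = ((0 + 0) + c x.fst) + d x.snd
    rw [add_zero, zero_add]

theorem isSymmetric_blockOp [CompleteSpace H] {a b d : H →L[ℂ] H}
    (ha : IsSelfAdjoint a) (hd : IsSelfAdjoint d) :
    (blockOp a b (ContinuousLinearMap.adjoint b) d :
      WithLp 2 (H × H) →ₗ[ℂ] WithLp 2 (H × H)).IsSymmetric := fun x y => by
  have h1 : ∀ u v, inner ℂ (a u) v = inner ℂ u (a v) := ha.isSymmetric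
  have h2 : ∀ u v, inner ℂ (d u) v = inner ℂ u (d v) := hd.isSymmetric
  simp only [ContinuousLinearMap.coe_coe, blockOp_apply, inner_withLp, WithLp.toLp_fst,
    WithLp.toLp_snd]
  simp only [inner_add_left, inner_add_right, h1, h2, ContinuousLinearMap.adjoint_inner_left,
    ContinuousLinearMap.adjoint_inner_right]
  ring

end Blocks

/-! ### The operator `Q` as a norm-continuous function of bounded operators -/

section Bott

variable {H 𝒢 : Type*} [NormedAddCommGroup H] [InnerProductSpace ℂ H] [CompleteSpace H]
  [NormedAddCommGroup 𝒢] [InnerProductSpace ℂ 𝒢] [CompleteSpace 𝒢]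

open ContinuousLinearMap (adjoint)

/-- The Gram operator `j† j + k† k`. -/
noncomputable def gram (j k : 𝒢 →L[ℂ] H) : 𝒢 →L[ℂ] 𝒢 := adjoint j ∘L j + adjoint k ∘L k

theorem inner_gram (j k : 𝒢 →L[ℂ] H) (x y : 𝒢) :
    inner ℂ (gram j k x) y = inner ℂ (j x) (j y) + inner ℂ (k x) (k y) := by
  rw [gram, add_apply, inner_add_left, ContinuousLinearMap.comp_apply,
    ContinuousLinearMap.comp_apply, ContinuousLinearMap.adjoint_inner_left,
    ContinuousLinearMap.adjoint_inner_left]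

theorem isSelfAdjoint_gram (j k : 𝒢 →L[ℂ] H) : IsSelfAdjoint (gram j k) := by
  rw [ContinuousLinearMap.isSelfAdjoint_iff_isSymmetric]
  intro x y
  change inner ℂ (gram j k x) y = inner ℂ x (gram j k y)
  rw [← inner_conj_symm x, inner_gram, inner_gram, map_add, inner_conj_symm, inner_conj_symm]

/-- The operator `m (j† j + k† k)⁻¹ j†`; for `m = j` it is `Δ⁻¹`, for `m = C j` it is `C Δ⁻¹`. -/
noncomputable def sandwich (j k m : 𝒢 →L[ℂ] H) : H →L[ℂ] H :=
  m ∘L Ring.inverse (gram j k) ∘L adjoint j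

/-- The operator `Q` expressed by the embedding `j` and the operators `k = C† j` and `m = C j`. -/
noncomputable def bottOp (j k m : 𝒢 →L[ℂ] H) : WithLp 2 (H × H) →L[ℂ] WithLp 2 (H × H) :=
  blockOp (sandwich j k j) (sandwich j k m) (adjoint (sandwich j k m)) (1 - sandwich j k j)

theorem adjoint_ringInverse_gram (j k : 𝒢 →L[ℂ] H) :
    adjoint (Ring.inverse (gram j k)) = Ring.inverse (gram j k) := by
  have h := Ring.inverse_star (gram j k)
  rw [(isSelfAdjoint_gram j k).star_eq] at h
  exact h.symm

theorem adjoint_sandwich (j k m : 𝒢 →L[ℂ] H) :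
    adjoint (sandwich j k m) = j ∘L Ring.inverse (gram j k) ∘L adjoint m := by
  rw [sandwich, ContinuousLinearMap.adjoint_comp, ContinuousLinearMap.adjoint_comp,
    ContinuousLinearMap.adjoint_adjoint, adjoint_ringInverse_gram, ContinuousLinearMap.comp_assoc]

theorem isSelfAdjoint_sandwich (j k : 𝒢 →L[ℂ] H) : IsSelfAdjoint (sandwich j k j) :=
  adjoint_sandwich j k j

theorem isSymmetric_bottOp (j k m : 𝒢 →L[ℂ] H) :
    (bottOp j k m : WithLp 2 (H × H) →ₗ[ℂ] WithLp 2 (H × H)).IsSymmetric :=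
  isSymmetric_blockOp (isSelfAdjoint_sandwich j k)
    ((IsSelfAdjoint.one _).sub (isSelfAdjoint_sandwich j k))

/-- After subtracting `diag(0,1)` every block is a product containing `j` or `j†`. -/
theorem isCompactOperator_bottOp_sub {j : 𝒢 →L[ℂ] H} (hj : IsCompactOperator j)
    (hj' : IsCompactOperator (adjoint j)) (k m : 𝒢 →L[ℂ] H) :
    IsCompactOperator (bottOp j k m - sndProj H) := by
  have h1 : ∀ m : 𝒢 →L[ℂ] H, IsCompactOperator (sandwich j k m) := fun m =>
    (hj'.clm_comp (Ring.inverse (gram j k))).clm_comp m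
  have h2 : IsCompactOperator (adjoint (sandwich j k m)) := by
    rw [adjoint_sandwich]
    exact hj.comp_clm (Ring.inverse (gram j k) ∘L adjoint m)
  have h3 : sndProj H = blockOp 0 0 0 1 := by
    ext x
    rw [sndProj_apply, blockOp_apply]
    simp
  rw [bottOp, h3, blockOp_sub]
  refine isCompactOperator_blockOp (by simpa using h1 j) (by simpa using h1 m) (by simpa using h2) ?_
  rw [show (1 : H →L[ℂ] H) - sandwich j k j - 1 = -sandwich j k j by abel]
  exact (h1 j).neg

/-- Inversion is continuous at units. Holding `𝒢` and `j` fixed is what turns a relatively bounded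
perturbation of unbounded operators into a norm perturbation of `Q`. -/
theorem exists_gram_bottOp_close {j k m : 𝒢 →L[ℂ] H} (hu : IsUnit (gram j k)) {ε : ℝ}
    (hε : 0 < ε) : ∃ δ > 0, ∀ k₁ m₁ : 𝒢 →L[ℂ] H, ‖k₁ - k‖ < δ → ‖m₁ - m‖ < δ →
      IsUnit (gram j k₁) ∧ ‖bottOp j k₁ m₁ - bottOp j k m‖ < ε := by
  have hg : Continuous fun k₁ : 𝒢 →L[ℂ] H => gram j k₁ := by
    unfold gram
    have : Continuous fun k₁ : 𝒢 →L[ℂ] H => adjoint k₁ :=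
      (adjoint : (𝒢 →L[ℂ] H) ≃ₗᵢ⋆[ℂ] (H →L[ℂ] 𝒢)).continuous
    fun_prop
  obtain ⟨u, hu'⟩ := hu
  have hinv : ContinuousAt (fun k₁ : 𝒢 →L[ℂ] H => Ring.inverse (gram j k₁)) k := by
    refine ContinuousAt.comp (g := Ring.inverse) (f := fun k₁ : 𝒢 →L[ℂ] H => gram j k₁) ?_
      hg.continuousAt
    simp only [← hu']
    exact NormedRing.inverse_continuousAt u
  have hS : ∀ f : (𝒢 →L[ℂ] H) × (𝒢 →L[ℂ] H) → (𝒢 →L[ℂ] H), Continuous f →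
      ContinuousAt (fun p : (𝒢 →L[ℂ] H) × (𝒢 →L[ℂ] H) => sandwich j p.1 (f p)) (k, m) := by
    intro f hf
    have h1 : ContinuousAt (fun p : (𝒢 →L[ℂ] H) × (𝒢 →L[ℂ] H) => Ring.inverse (gram j p.1))
        (k, m) := 
      ContinuousAt.comp (g := fun k₁ : 𝒢 →L[ℂ] H => Ring.inverse (gram j k₁)) (f := Prod.fst)
        hinv continuousAt_fst
    exact hf.continuousAt.clm_comp (h1.clm_comp continuousAt_const)
  have hunit : ∀ᶠ p : (𝒢 →L[ℂ] H) × (𝒢 →L[ℂ] H) in 𝓝 (k, m), IsUnit (gram j p.1) := by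
    have h1 : ContinuousAt (fun p : (𝒢 →L[ℂ] H) × (𝒢 →L[ℂ] H) => gram j p.1) (k, m) :=
      (hg.comp continuous_fst).continuousAt
    exact h1.eventually_mem (Units.isOpen.mem_nhds ⟨u, hu'⟩)
  have e1 := Metric.continuousAt_iff'.mp (hS (fun _ => j) continuous_const) (ε / 4) (by positivity)
  have e2 := Metric.continuousAt_iff'.mp (hS Prod.snd continuous_snd) (ε / 4) (by positivity)
  obtain ⟨δ, hδ, h⟩ := Metric.eventually_nhds_iff.mp (hunit.and (e1.and e2))
  refine ⟨δ, hδ, fun k₁ m₁ hk hm => ?_⟩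
  obtain ⟨h1, h2, h3⟩ := h (y := (k₁, m₁)) (by
    rw [Prod.dist_eq, dist_eq_norm, dist_eq_norm]
    exact max_lt hk hm)
  refine ⟨h1, ?_⟩
  rw [dist_eq_norm] at h2 h3
  rw [bottOp, bottOp, blockOp_sub]
  refine (norm_blockOp_le _ _ _ _).trans_lt ?_
  rw [← map_sub, LinearIsometryEquiv.norm_map, sub_sub_sub_cancel_left, norm_sub_rev _ (sandwich j k₁ j)]
  simp only at h2 h3
  linarith

/-- A symmetric coercive Gram operator is invertible. -/
theorem isUnit_gram_of_le {j k : 𝒢 →L[ℂ] H} {M : ℝ}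
    (h : ∀ x, ‖x‖ ^ 2 ≤ M * (‖j x‖ ^ 2 + ‖k x‖ ^ 2)) : IsUnit (gram j k) := by
  have h0 : ∀ x, (0 : ℝ) ≤ ‖j x‖ ^ 2 + ‖k x‖ ^ 2 := fun x => by positivity
  have hM : (0 : ℝ) < max M 1 := lt_max_of_lt_right one_pos
  refine ContinuousLinearMap.isUnit_of_forall_le_norm_inner_map (gram j k)
    (c := ⟨(max M 1)⁻¹, by positivity⟩) (inv_pos.mpr hM : (0 : ℝ) < (max M 1)⁻¹) fun x => ?_
  rw [inner_gram, inner_self_eq_norm_sq_to_K, inner_self_eq_norm_sq_to_K]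
  have h1 : ‖((‖j x‖ : ℂ) ^ 2 + (‖k x‖ : ℂ) ^ 2)‖ = ‖j x‖ ^ 2 + ‖k x‖ ^ 2 := by
    rw [← Complex.ofReal_pow, ← Complex.ofReal_pow, ← Complex.ofReal_add, Complex.norm_real,
      Real.norm_of_nonneg (h0 x)]
  change ‖x‖ ^ 2 * (max M 1)⁻¹ ≤ ‖((‖j x‖ : ℂ) ^ 2 + (‖k x‖ : ℂ) ^ 2)‖
  rw [h1, mul_inv_le_iff₀ hM]
  have := mul_le_mul_of_nonneg_right (le_max_left M 1) (h0 x)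
  linarith [h x]

end Bott

/-! ### Realizing `Δ⁻¹` and `Q` on the graph space of `A - iB` -/

section HilbertModels

variable {H 𝒢 : Type*} [NormedAddCommGroup H] [InnerProductSpace ℂ H] [CompleteSpace H]
  [NormedAddCommGroup 𝒢] [InnerProductSpace ℂ 𝒢] [CompleteSpace 𝒢]

open ContinuousLinearMap (adjoint)

/-- A model of the pair `(A, B)` on a Hilbert space, by bounded operators, such that `A + iB` and
`A - iB` are adjoint to each other. -/
structure IsHilbertModel (A B : H →ₗ.[ℂ] H) (j α β : 𝒢 →L[ℂ] H) : Prop where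
  isModel : IsModel A B (j : 𝒢 →ₗ[ℂ] H) (α : 𝒢 →ₗ[ℂ] H) (β : 𝒢 →ₗ[ℂ] H)
  dense : Dense (Set.range j)
  isMutualAdjoint : IsMutualAdjoint (j : 𝒢 →ₗ[ℂ] H)
    ((α : 𝒢 →ₗ[ℂ] H) + Complex.I • (β : 𝒢 →ₗ[ℂ] H))
    ((α : 𝒢 →ₗ[ℂ] H) - Complex.I • (β : 𝒢 →ₗ[ℂ] H))

theorem IsDeltaInv.unique {A B : H →ₗ.[ℂ] H} {S S' : H →L[ℂ] H} (h : IsDeltaInv A B S)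
    (h' : IsDeltaInv A B S') : S = S' := by
  ext x
  obtain ⟨y, h1, h2⟩ := h.right_inv x
  have h3 := h'.left_inv _ _ _ h1 h2
  rw [add_sub_cancel] at h3
  exact h3.symm

namespace IsHilbertModel

variable {A B : H →ₗ.[ℂ] H} {j α β : 𝒢 →L[ℂ] H}

omit [CompleteSpace 𝒢] in
theorem mem_graph_opC_iff (h : IsHilbertModel A B j α β) (u y : H) :
    (u, y) ∈ (opC A B).graph ↔ ∃ x, j x = u ∧ (α + Complex.I • β) x = y :=
  h.isModel.mem_graph_opC_iff h.dense h.isMutualAdjoint u y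

omit [CompleteSpace 𝒢] in
theorem mem_graph_adjoint_opC_iff (h : IsHilbertModel A B j α β) (u y : H) :
    (u, y) ∈ (opC A B)†.graph ↔ ∃ x, j x = u ∧ (α - Complex.I • β) x = y :=
  h.isModel.mem_graph_adjoint_opC_iff h.dense h.isMutualAdjoint u y

omit [CompleteSpace H] [CompleteSpace 𝒢] in
theorem inner_eq (h : IsHilbertModel A B j α β) (x y : 𝒢) :
    inner ℂ ((α + Complex.I • β) x) (j y) = inner ℂ (j x) ((α - Complex.I • β) y) :=
  h.isMutualAdjoint.inner_eq x y

omit [CompleteSpace H] [CompleteSpace 𝒢] in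
theorem inner_eq' (h : IsHilbertModel A B j α β) (x y : 𝒢) :
    inner ℂ ((α - Complex.I • β) x) (j y) = inner ℂ (j x) ((α + Complex.I • β) y) :=
  h.isMutualAdjoint.inner_eq' x y

theorem gram_inverse_apply {j k : 𝒢 →L[ℂ] H} (hu : IsUnit (gram j k)) (x : 𝒢) :
    gram j k (Ring.inverse (gram j k) x) = x :=
  congrArg (fun q : 𝒢 →L[ℂ] 𝒢 => q x) (Ring.mul_inverse_cancel _ hu)

theorem inverse_gram_apply {j k : 𝒢 →L[ℂ] H} (hu : IsUnit (gram j k)) (x : 𝒢) :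
    Ring.inverse (gram j k) (gram j k x) = x :=
  congrArg (fun q : 𝒢 →L[ℂ] 𝒢 => q x) (Ring.inverse_mul_cancel _ hu)

/-- With `g = (j†j + k†k)⁻¹ j†x` one has `⟨jg, jy⟩ + ⟨kg, ky⟩ = ⟨x, jy⟩` for all `y`. This says that
`kg = C†(jg)` lies in `D(C)` and `C(kg) = x - jg`, that is, `Δ(jg) = x`. -/
theorem isDeltaInv (h : IsHilbertModel A B j α β) (hu : IsUnit (gram j (α - Complex.I • β))) :
    IsDeltaInv A B (sandwich j (α - Complex.I • β) j) where
  right_inv x := by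
    set k := α - Complex.I • β with hk
    set g := Ring.inverse (gram j k) (adjoint j x) with hg
    refine ⟨k g, (h.mem_graph_adjoint_opC_iff _ _).mpr ⟨g, rfl, rfl⟩,
      (h.mem_graph_opC_iff _ _).mpr ?_⟩
    refine h.isMutualAdjoint.maximal_right _ _ fun y => ?_
    have h1 : inner ℂ (gram j k g) y = inner ℂ (adjoint j x) y := by
      rw [hg, gram_inverse_apply hu]
    rw [inner_gram, ContinuousLinearMap.adjoint_inner_left] at h1
    change inner ℂ (k g) (k y) = inner ℂ (x - j g) (j y)
    rw [inner_sub_left]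
    linear_combination h1
  left_inv u y z huy hyz := by
    set k := α - Complex.I • β with hk
    obtain ⟨d, rfl, hd⟩ := (h.mem_graph_adjoint_opC_iff _ _).mp huy
    obtain ⟨e, he, rfl⟩ := (h.mem_graph_opC_iff _ _).mp hyz
    have h1 : adjoint j (j d + (α + Complex.I • β) e) = gram j k d := by
      refine ext_inner_right ℂ fun x => ?_
      rw [ContinuousLinearMap.adjoint_inner_left, inner_gram, inner_add_left, h.inner_eq, he, ← hd]
    change j (Ring.inverse (gram j k) (adjoint j (j d + (α + Complex.I • β) e))) = j d
    rw [h1, inverse_gram_apply hu]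

/-- The lower left block is taken as the adjoint of `C Δ⁻¹`; it agrees with `Δ⁻¹ C†` on `D(C†)`
because adjointness of `A ± iB` gives `m†j = j†k`. -/
theorem isBottOperator (h : IsHilbertModel A B j α β)
    (hu : IsUnit (gram j (α - Complex.I • β))) :
    IsBottOperator A B (bottOp j (α - Complex.I • β) (α + Complex.I • β)) := by
  refine ⟨_, sandwich j (α - Complex.I • β) (α + Complex.I • β),
    adjoint (sandwich j (α - Complex.I • β) (α + Complex.I • β)), h.isDeltaInv hu,
    fun x => (h.mem_graph_opC_iff _ _).mpr ⟨_, rfl, rfl⟩, fun x y hxy => ?_, fun u v => rfl⟩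
  obtain ⟨d, rfl, rfl⟩ := (h.mem_graph_adjoint_opC_iff _ _).mp hxy
  rw [adjoint_sandwich]
  have h1 : adjoint (α + Complex.I • β) (j d) = adjoint j ((α - Complex.I • β) d) := by
    refine ext_inner_right ℂ fun x => ?_
    rw [ContinuousLinearMap.adjoint_inner_left, ContinuousLinearMap.adjoint_inner_left, h.inner_eq']
  change j (Ring.inverse (gram j (α - Complex.I • β)) (adjoint (α + Complex.I • β) (j d))) = _
  rw [h1]
  rfl

-- `Δ⁻¹` is unique, `C Δ⁻¹` is read off the graph of `C`, and the extension of `Δ⁻¹ C†` is fixed on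
-- the dense subspace `D(C†)`.
omit [CompleteSpace 𝒢] in
theorem bottOperator_unique (h : IsHilbertModel A B j α β)
    {Q Q' : WithLp 2 (H × H) →L[ℂ] WithLp 2 (H × H)} (hQ : IsBottOperator A B Q)
    (hQ' : IsBottOperator A B Q') : Q = Q' := by
  obtain ⟨S, G, L, hS, hG, hL, hq⟩ := hQ
  obtain ⟨S', G', L', hS', hG', hL', hq'⟩ := hQ'
  have e1 : S = S' := IsDeltaInv.unique hS hS'
  subst e1
  have e2 : G = G' := by
    ext x
    exact LinearPMap.mem_graph_snd_inj _ (hG x) (hG' x) rfl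
  have e3 : L = L' := by
    refine ContinuousLinearMap.coeFn_injective
      (L.continuous.ext_on h.dense L'.continuous ?_)
    rintro _ ⟨d, rfl⟩
    have hd := (h.mem_graph_adjoint_opC_iff _ _).mpr ⟨d, rfl, rfl⟩
    rw [hL _ _ hd, hL' _ _ hd]
  subst e2 e3
  ext x
  exact (hq x.fst x.snd).trans (hq' x.fst x.snd).symm

/-- For the graph norm the Gram operator is `1` and `Δ⁻¹ = j j†`. So `j†` is compact, hence `j†j`,
hence `j`. -/
theorem isCompactOperator_embedding (h : IsHilbertModel A B j α β)
    (hgram : gram j (α - Complex.I • β) = 1) {S : H →L[ℂ] H} (hS : IsDeltaInv A B S)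
    (hcpt : IsCompactOperator S) : IsCompactOperator j ∧ IsCompactOperator (adjoint j) := by
  have hu : IsUnit (gram j (α - Complex.I • β)) := hgram ▸ isUnit_one
  have h1 : S = j ∘L adjoint j := by
    rw [IsDeltaInv.unique hS (h.isDeltaInv hu), sandwich, hgram, Ring.inverse_one]
    rfl
  have h2 : IsCompactOperator (adjoint j) := by
    refine isCompactOperator_of_adjoint_comp_self ?_
    rw [ContinuousLinearMap.adjoint_adjoint, ← h1]
    exact hcpt
  exact ⟨isCompactOperator_of_adjoint_comp_self (h2.comp_clm j), h2⟩

end IsHilbertModel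
/-- Every admissible pair with a bounded commutator has a model on a Hilbert space whose norm is the
graph norm of `A - iB`. -/
theorem IsAdmissible.exists_isHilbertModel {A B : H →ₗ.[ℂ] H} {K : H →L[ℂ] H}
    (hAB : IsAdmissible A B) (hK : IsCommutator A B K) :
    ∃ (Γ : Submodule ℂ (WithLp 2 (H × H))) (_ : CompleteSpace Γ) (j α β : Γ →L[ℂ] H),
      IsHilbertModel A B j α β ∧ gram j (α - Complex.I • β) = 1 := by
  have hmod := isModel_inf A B
  have hmut := hAB.isMutualAdjoint hmod hK
  set ι := (A.domain ⊓ B.domain).subtype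
  set α₀ : ↥(A.domain ⊓ B.domain) →ₗ[ℂ] H := A.toFun ∘ₗ Submodule.inclusion inf_le_left with hα₀
  set β₀ : ↥(A.domain ⊓ B.domain) →ₗ[ℂ] H := B.toFun ∘ₗ Submodule.inclusion inf_le_right with hβ₀
  set c' := α₀ - Complex.I • β₀ with hc'
  -- The model space is the graph of `A - iB`; it is complete because maximality makes the graph
  -- closed.
  let φ : ↥(A.domain ⊓ B.domain) →ₗ[ℂ] WithLp 2 (H × H) :=
    (WithLp.linearEquiv 2 ℂ (H × H)).symm.toLinearMap ∘ₗ ι.prod c'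
  have hφ : Function.Injective φ := fun x y hxy => hmod.injective (congrArg WithLp.fst hxy)
  have hclosed : IsClosed (LinearMap.range φ : Set (WithLp 2 (H × H))) := by
    refine isClosed_of_closure_subset fun p hp => ?_
    obtain ⟨x, hx, hxp⟩ := mem_closure_iff_seq_limit.mp hp
    choose d hd using hx
    have h1 : Tendsto (fun n => ι (d n)) atTop (𝓝 p.fst) :=
      (((WithLp.continuous_fst 2 H H).tendsto p).comp hxp).congr fun n => by
        rw [Function.comp_apply, ← hd n]; rfl
    have h2 : Tendsto (fun n => c' (d n)) atTop (𝓝 p.snd) :=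
      (((WithLp.continuous_snd 2 H H).tendsto p).comp hxp).congr fun n => by
        rw [Function.comp_apply, ← hd n]; rfl
    obtain ⟨e, he1, he2⟩ := hmut.maximal_left p.fst p.snd fun h =>
      tendsto_nhds_unique (h1.inner tendsto_const_nhds)
        ((h2.inner tendsto_const_nhds).congr fun n => hmut.inner_eq' _ _)
    exact ⟨e, ext_withLp he1 he2⟩
  let e := LinearEquiv.ofInjective φ hφ
  have hnorm : ∀ x : LinearMap.range φ, ‖x‖ ^ 2 = ‖ι (e.symm x)‖ ^ 2 + ‖c' (e.symm x)‖ ^ 2 := by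
    intro x
    obtain ⟨d, rfl⟩ := e.surjective x
    rw [e.symm_apply_apply]
    exact WithLp.prod_norm_sq_eq_of_L2 (φ d)
  have hle : ∀ x : LinearMap.range φ, ‖ι (e.symm x)‖ ≤ ‖x‖ ∧ ‖c' (e.symm x)‖ ≤ ‖x‖ := fun x =>
    ⟨(abs_le_of_sq_le_sq' (by nlinarith [hnorm x, sq_nonneg ‖c' (e.symm x)‖]) (norm_nonneg _)).2,
      (abs_le_of_sq_le_sq' (by nlinarith [hnorm x, sq_nonneg ‖ι (e.symm x)‖]) (norm_nonneg _)).2⟩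
  -- This is where the bounded commutator makes `A` and `B` separately bounded for the graph norm of
  -- `A - iB`.
  have hbound : ∀ f : ↥(A.domain ⊓ B.domain) →ₗ[ℂ] H,
      (∀ d, ‖f d‖ ^ 2 ≤ ‖c' d‖ ^ 2 + ‖K‖ * ‖ι d‖ ^ 2) →
      ∀ x : LinearMap.range φ, ‖(f ∘ₗ e.symm.toLinearMap) x‖ ≤ (2 + ‖K‖) * ‖x‖ := by
    intro f hf x
    have h1 := le_add_mul_of_sq_le (norm_nonneg _) (norm_nonneg _) (norm_nonneg K) (hf (e.symm x))
    have h2 := mul_le_mul_of_nonneg_left (hle x).1 (by positivity : 0 ≤ 1 + ‖K‖)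
    exact h1.trans (by linarith [(hle x).2])
  let j : LinearMap.range φ →L[ℂ] H := LinearMap.mkContinuous (ι ∘ₗ e.symm.toLinearMap) 1
    fun x => by rw [one_mul]; exact (hle x).1
  let α : LinearMap.range φ →L[ℂ] H := LinearMap.mkContinuous (α₀ ∘ₗ e.symm.toLinearMap) _
    (hbound α₀ fun d => by nlinarith [(sq_norm_add_sq_norm_le hmod hK d).2, sq_nonneg ‖β₀ d‖])
  let β : LinearMap.range φ →L[ℂ] H := LinearMap.mkContinuous (β₀ ∘ₗ e.symm.toLinearMap) _
    (hbound β₀ fun d => by nlinarith [(sq_norm_add_sq_norm_le hmod hK d).2, sq_nonneg ‖α₀ d‖])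
  have hcs : CompleteSpace (LinearMap.range φ) := hclosed.completeSpace_coe
  have hmodel : IsModel A B (j : LinearMap.range φ →ₗ[ℂ] H) (α : LinearMap.range φ →ₗ[ℂ] H)
      (β : LinearMap.range φ →ₗ[ℂ] H) :=
    { injective := hmod.injective.comp e.symm.injective
      graph_left := fun x => hmod.graph_left (e.symm x)
      graph_right := fun x => hmod.graph_right (e.symm x)
      exists_eq := fun u h1 h2 => by
        obtain ⟨d, hd⟩ := hmod.exists_eq u h1 h2
        exact ⟨e d, (congrArg ι (e.symm_apply_apply d)).trans hd⟩ }
  refine ⟨LinearMap.range φ, hcs, j, α, β, ⟨hmodel, ?_, hAB.isMutualAdjoint hmodel hK⟩, ?_⟩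
  · have := hmodel.range_eq
    rw [ContinuousLinearMap.coe_coe] at this
    rw [this]
    exact hAB.dense_domain
  · refine ContinuousLinearMap.ext fun x => ext_inner_right ℂ fun y => ?_
    rw [inner_gram]
    change inner ℂ (ι (e.symm x)) (ι (e.symm y)) + inner ℂ (c' (e.symm x)) (c' (e.symm y)) = _
    obtain ⟨d, rfl⟩ := e.surjective x
    obtain ⟨d', rfl⟩ := e.surjective y
    rw [e.symm_apply_apply, e.symm_apply_apply]
    rfl

end HilbertModels

/-! ### `Q` is an almost projection when the commutator is small -/

section Estimate

variable {H 𝒢 : Type*} [NormedAddCommGroup H] [InnerProductSpace ℂ H] [CompleteSpace H]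
  [NormedAddCommGroup 𝒢] [InnerProductSpace ℂ 𝒢] [CompleteSpace 𝒢]

open ContinuousLinearMap (adjoint)

theorem norm_le_one_of_gram_eq_one {j k : 𝒢 →L[ℂ] H} (h : gram j k = 1) :
    ‖j‖ ≤ 1 ∧ ‖k‖ ≤ 1 := by
  have h1 : ∀ x, ‖j x‖ ^ 2 + ‖k x‖ ^ 2 = ‖x‖ ^ 2 := fun x => by
    have h2 := inner_gram j k x x
    rw [h] at h2
    change inner ℂ x x = _ at h2
    rw [inner_self_eq_norm_sq_to_K, inner_self_eq_norm_sq_to_K, inner_self_eq_norm_sq_to_K] at h2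
    exact_mod_cast h2.symm
  constructor
  · refine ContinuousLinearMap.opNorm_le_bound _ zero_le_one fun x => ?_
    rw [one_mul]
    exact (abs_le_of_sq_le_sq' (by nlinarith [h1 x, sq_nonneg ‖k x‖]) (norm_nonneg _)).2
  · refine ContinuousLinearMap.opNorm_le_bound _ zero_le_one fun x => ?_
    rw [one_mul]
    exact (abs_le_of_sq_le_sq' (by nlinarith [h1 x, sq_nonneg ‖j x‖]) (norm_nonneg _)).2

variable {A B : H →ₗ.[ℂ] H} {j α β : 𝒢 →L[ℂ] H} {K : H →L[ℂ] H}

-- The form version of `C†C - CC† = 2i[A,B]`.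
omit [CompleteSpace H] [CompleteSpace 𝒢] in
theorem IsHilbertModel.inner_commutator (h : IsHilbertModel A B j α β) (hK : IsCommutator A B K)
    (x y : 𝒢) :
    inner ℂ ((α + Complex.I • β) x) ((α + Complex.I • β) y)
      = inner ℂ ((α - Complex.I • β) x) ((α - Complex.I • β) y)
        + 2 * Complex.I * inner ℂ (j x) (K (j y)) := by
  have h1 : inner ℂ (α x) (β y) - inner ℂ (β x) (α y) = inner ℂ (j x) (K (j y)) := by
    obtain ⟨hp1, hp2⟩ := exists_apply_eq_of_mem_graph (h.isModel.graph_left x)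
    obtain ⟨hq1, hq2⟩ := exists_apply_eq_of_mem_graph (h.isModel.graph_right x)
    obtain ⟨hr1, hr2⟩ := exists_apply_eq_of_mem_graph (h.isModel.graph_left y)
    obtain ⟨hs1, hs2⟩ := exists_apply_eq_of_mem_graph (h.isModel.graph_right y)
    have := hK _ _ hp1 hq1 hr1 hs1
    rw [hp2, hq2, hr2, hs2] at this
    exact this
  rw [← h1]
  simp only [add_apply, sub_apply, smul_apply, inner_add_left,
    inner_add_right, inner_sub_left, inner_sub_right, inner_smul_left, inner_smul_right,
    Complex.conj_I]
  ring

/-- The commutation relation between `Δ⁻¹` and `C`. -/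
theorem IsHilbertModel.comp_adjoint_eq (h : IsHilbertModel A B j α β) (hK : IsCommutator A B K)
    (hgram : gram j (α - Complex.I • β) = 1) :
    (α + Complex.I • β) ∘L adjoint j
      = j ∘L adjoint (α - Complex.I • β)
        + (j ∘L adjoint (α - Complex.I • β)) * adjoint ((2 * Complex.I) • K) * (j ∘L adjoint j) := by
  set k := α - Complex.I • β with hk
  set m := α + Complex.I • β with hm
  ext x
  have hu : IsUnit (gram j k) := hgram ▸ isUnit_one
  set g := adjoint j x with hg
  obtain ⟨y, hy1, hy2⟩ := (h.isDeltaInv hu).right_inv x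
  have hS : sandwich j k j x = j g := by
    rw [sandwich, hgram, Ring.inverse_one]
    rfl
  rw [← hk] at hy1 hy2
  rw [hS] at hy1 hy2
  obtain ⟨g', hg1, hg2⟩ := (h.mem_graph_adjoint_opC_iff _ _).mp hy1
  obtain ⟨e, he1, he2⟩ := (h.mem_graph_opC_iff _ _).mp hy2
  have hgg' : g' = g := h.isModel.injective hg1
  rw [hgg', ← hk] at hg2
  rw [← hm] at he2
  set z := adjoint ((2 * Complex.I) • K) (j g) with hz
  -- Formally `CΔ⁻¹ - Δ⁻¹C = Δ⁻¹(ΔC - CΔ)Δ⁻¹ = Δ⁻¹C(C†C - CC†)Δ⁻¹`. Rigorously, `hw` puts `CΔ⁻¹x`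
  -- into `D(C†)`. Using the adjoint of `2iK` avoids proving that `2iK` is self-adjoint.
  have hw : ∀ v, inner ℂ (m g) (m v) = inner ℂ (x - j g + z) (j v) := fun v => by
    have e1 : inner ℂ (k g) (k v) = inner ℂ (x - j g) (j v) := by
      rw [hg2, ← he1, ← he2, h.inner_eq]
    have e2 : inner ℂ z (j v) = 2 * Complex.I * inner ℂ (j g) (K (j v)) := by
      rw [hz, ContinuousLinearMap.adjoint_inner_left, smul_apply,
        inner_smul_right]
    rw [h.inner_commutator hK, inner_add_left, ← e1, e2]
  obtain ⟨d, hd1, hd2⟩ := h.isMutualAdjoint.maximal_left _ _ hw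
  have hd : d = adjoint k (x + z) := by
    refine ext_inner_right ℂ fun v => ?_
    have e1 : inner ℂ (gram j k d) v = inner ℂ d v := by rw [hgram]; rfl
    change j d = m g at hd1
    change k d = x - j g + z at hd2
    rw [← e1, inner_gram, hd1, hd2, ContinuousLinearMap.adjoint_inner_left, h.inner_eq, ← hk,
      ← inner_add_left]
    congr 1
    abel
  change m g = j (adjoint k x) + j (adjoint k z)
  rw [← map_add, ← map_add, ← hd]
  exact hd1.symm

theorem norm_adjoint_two_I_smul_le (K : H →L[ℂ] H) :
    ‖adjoint ((2 * Complex.I) • K)‖ ≤ 2 * ‖K‖ := by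
  rw [LinearIsometryEquiv.norm_map, norm_smul]
  simp

/-- If the commutator is small, then `Q` is an almost projection. -/
theorem IsHilbertModel.norm_bottOp_sq_sub_lt (h : IsHilbertModel A B j α β)
    (hK : IsCommutator A B K) (hgram : gram j (α - Complex.I • β) = 1) (hlt : ‖K‖ < 0.02) :
    ‖bottOp j (α - Complex.I • β) (α + Complex.I • β)
        * bottOp j (α - Complex.I • β) (α + Complex.I • β)
      - bottOp j (α - Complex.I • β) (α + Complex.I • β)‖ < 1 / 4 := by
  have hcomm := h.comp_adjoint_eq hK hgram
  have hinner := h.inner_commutator hK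
  have hie := h.inner_eq
  set k := α - Complex.I • β with hk
  set m := α + Complex.I • β with hm
  set X : H →L[ℂ] H := (2 * Complex.I) • K with hX
  set Z := adjoint X with hZ
  set S : H →L[ℂ] H := j ∘L adjoint j with hS
  set R : H →L[ℂ] H := j ∘L adjoint k with hR
  set G : H →L[ℂ] H := m ∘L adjoint j with hG
  obtain ⟨hj1, hk1⟩ := norm_le_one_of_gram_eq_one hgram
  have hprod : ∀ a b : 𝒢 →L[ℂ] H, ‖a‖ ≤ 1 → ‖b‖ ≤ 1 → ‖a ∘L adjoint b‖ ≤ 1 := fun a b ha hb => by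
    refine (ContinuousLinearMap.opNorm_comp_le _ _).trans ?_
    rw [LinearIsometryEquiv.norm_map]
    exact mul_le_one₀ ha (norm_nonneg _) hb
  have nS : ‖S‖ ≤ 1 := hprod _ _ hj1 hj1
  have nR : ‖R‖ ≤ 1 := hprod _ _ hj1 hk1
  have nZ : ‖Z‖ ≤ 2 * ‖K‖ := norm_adjoint_two_I_smul_le K
  have nX : ‖X‖ ≤ 2 * ‖K‖ := by rwa [hZ, LinearIsometryEquiv.norm_map] at nZ
  have nR' : ‖adjoint R‖ ≤ 1 := by rwa [LinearIsometryEquiv.norm_map]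
  have hSs : adjoint S = S := by
    rw [hS, ContinuousLinearMap.adjoint_comp, ContinuousLinearMap.adjoint_adjoint]
  have hG' : adjoint G = adjoint R + S * X * adjoint R := by
    have h1 : ∀ a b : H →L[ℂ] H, adjoint (a * b) = adjoint b * adjoint a := fun a b => star_mul a b
    rw [hcomm, map_add, h1, h1, hSs, hZ, ContinuousLinearMap.adjoint_adjoint, mul_assoc]
  have hkk : adjoint k ∘L k = 1 - adjoint j ∘L j := by
    rw [← hgram, gram]
    abel
  have hmm : adjoint m ∘L m = adjoint k ∘L k + adjoint j ∘L X ∘L j := by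
    refine ContinuousLinearMap.ext fun x => ext_inner_left ℂ fun y => ?_
    simp only [ContinuousLinearMap.comp_apply, add_apply, inner_add_right,
      ContinuousLinearMap.adjoint_inner_right, hinner, hX, smul_apply,
      inner_smul_right]
  have hjm : adjoint j ∘L m = adjoint k ∘L j := by
    refine ContinuousLinearMap.ext fun x => ext_inner_right ℂ fun y => ?_
    simp only [ContinuousLinearMap.comp_apply, ContinuousLinearMap.adjoint_inner_left, hie]
  have hjkkj : j ∘L (adjoint k ∘L k) ∘L adjoint j = S - S * S := by
    rw [hkk]
    ext x
    simp [hS]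
  -- `R` is the bounded extension of `Δ⁻¹C`; since `k†k = 1 - j†j`, the operators `S`, `R` satisfy
  -- exactly the relation that would make `Q` a projection if `G` were `R`.
  have hRR : R * adjoint R = S - S * S := by
    rw [← hjkkj, hR, ContinuousLinearMap.adjoint_comp, ContinuousLinearMap.adjoint_adjoint]
    rfl
  have hGG : adjoint G * G = S - S * S + S * X * S := by
    rw [← hjkkj, hG, ContinuousLinearMap.adjoint_comp, ContinuousLinearMap.adjoint_adjoint]
    have h1 : (j ∘L adjoint m) * (m ∘L adjoint j) = j ∘L (adjoint m ∘L m) ∘L adjoint j := rfl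
    rw [h1, hmm, ContinuousLinearMap.add_comp, ContinuousLinearMap.comp_add]
    rfl
  have hSG : S * G = R * S := by
    have h1 : S * G = j ∘L (adjoint j ∘L m) ∘L adjoint j := rfl
    rw [h1, hjm]
    rfl
  have hGS : adjoint G * S = S * adjoint R := by
    have h1 := congrArg adjoint hSG
    have h2 : ∀ a b : H →L[ℂ] H, adjoint (a * b) = adjoint b * adjoint a := fun a b => star_mul a b
    rwa [h2, h2, hSs] at h1
  have hQ : bottOp j k m = blockOp S G (adjoint G) (1 - S) := by
    rw [bottOp, sandwich, sandwich, hgram, Ring.inverse_one]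
    rfl
  have hQQ : bottOp j k m * bottOp j k m - bottOp j k m
      = blockOp (R * Z * S * adjoint R + R * S * X * adjoint R
          + R * Z * S * S * X * adjoint R) (-(R * Z * S * S)) (-(S * S * X * adjoint R))
          (S * X * S) := by
    rw [hQ, blockOp_mul, blockOp_sub]
    congr 1
    · have e : G * adjoint G = R * adjoint R + R * Z * S * adjoint R + R * S * X * adjoint R
          + R * Z * S * S * X * adjoint R := by
        rw [hG', hcomm]
        noncomm_ring
      rw [e, hRR]
      abel
    · rw [mul_sub, mul_one, hSG, hcomm]
      noncomm_ring
    · rw [sub_mul, one_mul, hGS, hG']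
      noncomm_ring
    · rw [hGG]
      noncomm_ring
  rw [hQQ]
  have hκ := norm_nonneg K
  have mul2 : ∀ (a b : H →L[ℂ] H) (p q : ℝ), ‖a‖ ≤ p → ‖b‖ ≤ q → ‖a * b‖ ≤ p * q :=
    fun a b p q ha hb => (norm_mul_le a b).trans
      (mul_le_mul ha hb (norm_nonneg _) ((norm_nonneg _).trans ha))
  have b1 := mul2 _ _ _ _ (mul2 _ _ _ _ (mul2 _ _ _ _ nR nZ) nS) nR'
  have b2 := mul2 _ _ _ _ (mul2 _ _ _ _ (mul2 _ _ _ _ nR nS) nX) nR'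
  have b3 := mul2 _ _ _ _ (mul2 _ _ _ _ (mul2 _ _ _ _ (mul2 _ _ _ _ (mul2 _ _ _ _ nR nZ) nS) nS)
    nX) nR'
  have b4 := mul2 _ _ _ _ (mul2 _ _ _ _ (mul2 _ _ _ _ nR nZ) nS) nS
  have b5 := mul2 _ _ _ _ (mul2 _ _ _ _ (mul2 _ _ _ _ nS nS) nX) nR'
  have b6 := mul2 _ _ _ _ (mul2 _ _ _ _ nS nX) nS
  -- With `κ = ‖K‖` the blocks contribute at most `(4κ + 4κ²) + 2κ + 2κ + 2κ = 10κ + 4κ²`, which is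
  -- below `1/4` for `κ < 0.02`.
  refine (norm_blockOp_le _ _ _ _).trans_lt ?_
  rw [norm_neg, norm_neg]
  have b0 := (norm_add_le (R * Z * S * adjoint R + R * S * X * adjoint R)
    (R * Z * S * S * X * adjoint R)).trans
      (add_le_add_left (norm_add_le (R * Z * S * adjoint R) (R * S * X * adjoint R)) _)
  nlinarith

end Estimate

/-! ### Stability of admissibility and of `ω` under relatively small perturbations -/

section Perturbation

variable {H 𝒢 : Type*} [NormedAddCommGroup H] [InnerProductSpace ℂ H] [CompleteSpace H]
  [NormedAddCommGroup 𝒢] [InnerProductSpace ℂ 𝒢] [CompleteSpace 𝒢]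

open ContinuousLinearMap (adjoint)

/-- The symmetric operator `A₁` is defined on `D(A)`, where
`‖(A₁ - A) x‖ ≤ a * ‖A x‖ + b * ‖x‖`. -/
structure IsRelClose (a b : ℝ) (A A₁ : H →ₗ.[ℂ] H) : Prop where
  symmetric : A₁.IsFormalAdjoint A₁
  domain_le : A.domain ≤ A₁.domain
  bound : ∀ (x : H) (hx : x ∈ A.domain),
    ‖A₁ ⟨x, domain_le hx⟩ - A ⟨x, hx⟩‖ ≤ a * ‖A ⟨x, hx⟩‖ + b * ‖x‖

/-- Kato–Rellich makes the restriction of `A₁` to `D(A)` self-adjoint, and its symmetric extension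
`A₁` cannot be larger. -/
theorem IsRelClose.isSelfAdjoint {A A₁ : H →ₗ.[ℂ] H} {a b : ℝ} (h : IsRelClose a b A A₁)
    (ha0 : 0 ≤ a) (ha : a < 1) (hb : 0 ≤ b) (hA : IsSelfAdjoint A) :
    IsSelfAdjoint A₁ ∧ A₁.domain ≤ A.domain := by
  have h1 := (IsSelfAdjoint.isMutualAdjoint hA).perturb_self
    (T₁ := A₁.toFun ∘ₗ Submodule.inclusion h.domain_le) A.domain.injective_subtype
    (fun x y => h.symmetric ⟨x, h.domain_le x.2⟩ ⟨y, h.domain_le y.2⟩) ha0 ha hb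
    (fun d => h.bound d d.2)
  obtain ⟨h2, h3⟩ := isSelfAdjoint_of_isMutualAdjoint h.symmetric h1
    (fun d => LinearPMap.mem_graph A₁ ⟨d, h.domain_le d.2⟩) (by simpa using hA.dense_domain)
  refine ⟨h2, fun u hu => ?_⟩
  obtain ⟨d, rfl⟩ := h3 u hu
  exact d.2

-- Transports `A₁` to the model space of the unperturbed pair: the relative bound against the
-- bounded `α` and `j` becomes an operator norm bound.
omit [CompleteSpace H] [CompleteSpace 𝒢] in
theorem IsRelClose.exists_extension {A A₁ : H →ₗ.[ℂ] H} {a b : ℝ} (h : IsRelClose a b A A₁)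
    (ha0 : 0 ≤ a) (hb : 0 ≤ b) {j α : 𝒢 →L[ℂ] H} (hj : ‖j‖ ≤ 1)
    (hgraph : ∀ x, (j x, α x) ∈ A.graph) :
    ∃ α₁ : 𝒢 →L[ℂ] H, (∀ x, (j x, α₁ x) ∈ A₁.graph) ∧ ‖α₁ - α‖ ≤ a * ‖α‖ + b ∧
      ∀ x, ‖α₁ x - α x‖ ≤ a * ‖α x‖ + b * ‖j x‖ := by
  have hmem : ∀ x, j x ∈ A₁.domain := fun x =>
    h.domain_le (LinearPMap.mem_domain_of_mem_graph (hgraph x))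
  let α' : 𝒢 →ₗ[ℂ] H := A₁.toFun ∘ₗ (j : 𝒢 →ₗ[ℂ] H).codRestrict A₁.domain hmem
  have hb' : ∀ x, ‖α' x - α x‖ ≤ a * ‖α x‖ + b * ‖j x‖ := fun x => by
    obtain ⟨h1, h2⟩ := exists_apply_eq_of_mem_graph (hgraph x)
    have h3 := h.bound (j x) h1
    rwa [h2] at h3
  let V : 𝒢 →L[ℂ] H := LinearMap.mkContinuous (α' - (α : 𝒢 →ₗ[ℂ] H)) (a * ‖α‖ + b) fun x => by
    refine (hb' x).trans ?_
    have h1 := mul_le_mul_of_nonneg_left (α.le_opNorm x) ha0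
    have h2 := (j.le_opNorm x).trans (mul_le_mul_of_nonneg_right hj (norm_nonneg x))
    have h3 := mul_le_mul_of_nonneg_left h2 hb
    linarith
  have hV : ∀ x, (α + V) x = α' x := fun x => add_sub_cancel (α x) (α' x)
  refine ⟨α + V, fun x => ?_, ?_, fun x => ?_⟩
  · rw [hV]
    exact LinearPMap.mem_graph A₁ ⟨j x, hmem x⟩
  · rw [add_sub_cancel_left]
    exact LinearMap.mkContinuous_norm_le _ (by positivity) _
  · rw [hV]
    exact hb' x

/-- A pair close to a pair with a Hilbert space model has a model on the same space. -/
theorem IsHilbertModel.exists_perturbed {A B A₁ B₁ : H →ₗ.[ℂ] H} {j α β : 𝒢 →L[ℂ] H}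
    {K : H →L[ℂ] H} (h : IsHilbertModel A B j α β) (hA : IsSelfAdjoint A) (hB : IsSelfAdjoint B)
    (hK : IsCommutator A B K) (hgram : gram j (α - Complex.I • β) = 1) {a b : ℝ} (ha0 : 0 ≤ a)
    (ha : a < 1 / 4) (hb : 0 ≤ b) (hA₁ : IsRelClose a b A A₁) (hB₁ : IsRelClose a b B B₁) :
    ∃ α₁ β₁ : 𝒢 →L[ℂ] H, IsHilbertModel A₁ B₁ j α₁ β₁ ∧
      IsUnit (gram j (α₁ - Complex.I • β₁)) ∧
      ‖α₁ - α‖ ≤ a * ‖α‖ + b ∧ ‖β₁ - β‖ ≤ a * ‖β‖ + b := by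
  obtain ⟨hj, -⟩ := norm_le_one_of_gram_eq_one hgram
  obtain ⟨α₁, hα₁, hα₂, hα₃⟩ := hA₁.exists_extension ha0 hb hj h.isModel.graph_left
  obtain ⟨β₁, hβ₁, hβ₂, hβ₃⟩ := hB₁.exists_extension ha0 hb hj h.isModel.graph_right
  have hmodel : IsModel A₁ B₁ (j : 𝒢 →ₗ[ℂ] H) (α₁ : 𝒢 →ₗ[ℂ] H) (β₁ : 𝒢 →ₗ[ℂ] H) :=
    { injective := h.isModel.injective
      graph_left := hα₁
      graph_right := hβ₁
      exists_eq := fun u h1 h2 => h.isModel.exists_eq u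
        ((hA₁.isSelfAdjoint ha0 (by linarith) hb hA).2 h1)
        ((hB₁.isSelfAdjoint ha0 (by linarith) hb hB).2 h2) }
  set b' : ℝ := 2 * a * (1 + ‖K‖) + 2 * b with hb'
  have hb'0 : 0 ≤ b' := by positivity
  have hI : ∀ y : H, ‖Complex.I • y‖ = ‖y‖ := fun y => by simp [norm_smul]
  have hαβ : ∀ (c : 𝒢 →ₗ[ℂ] H) (x : 𝒢), ‖α x‖ ^ 2 + ‖β x‖ ^ 2 ≤ ‖c x‖ ^ 2 + ‖K‖ * ‖j x‖ ^ 2 →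
      a * ‖α x‖ + b * ‖j x‖ + (a * ‖β x‖ + b * ‖j x‖) ≤ 2 * a * ‖c x‖ + b' * ‖j x‖ := by
    intro c x hx
    have h1 := le_add_mul_of_sq_le (x := ‖α x‖) (norm_nonneg (c x)) (norm_nonneg (j x))
      (norm_nonneg K) (by nlinarith [sq_nonneg ‖β x‖])
    have h2 := le_add_mul_of_sq_le (x := ‖β x‖) (norm_nonneg (c x)) (norm_nonneg (j x))
      (norm_nonneg K) (by nlinarith [sq_nonneg ‖α x‖])
    have h3 := mul_le_mul_of_nonneg_left (add_le_add h1 h2) ha0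
    rw [hb']
    linarith
  have hc : ∀ x, ‖(α₁ + Complex.I • β₁) x - (α + Complex.I • β) x‖
      ≤ 2 * a * ‖(α + Complex.I • β) x‖ + b' * ‖j x‖ := fun x => by
    refine le_trans ?_ (hαβ ((α : 𝒢 →ₗ[ℂ] H) + Complex.I • (β : 𝒢 →ₗ[ℂ] H)) x
      (sq_norm_add_sq_norm_le h.isModel hK x).1)
    have e : (α₁ + Complex.I • β₁) x - (α + Complex.I • β) x
        = (α₁ x - α x) + Complex.I • (β₁ x - β x) := by
      simp only [add_apply, smul_apply, smul_sub]
      abel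
    rw [e]
    refine (norm_add_le _ _).trans ?_
    rw [hI]
    exact add_le_add (hα₃ x) (hβ₃ x)
  have hc' : ∀ x, ‖(α₁ - Complex.I • β₁) x - (α - Complex.I • β) x‖
      ≤ 2 * a * ‖(α - Complex.I • β) x‖ + b' * ‖j x‖ := fun x => by
    refine le_trans ?_ (hαβ ((α : 𝒢 →ₗ[ℂ] H) - Complex.I • (β : 𝒢 →ₗ[ℂ] H)) x
      (sq_norm_add_sq_norm_le h.isModel hK x).2)
    have e : (α₁ - Complex.I • β₁) x - (α - Complex.I • β) x
        = (α₁ x - α x) - Complex.I • (β₁ x - β x) := by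
      simp only [sub_apply, smul_apply, smul_sub]
      abel
    rw [e]
    refine (norm_sub_le _ _).trans ?_
    rw [hI]
    exact add_le_add (hα₃ x) (hβ₃ x)
  have hsymm : ∀ x y, inner ℂ (((α₁ : 𝒢 →ₗ[ℂ] H) + Complex.I • (β₁ : 𝒢 →ₗ[ℂ] H)) x) (j y)
      = inner ℂ (j x) (((α₁ : 𝒢 →ₗ[ℂ] H) - Complex.I • (β₁ : 𝒢 →ₗ[ℂ] H)) y) := fun x y => by
    have e1 := isFormalAdjoint_graph hA₁.symmetric (hα₁ x) (hα₁ y)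
    have e2 := isFormalAdjoint_graph hB₁.symmetric (hβ₁ x) (hβ₁ y)
    simp only [LinearMap.add_apply, LinearMap.sub_apply, LinearMap.smul_apply,
      ContinuousLinearMap.coe_coe, inner_add_left, inner_sub_right, inner_smul_left,
      inner_smul_right, e1, e2, Complex.conj_I]
    ring
  have hmut := h.isMutualAdjoint.perturb h.isModel.injective hsymm (a := 2 * a) (b := b')
    (by positivity) (by linarith) hb'0 hc hc'
  refine ⟨α₁, β₁, ⟨hmodel, h.dense, hmut⟩, ?_, hα₂, hβ₂⟩
  -- Old and new graph norms are equivalent: since `1 - 2a ≥ 1/2`, one has `p ≤ 2q + 2b'‖jx‖` below,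
  -- so `p² ≤ 8q² + 8b'²‖jx‖²`.
  refine isUnit_gram_of_le (M := 9 + 8 * b' ^ 2) fun x => ?_
  have h1 : ‖x‖ ^ 2 = ‖j x‖ ^ 2 + ‖(α - Complex.I • β) x‖ ^ 2 := by
    have h2 := inner_gram j (α - Complex.I • β) x x
    rw [hgram] at h2
    change inner ℂ x x = _ at h2
    rw [inner_self_eq_norm_sq_to_K, inner_self_eq_norm_sq_to_K, inner_self_eq_norm_sq_to_K] at h2
    exact_mod_cast h2
  have h2 : ‖(α - Complex.I • β) x‖ ≤ 2 * ‖(α₁ - Complex.I • β₁) x‖ + 2 * b' * ‖j x‖ := by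
    have h3 := norm_sub_norm_le ((α - Complex.I • β) x) ((α₁ - Complex.I • β₁) x)
    rw [norm_sub_rev] at h3
    nlinarith [hc' x, norm_nonneg ((α - Complex.I • β) x)]
  rw [h1]
  set p := ‖(α - Complex.I • β) x‖
  set q := ‖(α₁ - Complex.I • β₁) x‖
  have h3 : p ^ 2 ≤ (2 * q + 2 * b' * ‖j x‖) ^ 2 := pow_le_pow_left₀ (norm_nonneg _) h2 2
  nlinarith [sq_nonneg (2 * q - 2 * b' * ‖j x‖), sq_nonneg (b' * q), sq_nonneg q, sq_nonneg ‖j x‖]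

theorem IsHilbertModel.isAdmissible {A B : H →ₗ.[ℂ] H} {j α β : 𝒢 →L[ℂ] H}
    (h : IsHilbertModel A B j α β) (hA : IsSelfAdjoint A) (hB : IsSelfAdjoint B)
    (hu : IsUnit (gram j (α - Complex.I • β))) (hj : IsCompactOperator (adjoint j)) :
    IsAdmissible A B where
  selfAdjoint_left := hA
  selfAdjoint_right := hB
  dense_domain := by
    rw [← h.isModel.range_eq]
    exact h.dense
  closure_eq_adjoint := (h.isModel.opC_eq_adjoint_and_opC_eq h.dense h.isMutualAdjoint).1
  compact_inv := ⟨_, h.isDeltaInv hu,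
    (hj.clm_comp (Ring.inverse (gram j (α - Complex.I • β)))).clm_comp j⟩

/-- Admissibility is stable under perturbations of small relative bound. -/
theorem IsAdmissible.perturb {A B A₁ B₁ : H →ₗ.[ℂ] H} {K : H →L[ℂ] H} (hAB : IsAdmissible A B)
    (hK : IsCommutator A B K) {a b : ℝ} (ha0 : 0 ≤ a) (ha : a < 1 / 4) (hb : 0 ≤ b)
    (hA₁ : IsRelClose a b A A₁) (hB₁ : IsRelClose a b B B₁) : IsAdmissible A₁ B₁ := by
  obtain ⟨Γ, hΓ, j, α, β, h, hgram⟩ := hAB.exists_isHilbertModel hK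
  obtain ⟨S, hS, hcpt⟩ := hAB.compact_inv
  obtain ⟨α₁, β₁, h₁, hu, -, -⟩ := h.exists_perturbed hAB.selfAdjoint_left hAB.selfAdjoint_right
    hK hgram ha0 ha hb hA₁ hB₁
  exact h₁.isAdmissible (hA₁.isSelfAdjoint ha0 (by linarith) hb hAB.selfAdjoint_left).1
    (hB₁.isSelfAdjoint ha0 (by linarith) hb hAB.selfAdjoint_right).1 hu
    (h.isCompactOperator_embedding hgram hS hcpt).2

theorem omegaDefined_and_omega_eq {A B : H →ₗ.[ℂ] H} {w : ℤ} (h : HasOmega A B w)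
    (hw : ∀ w', HasOmega A B w' → w' = w) : OmegaDefined A B ∧ omega A B = w := by
  have hd : OmegaDefined A B := ⟨w, h, hw⟩
  refine ⟨hd, ?_⟩
  rw [omega, dif_pos hd]
  exact hw _ hd.choose_spec.1

theorem hasOmega_omega {A B : H →ₗ.[ℂ] H} (h : OmegaDefined A B) : HasOmega A B (omega A B) := by
  rw [omega, dif_pos h]
  exact h.choose_spec.1

theorem IsHilbertModel.omega_eq [TopologicalSpace.SeparableSpace H] {A B : H →ₗ.[ℂ] H}
    {j α β : 𝒢 →L[ℂ] H} (h : IsHilbertModel A B j α β)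
    (hu : IsUnit (gram j (α - Complex.I • β))) {w : ℤ}
    (hlt : ‖bottOp j (α - Complex.I • β) (α + Complex.I • β)
        * bottOp j (α - Complex.I • β) (α + Complex.I • β)
      - bottOp j (α - Complex.I • β) (α + Complex.I • β)‖ < 1 / 4)
    (hw : HasTruncationIndex (bottOp j (α - Complex.I • β) (α + Complex.I • β)) w) :
    OmegaDefined A B ∧ omega A B = w := by
  refine omegaDefined_and_omega_eq ⟨_, h.isBottOperator hu, hlt, hw⟩ ?_
  rintro w' ⟨Q, hQ, -, hQw⟩
  rw [h.bottOperator_unique hQ (h.isBottOperator hu)] at hQw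
  exact HasTruncationIndex.unique hQw hw

omit [CompleteSpace H] [CompleteSpace 𝒢] in
theorem norm_I_smul (T : 𝒢 →L[ℂ] H) : ‖Complex.I • T‖ = ‖T‖ := by
  rw [norm_smul, Complex.norm_I, one_mul]

/-- If the commutator of an admissible pair is small, then `ω` is defined and locally constant. -/
theorem IsAdmissible.exists_omega_eq_of_isRelClose [TopologicalSpace.SeparableSpace H]
    {A B : H →ₗ.[ℂ] H} {K : H →L[ℂ] H} (hAB : IsAdmissible A B) (hK : IsCommutator A B K)
    (hlt : ‖K‖ < 0.02) :
    OmegaDefined A B ∧ ∃ δ > 0, ∀ A₁ B₁ : H →ₗ.[ℂ] H, IsRelClose δ δ A A₁ → IsRelClose δ δ B B₁ →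
      IsAdmissible A₁ B₁ ∧ OmegaDefined A₁ B₁ ∧ omega A₁ B₁ = omega A B := by
  obtain ⟨Γ, hΓ, j, α, β, h, hgram⟩ := hAB.exists_isHilbertModel hK
  obtain ⟨S, hS, hcpt⟩ := hAB.compact_inv
  obtain ⟨hj, hj'⟩ := h.isCompactOperator_embedding hgram hS hcpt
  have hu : IsUnit (gram j (α - Complex.I • β)) := hgram ▸ isUnit_one
  obtain ⟨w, ε, hε, hw⟩ := exists_hasTruncationIndex_of_close (isSymmetric_bottOp j _ _)
    (isCompactOperator_bottOp_sub hj hj' (α - Complex.I • β) (α + Complex.I • β))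
    (h.norm_bottOp_sq_sub_lt hK hgram hlt)
  -- The original pair is the case of zero perturbation, so it gets the same integer `w` as all its
  -- neighbours.
  obtain ⟨w1, w2⟩ := hw _ (isSymmetric_bottOp j _ _) (isCompactOperator_bottOp_sub hj hj' _ _)
    (by rwa [sub_self, norm_zero])
  obtain ⟨hdef, homega⟩ := h.omega_eq hu w1 w2
  refine ⟨hdef, ?_⟩
  obtain ⟨δ', hδ', hclose⟩ := exists_gram_bottOp_close (m := α + Complex.I • β) hu hε
  -- The perturbations of `α` and `β` add up to at most `δ(‖α‖ + ‖β‖ + 2)`; the constant `3` makes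
  -- the comparison with `δ'` strict, and `1/8` keeps `δ` below the admissible `1/4`.
  set N := ‖α‖ + ‖β‖ + 3 with hN
  have hN0 : 0 < N := by positivity
  have hδ0 : 0 < min (1 / 8) (δ' / N) := lt_min (by norm_num) (by positivity)
  refine ⟨min (1 / 8) (δ' / N), hδ0, fun A₁ B₁ hA₁ hB₁ => ?_⟩
  set δ := min (1 / 8) (δ' / N)
  have hδ1 : δ ≤ 1 / 8 := min_le_left _ _
  have hδ2 : δ * N ≤ δ' := (le_div_iff₀ hN0).mp (min_le_right _ _)
  obtain ⟨α₁, β₁, h₁, hu₁, hα, hβ⟩ := h.exists_perturbed hAB.selfAdjoint_left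
    hAB.selfAdjoint_right hK hgram hδ0.le (by linarith) hδ0.le hA₁ hB₁
  have hk : ‖(α₁ - Complex.I • β₁) - (α - Complex.I • β)‖ < δ' := by
    have e : (α₁ - Complex.I • β₁) - (α - Complex.I • β)
        = (α₁ - α) - Complex.I • (β₁ - β) := by
      rw [smul_sub]
      abel
    rw [e]
    have := norm_sub_le (α₁ - α) (Complex.I • (β₁ - β))
    rw [norm_I_smul] at this
    rw [hN] at hδ2
    linarith
  have hm : ‖(α₁ + Complex.I • β₁) - (α + Complex.I • β)‖ < δ' := by
    have e : (α₁ + Complex.I • β₁) - (α + Complex.I • β)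
        = (α₁ - α) + Complex.I • (β₁ - β) := by
      rw [smul_sub]
      abel
    rw [e]
    have := norm_add_le (α₁ - α) (Complex.I • (β₁ - β))
    rw [norm_I_smul] at this
    rw [hN] at hδ2
    linarith
  obtain ⟨-, hQ⟩ := hclose _ _ hk hm
  obtain ⟨v1, v2⟩ := hw _ (isSymmetric_bottOp j _ _) (isCompactOperator_bottOp_sub hj hj' _ _) hQ
  obtain ⟨hdef₁, homega₁⟩ := h₁.omega_eq hu₁ v1 v2
  exact ⟨h₁.isAdmissible (hA₁.isSelfAdjoint hδ0.le (by linarith) hδ0.le hAB.selfAdjoint_left).1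
    (hB₁.isSelfAdjoint hδ0.le (by linarith) hδ0.le hAB.selfAdjoint_right).1 hu₁ hj', hdef₁,
    homega₁.trans homega.symm⟩

end Perturbation

/-! ### Independence of the scale -/

section Scaling

variable {H : Type*} [NormedAddCommGroup H] [InnerProductSpace ℂ H]

/-- The operator `exp(x) A`. -/
noncomputable def expSMul (x : ℝ) (A : H →ₗ.[ℂ] H) : H →ₗ.[ℂ] H := ((Real.exp x : ℝ) : ℂ) • A

theorem expSMul_zero (A : H →ₗ.[ℂ] H) : expSMul 0 A = A := by
  rw [expSMul, Real.exp_zero, Complex.ofReal_one, one_smul]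

theorem isFormalAdjoint_expSMul {A : H →ₗ.[ℂ] H} (hA : A.IsFormalAdjoint A) (x : ℝ) :
    (expSMul x A).IsFormalAdjoint (expSMul x A) := fun u v => by
  change inner ℂ (((Real.exp x : ℝ) : ℂ) • A u) (v : H)
    = inner ℂ (u : H) (((Real.exp x : ℝ) : ℂ) • A v)
  rw [inner_smul_left, inner_smul_right, Complex.conj_ofReal, hA u v]

/-- In logarithmic scale the relative bound `|exp(x' - x) - 1| ≤ 2|x' - x|` depends only on the
difference, hence is uniform over all scales. -/
theorem isRelClose_expSMul {A : H →ₗ.[ℂ] H} (hA : A.IsFormalAdjoint A) {x x' : ℝ}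
    (hx : |x' - x| ≤ 1) : IsRelClose (2 * |x' - x|) 0 (expSMul x A) (expSMul x' A) where
  symmetric := isFormalAdjoint_expSMul hA x'
  domain_le := le_rfl
  bound u hu := by
    change ‖((Real.exp x' : ℝ) : ℂ) • A ⟨u, hu⟩ - ((Real.exp x : ℝ) : ℂ) • A ⟨u, hu⟩‖
      ≤ 2 * |x' - x| * ‖((Real.exp x : ℝ) : ℂ) • A ⟨u, hu⟩‖ + 0 * ‖u‖
    have e : Real.exp x' - Real.exp x = Real.exp x * (Real.exp (x' - x) - 1) := by
      rw [mul_sub, ← Real.exp_add, add_sub_cancel, mul_one]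
    rw [← sub_smul, ← Complex.ofReal_sub, norm_smul, norm_smul, Complex.norm_real,
      Complex.norm_real, e, norm_mul, Real.norm_eq_abs (Real.exp (x' - x) - 1)]
    have h1 := Real.abs_exp_sub_one_le hx
    have h2 : 0 ≤ ‖Real.exp x‖ * ‖A ⟨u, hu⟩‖ := by positivity
    nlinarith [mul_le_mul_of_nonneg_left h1 h2]

theorem IsRelClose.mono {a b a' b' : ℝ} {A A₁ : H →ₗ.[ℂ] H} (h : IsRelClose a b A A₁)
    (ha : a ≤ a') (hb : b ≤ b') : IsRelClose a' b' A A₁ where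
  symmetric := h.symmetric
  domain_le := h.domain_le
  bound x hx := (h.bound x hx).trans <| add_le_add
    (mul_le_mul_of_nonneg_right ha (norm_nonneg _)) (mul_le_mul_of_nonneg_right hb (norm_nonneg _))

theorem IsCommutator.smul {A B : H →ₗ.[ℂ] H} {K : H →L[ℂ] H} (hK : IsCommutator A B K) (s t : ℝ) :
    IsCommutator ((s : ℂ) • A) ((t : ℂ) • B) (((s * t : ℝ) : ℂ) • K) := by
  intro x y hxA hxB hyA hyB
  have h := hK x y hxA hxB hyA hyB
  change inner ℂ ((s : ℂ) • A ⟨x, hxA⟩) ((t : ℂ) • B ⟨y, hyB⟩)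
    - inner ℂ ((t : ℂ) • B ⟨x, hxB⟩) ((s : ℂ) • A ⟨y, hyA⟩) = inner ℂ x (((s * t : ℝ) : ℂ) • K y)
  simp only [inner_smul_left, inner_smul_right, Complex.conj_ofReal, ← h, Complex.ofReal_mul]
  ring

theorem IsCommutator.unique {A B : H →ₗ.[ℂ] H} {K K' : H →L[ℂ] H} (hK : IsCommutator A B K)
    (hK' : IsCommutator A B K') (hd : Dense ((A.domain ⊓ B.domain : Submodule ℂ H) : Set H)) :
    K = K' := by
  refine ContinuousLinearMap.coeFn_injective (K.continuous.ext_on hd K'.continuous fun y hy => ?_)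
  refine hd.eq_of_inner_right ℂ fun x hx => ?_
  rw [← hK x y hx.1 hx.2 hy.1 hy.2, ← hK' x y hx.1 hx.2 hy.1 hy.2]

variable [CompleteSpace H]

/-- Different factors on `A` and `B` genuinely change `C`. A step of fixed length `1/10` has
relative bound at most `1/5 < 1/4` and preserves admissibility, so the admissible scales form a
clopen subset of the plane. -/
theorem IsAdmissible.expSMul {A B : H →ₗ.[ℂ] H} {K : H →L[ℂ] H} (hAB : IsAdmissible A B)
    (hK : IsCommutator A B K) (p : ℝ × ℝ) :
    IsAdmissible (expSMul p.1 A) (expSMul p.2 B) := by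
  have step : ∀ p p' : ℝ × ℝ, dist p' p < 1 / 10 →
      IsAdmissible (OperatorPair.expSMul p.1 A) (OperatorPair.expSMul p.2 B) →
      IsAdmissible (OperatorPair.expSMul p'.1 A) (OperatorPair.expSMul p'.2 B) := by
    intro p p' hp h
    rw [Prod.dist_eq, max_lt_iff, Real.dist_eq, Real.dist_eq] at hp
    refine h.perturb (hK.smul _ _) (a := 1 / 5) (b := 0) (by norm_num) (by norm_num) le_rfl ?_ ?_
    · exact (isRelClose_expSMul (IsSelfAdjoint.isFormalAdjoint hAB.selfAdjoint_left)
        (by linarith)).mono (by linarith) le_rfl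
    · exact (isRelClose_expSMul (IsSelfAdjoint.isFormalAdjoint hAB.selfAdjoint_right)
        (by linarith)).mono (by linarith) le_rfl
  have hclopen : IsClopen {p : ℝ × ℝ |
      IsAdmissible (OperatorPair.expSMul p.1 A) (OperatorPair.expSMul p.2 B)} := by
    constructor
    · rw [← isOpen_compl_iff, Metric.isOpen_iff]
      exact fun p hp => ⟨1 / 10, by norm_num, fun p' hp' h =>
        hp (step p' p (by rwa [dist_comm]) h)⟩
    · rw [Metric.isOpen_iff]
      exact fun p hp => ⟨1 / 10, by norm_num, fun p' hp' => step p p' hp' hp⟩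
  have huniv := hclopen.eq_univ ⟨(0, 0), by
    simpa only [Set.mem_ofPred_eq, expSMul_zero] using hAB⟩
  exact huniv.symm.subset (Set.mem_univ p)

theorem norm_commutator_expSMul (K : H →L[ℂ] H) (x y : ℝ) :
    ‖((Real.exp x * Real.exp y : ℝ) : ℂ) • K‖ = Real.exp (x + y) * ‖K‖ := by
  rw [norm_smul, Complex.norm_real, ← Real.exp_add, Real.norm_of_nonneg (Real.exp_pos _).le]

/-- The logarithmic scales at which the commutator is small. -/
def smallScales (K : H →L[ℂ] H) : Set (ℝ × ℝ) := {p | Real.exp (p.1 + p.2) * ‖K‖ < 0.02}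

-- A sublevel set of a convex function is convex.
omit [CompleteSpace H] in
theorem isPreconnected_smallScales (K : H →L[ℂ] H) : IsPreconnected (smallScales K) := by
  have h1 : ConvexOn ℝ Set.univ fun p : ℝ × ℝ => Real.exp (p.1 + p.2) :=
    convexOn_exp.comp_linearMap (LinearMap.fst ℝ ℝ ℝ + LinearMap.snd ℝ ℝ ℝ)
  have h2 : ConvexOn ℝ Set.univ fun p : ℝ × ℝ => ‖K‖ * Real.exp (p.1 + p.2) :=
    h1.smul (norm_nonneg K)
  have h3 := (h2.convex_lt 0.02).isPreconnected
  have e : smallScales K = {p | p ∈ Set.univ ∧ ‖K‖ * Real.exp (p.1 + p.2) < 0.02} := by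
    ext p
    simp only [smallScales, Set.mem_ofPred_eq, Set.mem_univ, true_and, mul_comm]
  rw [e]
  exact h3

omit [CompleteSpace H] in
theorem nonempty_smallScales (K : H →L[ℂ] H) : (smallScales K).Nonempty := by
  refine ⟨(Real.log (0.01 / (‖K‖ + 1)), 0), ?_⟩
  change Real.exp (Real.log (0.01 / (‖K‖ + 1)) + 0) * ‖K‖ < 0.02
  rw [add_zero, Real.exp_log (by positivity), div_mul_eq_mul_div, div_lt_iff₀ (by positivity)]
  nlinarith [norm_nonneg K]

variable [TopologicalSpace.SeparableSpace H]

theorem IsAdmissible.omegaDefined_expSMul {A B : H →ₗ.[ℂ] H} {K : H →L[ℂ] H}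
    (hAB : IsAdmissible A B) (hK : IsCommutator A B K) {p : ℝ × ℝ} (hp : p ∈ smallScales K) :
    OmegaDefined (OperatorPair.expSMul p.1 A) (OperatorPair.expSMul p.2 B) ∧
    ∃ δ > 0, ∀ A₁ B₁ : H →ₗ.[ℂ] H, IsRelClose δ δ (OperatorPair.expSMul p.1 A) A₁ →
      IsRelClose δ δ (OperatorPair.expSMul p.2 B) B₁ →
      omega A₁ B₁ = omega (OperatorPair.expSMul p.1 A) (OperatorPair.expSMul p.2 B) := by
  obtain ⟨h1, δ, hδ, h2⟩ := (hAB.expSMul hK p).exists_omega_eq_of_isRelClose (hK.smul _ _)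
    (by rw [norm_commutator_expSMul]; exact hp)
  exact ⟨h1, δ, hδ, fun A₁ B₁ hA hB => (h2 A₁ B₁ hA hB).2.2⟩

/-- A locally constant function on a connected set is constant. -/
theorem IsAdmissible.omega_expSMul_eq {A B : H →ₗ.[ℂ] H} {K : H →L[ℂ] H}
    (hAB : IsAdmissible A B) (hK : IsCommutator A B K) {p p' : ℝ × ℝ} (hp : p ∈ smallScales K)
    (hp' : p' ∈ smallScales K) :
    omega (OperatorPair.expSMul p.1 A) (OperatorPair.expSMul p.2 B)
      = omega (OperatorPair.expSMul p'.1 A) (OperatorPair.expSMul p'.2 B) := by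
  refine (isPreconnected_smallScales K).constant
    (f := fun p => omega (OperatorPair.expSMul p.1 A) (OperatorPair.expSMul p.2 B)) ?_ hp hp'
  intro q hq
  obtain ⟨-, δ, hδ, h⟩ := hAB.omegaDefined_expSMul hK hq
  refine ContinuousAt.continuousWithinAt ?_
  refine tendsto_nhds_of_eventually_eq ?_
  filter_upwards [Metric.ball_mem_nhds q (lt_min one_pos (half_pos hδ))] with q' hq'
  rw [Metric.mem_ball, Prod.dist_eq, max_lt_iff, lt_min_iff, lt_min_iff, Real.dist_eq,
    Real.dist_eq] at hq'
  exact h _ _ ((isRelClose_expSMul (IsSelfAdjoint.isFormalAdjoint hAB.selfAdjoint_left)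
      (by linarith)).mono (by linarith) hδ.le)
    ((isRelClose_expSMul (IsSelfAdjoint.isFormalAdjoint hAB.selfAdjoint_right)
      (by linarith)).mono (by linarith) hδ.le)

theorem IsAdmissible.scaledOmega_eq {A B : H →ₗ.[ℂ] H} {K : H →L[ℂ] H}
    (hAB : IsAdmissible A B) (hK : IsCommutator A B K) {p : ℝ × ℝ} (hp : p ∈ smallScales K) :
    ScaledOmegaDefined A B ∧
      scaledOmega A B = omega (OperatorPair.expSMul p.1 A) (OperatorPair.expSMul p.2 B) := by
  have hexists : HasScaledOmega A B
      (omega (OperatorPair.expSMul p.1 A) (OperatorPair.expSMul p.2 B)) := by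
    refine ⟨⟨K, hK⟩, fun s t hs ht K' hK' hlt => ?_⟩
    have hs' : ((s : ℝ) : ℂ) • A = OperatorPair.expSMul (Real.log s) A := by
      rw [OperatorPair.expSMul, Real.exp_log hs]
    have ht' : ((t : ℝ) : ℂ) • B = OperatorPair.expSMul (Real.log t) B := by
      rw [OperatorPair.expSMul, Real.exp_log ht]
    have hp' : (Real.log s, Real.log t) ∈ smallScales K := by
      -- Density of the common domain makes the commutator unique, so smallness of `K'` is exactly
      -- membership of the scale in `smallScales K`.
      have e : K' = ((s * t : ℝ) : ℂ) • K := hK'.unique (hK.smul s t) hAB.dense_domain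
      rw [e] at hlt
      change Real.exp (Real.log s + Real.log t) * ‖K‖ < 0.02
      rwa [← norm_commutator_expSMul, Real.exp_log hs, Real.exp_log ht]
    rw [hs', ht', hAB.omega_expSMul_eq hK hp hp']
    exact hasOmega_omega (hAB.omegaDefined_expSMul hK hp').1
  have hunique : ∀ w, HasScaledOmega A B w →
      w = omega (OperatorPair.expSMul p.1 A) (OperatorPair.expSMul p.2 B) := by
    intro w hw
    have h1 := hw.2 _ _ (Real.exp_pos p.1) (Real.exp_pos p.2) _ (hK.smul _ _)
      (by rw [norm_commutator_expSMul]; exact hp)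
    have h2 := (hAB.omegaDefined_expSMul hK hp).1
    exact h2.unique h1 (hasOmega_omega h2)
  have hd : ScaledOmegaDefined A B := ⟨_, hexists, hunique⟩
  refine ⟨hd, ?_⟩
  rw [scaledOmega, dif_pos hd]
  exact hunique _ hd.choose_spec.1

end Scaling

/-! ### Adding a bounded operator commuting with `B` -/

section BoundedPerturbation

variable {H : Type*} [NormedAddCommGroup H] [InnerProductSpace ℂ H] [CompleteSpace H]

omit [CompleteSpace H] in
theorem addBounded_domain (A : H →ₗ.[ℂ] H) (T : H →L[ℂ] H) :
    (addBounded A T).domain = A.domain := inf_top_eq _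

omit [CompleteSpace H] in
theorem addBounded_apply (A : H →ₗ.[ℂ] H) (T : H →L[ℂ] H) (x : H) (hx : x ∈ A.domain)
    (hx' : x ∈ (addBounded A T).domain) : addBounded A T ⟨x, hx'⟩ = A ⟨x, hx⟩ + T x := rfl

omit [CompleteSpace H] in
theorem addBounded_zero (A : H →ₗ.[ℂ] H) : addBounded A 0 = A :=
  LinearPMap.ext (addBounded_domain A 0) fun x hx hx' => by
    rw [addBounded_apply A 0 x hx' hx]
    exact add_zero _

theorem isFormalAdjoint_addBounded {A : H →ₗ.[ℂ] H} (hA : A.IsFormalAdjoint A) {T : H →L[ℂ] H}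
    (hT : IsSelfAdjoint T) : (addBounded A T).IsFormalAdjoint (addBounded A T) := by
  rintro ⟨x, hx⟩ ⟨y, hy⟩
  rw [addBounded_apply A T x hx.1 hx, addBounded_apply A T y hy.1 hy]
  have h1 : inner ℂ (T x) y = inner ℂ x (T y) := hT.isSymmetric x y
  have h2 := hA ⟨x, hx.1⟩ ⟨y, hy.1⟩
  change inner ℂ (A ⟨x, hx.1⟩ + T x) y = inner ℂ x (A ⟨y, hy.1⟩ + T y)
  rw [inner_add_left, inner_add_right, h1]
  exact congrArg (· + inner ℂ x (T y)) h2

/-- The extra terms cancel: `⟨Bx, Ty⟩ = ⟨x, BTy⟩ = ⟨x, TBy⟩ = ⟨Tx, By⟩`. -/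
theorem IsCommutator.addBounded {A B : H →ₗ.[ℂ] H} {K T : H →L[ℂ] H} (hK : IsCommutator A B K)
    (hB : B.IsFormalAdjoint B) (hT : IsSelfAdjoint T) (hTB : CommutesWith T B) :
    IsCommutator (addBounded A T) B K := by
  intro x y hxA hxB hyA hyB
  have h := hK x y hxA.1 hxB hyA.1 hyB
  rw [addBounded_apply A T x hxA.1 hxA, addBounded_apply A T y hyA.1 hyA, inner_add_left,
    inner_add_right]
  have h1 : inner ℂ (T x) (B ⟨y, hyB⟩) = inner ℂ x (T (B ⟨y, hyB⟩)) := hT.isSymmetric x _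
  have h2 := isFormalAdjoint_graph hB (LinearPMap.mem_graph B ⟨x, hxB⟩)
    (hTB _ _ (LinearPMap.mem_graph B ⟨y, hyB⟩))
  rw [h1, h2]
  linear_combination h

theorem isRelClose_expSMul_addBounded {A : H →ₗ.[ℂ] H} (hA : A.IsFormalAdjoint A)
    {T T' : H →L[ℂ] H} (hT' : IsSelfAdjoint T') (x : ℝ) :
    IsRelClose 0 (Real.exp x * ‖T' - T‖) (expSMul x (addBounded A T))
      (expSMul x (addBounded A T')) where
  symmetric := isFormalAdjoint_expSMul (isFormalAdjoint_addBounded hA hT') x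
  domain_le := le_rfl
  bound u hu := by
    change ‖((Real.exp x : ℝ) : ℂ) • (A ⟨u, hu.1⟩ + T' u)
      - ((Real.exp x : ℝ) : ℂ) • (A ⟨u, hu.1⟩ + T u)‖ ≤ _
    rw [← smul_sub, add_sub_add_left_eq_sub, norm_smul, Complex.norm_real,
      Real.norm_of_nonneg (Real.exp_pos x).le, ← sub_apply, zero_mul, zero_add, mul_assoc]
    exact mul_le_mul_of_nonneg_left ((T' - T).le_opNorm u) (Real.exp_pos x).le

omit [CompleteSpace H] in
theorem isRelClose_self {A : H →ₗ.[ℂ] H} (hA : A.IsFormalAdjoint A) : IsRelClose 0 0 A A where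
  symmetric := hA
  domain_le := le_rfl
  bound u hu := by simp

/-- A bounded perturbation has relative bound `0`, and only that constant must be small; so `T` may
have any norm. -/
theorem IsAdmissible.addBounded {A B : H →ₗ.[ℂ] H} {K T : H →L[ℂ] H} (hAB : IsAdmissible A B)
    (hK : IsCommutator A B K) (hT : IsSelfAdjoint T) : IsAdmissible (addBounded A T) B := by
  have h := isRelClose_expSMul_addBounded (T := 0)
    (IsSelfAdjoint.isFormalAdjoint hAB.selfAdjoint_left) hT 0
  rw [expSMul_zero, expSMul_zero, addBounded_zero] at h
  exact hAB.perturb hK le_rfl (by norm_num) (by positivity) h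
    ((isRelClose_self (IsSelfAdjoint.isFormalAdjoint hAB.selfAdjoint_right)).mono le_rfl
      (by positivity))

theorem IsAdmissible.scaledOmega_addBounded [TopologicalSpace.SeparableSpace H]
    {A B : H →ₗ.[ℂ] H} {K T : H →L[ℂ] H} (hAB : IsAdmissible A B) (hK : IsCommutator A B K)
    (hT : IsSelfAdjoint T) (hTB : CommutesWith T B) :
    scaledOmega (OperatorPair.addBounded A T) B = scaledOmega A B := by
  obtain ⟨p, hp⟩ := nonempty_smallScales K
  have hA := IsSelfAdjoint.isFormalAdjoint hAB.selfAdjoint_left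
  have hB := IsSelfAdjoint.isFormalAdjoint hAB.selfAdjoint_right
  have hT' : ∀ r : ℝ, IsSelfAdjoint ((r : ℂ) • T) := fun r =>
    IsSelfAdjoint.smul (Complex.conj_ofReal r) hT
  have hTB' : ∀ r : ℝ, CommutesWith ((r : ℂ) • T) B := fun r x y hxy =>
    B.graph.smul_mem (r : ℂ) (hTB x y hxy)
  have hadm : ∀ r : ℝ, IsAdmissible (OperatorPair.addBounded A ((r : ℂ) • T)) B := fun r =>
    hAB.addBounded hK (hT' r)
  have hcom : ∀ r : ℝ, IsCommutator (OperatorPair.addBounded A ((r : ℂ) • T)) B K := fun r =>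
    hK.addBounded hB (hT' r) (hTB' r)
  -- The homotopy `r ↦ A + rT` keeps the commutator equal to `K`, so the scale `p` is good for every
  -- `r`, and `ω` at this scale is locally constant in `r`.
  have hconst := isPreconnected_univ.constant (x := (1 : ℝ)) (y := 0)
    (f := fun r : ℝ => omega (OperatorPair.expSMul p.1 (OperatorPair.addBounded A ((r : ℂ) • T)))
      (OperatorPair.expSMul p.2 B)) (fun r _ => by
      obtain ⟨-, δ, hδ, h⟩ := (hadm r).omegaDefined_expSMul (hcom r) hp
      refine ContinuousAt.continuousWithinAt ?_
      refine tendsto_nhds_of_eventually_eq ?_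
      have hN : 0 < Real.exp p.1 * (‖T‖ + 1) := by positivity
      filter_upwards [Metric.ball_mem_nhds r (by positivity : 0 < δ / (Real.exp p.1 * (‖T‖ + 1)))]
        with r' hr'
      rw [Metric.mem_ball, Real.dist_eq, lt_div_iff₀ hN] at hr'
      refine h _ _ ((isRelClose_expSMul_addBounded hA (hT' r') p.1).mono hδ.le ?_)
        ((isRelClose_self (isFormalAdjoint_expSMul hB p.2)).mono hδ.le hδ.le)
      rw [← sub_smul, ← Complex.ofReal_sub, norm_smul, Complex.norm_real, Real.norm_eq_abs]
      have := mul_nonneg (abs_nonneg (r' - r)) (Real.exp_pos p.1).le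
      nlinarith) (Set.mem_univ _) (Set.mem_univ _)
  simp only [Complex.ofReal_one, one_smul, Complex.ofReal_zero, zero_smul, addBounded_zero]
    at hconst
  rw [(hAB.scaledOmega_eq hK hp).2,
    ((hAB.addBounded hK hT).scaledOmega_eq (hK.addBounded hB hT hTB) hp).2, hconst]

omit [CompleteSpace H] in
theorem RelTendsto.eventually_isRelClose {An : ℕ → H →ₗ.[ℂ] H} {A : H →ₗ.[ℂ] H}
    (h : RelTendsto An A) {δ : ℝ} (hδ : 0 < δ) : ∀ᶠ n in atTop, IsRelClose δ δ A (An n) := by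
  obtain ⟨a, b, ha, hb, hbound⟩ := h.bound
  filter_upwards [ha.eventually_le_const hδ, hb.eventually_le_const hδ] with n han hbn
  exact IsRelClose.mono ⟨h.symmetric n, h.domain_le n, hbound n⟩ han hbn

end BoundedPerturbation

end OperatorPair

theorem mainTheorem5 {H : Type*} [NormedAddCommGroup H] [InnerProductSpace ℂ H] [CompleteSpace H]
    [TopologicalSpace.SeparableSpace H] :
    (∀ (A B : H →ₗ.[ℂ] H) (K : H →L[ℂ] H) (An Bm : ℕ → H →ₗ.[ℂ] H) (Knm : ℕ → ℕ → H →L[ℂ] H),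
      OperatorPair.IsAdmissible A B →
      OperatorPair.IsCommutator A B K →
      ‖K‖ < 0.02 →
      OperatorPair.RelTendsto An A →
      OperatorPair.RelTendsto Bm B →
      (∀ᶠ p : ℕ × ℕ in atTop,
        OperatorPair.IsCommutator (An p.1) (Bm p.2) (Knm p.1 p.2)) →
      Tendsto (fun p : ℕ × ℕ => Knm p.1 p.2) atTop (𝓝 K) →
      OperatorPair.OmegaDefined A B ∧
      ∀ᶠ p : ℕ × ℕ in atTop,
        OperatorPair.IsAdmissible (An p.1) (Bm p.2) ∧
        OperatorPair.OmegaDefined (An p.1) (Bm p.2) ∧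
        OperatorPair.omega (An p.1) (Bm p.2) = OperatorPair.omega A B) ∧
    (∀ (A B : H →ₗ.[ℂ] H) (K T : H →L[ℂ] H),
      OperatorPair.IsAdmissible A B →
      OperatorPair.IsCommutator A B K →
      IsSelfAdjoint T →
      OperatorPair.CommutesWith T B →
      OperatorPair.IsAdmissible (OperatorPair.addBounded A T) B ∧
      OperatorPair.IsCommutator (OperatorPair.addBounded A T) B K ∧
      OperatorPair.ScaledOmegaDefined A B ∧
      OperatorPair.ScaledOmegaDefined (OperatorPair.addBounded A T) B ∧
      OperatorPair.scaledOmega (OperatorPair.addBounded A T) B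
        = OperatorPair.scaledOmega A B) := by
  refine ⟨fun A B K An Bm Knm hAB hK hlt hAn hBm _ _ => ?_, fun A B K T hAB hK hT hTB => ?_⟩
  · obtain ⟨hdef, δ, hδ, h⟩ := hAB.exists_omega_eq_of_isRelClose hK hlt
    refine ⟨hdef, ?_⟩
    rw [← prod_atTop_atTop_eq]
    filter_upwards [tendsto_fst.eventually (hAn.eventually_isRelClose hδ),
      tendsto_snd.eventually (hBm.eventually_isRelClose hδ)] with p hA hB
    exact h _ _ hA hB
  · have hadm := hAB.addBounded hK hT
    have hcom := hK.addBounded (OperatorPair.IsSelfAdjoint.isFormalAdjoint hAB.selfAdjoint_right)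
      hT hTB
    obtain ⟨p, hp⟩ := OperatorPair.nonempty_smallScales K
    exact ⟨hadm, hcom, (hAB.scaledOmega_eq hK hp).1, (hadm.scaledOmega_eq hcom hp).1,
      hAB.scaledOmega_addBounded hK hT hTB⟩
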